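/- Fix arbitrary complex numbers $c,\theta_*,\theta_t,\theta_0,\nu$ and put $\Delta(\theta)=\frac{c-1}{24}+\theta^2$, $\Delta_t=\Delta(\theta_t)$, $\Delta_0=\Delta(\theta_0)$. All modules are modules over the Virasoro algebra with central charge $c$. **Whittaker modules and the irregular vertex operator.** For $\lambda_1,\lambda_2\in\mathbb C$ let $\mathcal W_{\lambda_1,\lambda_2}$ be the universal right module generated by a vector $\langle\lambda_1,\lambda_2|$ with $\langle\lambda_1,\lambda_2|L_{-1}=\lambda_1\langle\lambda_1,\lambda_2|$, $\langle\lambda_1,\lambda_2|L_{-2}=\lambda_2\langle\lambda_1,\lambda_2|$ and $\langle\lambda_1,\lambda_2|L_n=0$ for $n\le-3$. Let $\mathcal M_\Delta$ be the Verma module with highest weight vector $|\Delta\rangle$. The canonical pairing $\mathcal W_{\lambda_1,\lambda_2}\times\mathcal M_{\Delta}\to\mathbb C$ is the bilinear form with $\langle uL_n|x\rangle=\langle u|L_nx\rangle$ for all $n\in\mathbb Z$ and $\langle\lambda_1,\lambda_2|\Delta\rangle=1$. Let $W(t)$ be the operator from $\mathcal W_{\theta_*,\frac14}$ to formal series with coefficients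 in $\mathcal W_{\frac{\theta_*}2-\nu,\frac14}$ such that $[L_n,W(t)]=t^n\bigl(t\frac{\partial}{\partial t}+(n+1)\Delta_t\bigr)W(t)$ for all $n\in\mathbb Z$ and $$\langle\theta_*,\tfrac14|W(t)=t^{\frac{\theta_*^2}2-2\nu^2}e^{(\frac{\theta_*}2+\nu)t}\Bigl[\langle\tfrac{\theta_*}2-\nu,\tfrac14|+\sum_{n\ge1}t^{-n}\langle w_n|\Bigr],\qquad \langle w_n|\in\mathcal W_{\frac{\theta_*}2-\nu,\frac14}.$$ **Regular blocks.** For $\theta_1,\theta_t,\theta_\infty,\theta_0,\sigma\in\mathbb C$ let $\mathcal F_k\bigl(\begin{smallmatrix}\theta_1\;\;\theta_t\\ \sigma\\ \theta_\infty\;\;\theta_0\end{smallmatrix}\bigr)$, $k\ge0$, be the coefficients of the regular 4-point conformal block $$\langle\Delta_\infty|V^{\Delta_1}_{\Delta_\infty,\Delta}(1)V^{\Delta_t}_{\Delta,\Delta_0}(t)|\Delta_0\rangle=t^{\Delta-\Delta_0-\Delta_t}\sum_{k\ge0}\mathcal F_kt^k,\qquad \Delta=\Delta(\sigma),\ \Delta_i=\Delta(\theta_i),$$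 where $V^{\Delta_2}_{\Delta_1,\Delta_3}(z)$ is the chiral vertex operator from the dual Verma module $\mathcal M^*_{\Delta_1}$ to $\mathcal M^*_{\Delta_3}$, determined by $[L_n,V(z)]=z^n\bigl(z\frac{\partial}{\partial z}+(n+1)\Delta_2\bigr)V(z)$ for all $n\in\mathbb Z$ and $\langle\Delta_1|V(z)=z^{\Delta_1-\Delta_2-\Delta_3}\bigl[\langle\Delta_3|+\sum_{n\ge1}z^{-n}\langle v_n|\bigr]$. For $\Lambda\in\mathbb C$ write $F_k(\Lambda)=\mathcal F_k\bigl(\begin{smallmatrix}\frac{\Lambda+\theta_*}2\;\;\theta_t\\ \frac\Lambda2+\nu\\ \theta_0\;\;\frac{\Lambda-\theta_*}2\end{smallmatrix}\bigr)$ for the coefficients of the block that enters the confluent ($u$-channel) limit. **Theorem A.** The operator $W(t)$ and the canonical pairing of $\mathcal W_{\frac{\theta_*}2-\nu,\frac14}$ with $\mathcal M_{\Delta_0}$ exist and are unique. For every $k\ge0$ the coefficient $F_k(\Lambda)$ is well defined for all $\Lambda\in\mathbb C$ with $|\Lambda|$ sufficiently large, and the coefficient of $t^{-k}$ in $$\Bigl(1-\frac\Lambda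 t\Bigr)^{(\frac{\theta_*}2+\nu)\Lambda+\frac{\theta_*^2}4+\Delta_t-\nu^2}\ \sum_{l\ge0}F_l(\Lambda)\Bigl(\frac\Lambda t\Bigr)^l\in\mathbb C[[t^{-1}]]$$ (the power being expanded by the binomial series) has a finite limit $\mathcal D_k\in\mathbb C$ as $\Lambda\to\infty$. Moreover, as formal series, $$\langle\theta_*,\tfrac14|W(t)|\Delta_0\rangle=t^{\frac{\theta_*^2}2-2\nu^2}e^{(\frac{\theta_*}2+\nu)t}\sum_{k=0}^\infty\mathcal D_kt^{-k}.$$ -/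

import Mathlib

open Filter Topology

noncomputable section

namespace ConfBlock

/-! ### The Virasoro algebra with central charge `c` -/

/-- The Virasoro relations
`[L_m, L_n] = (m - n) L_{m+n} + (c / 12) (m ^ 3 - m) δ_{m+n,0}`. -/
inductive VirRel (c : ℂ) : FreeAlgebra ℂ ℤ → FreeAlgebra ℂ ℤ → Prop
  | comm (m n : ℤ) : VirRel c
      (FreeAlgebra.ι ℂ m * FreeAlgebra.ι ℂ n - FreeAlgebra.ι ℂ n * FreeAlgebra.ι ℂ m)
      (((m : ℂ) - (n : ℂ)) • FreeAlgebra.ι ℂ (m + n) +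
        algebraMap ℂ (FreeAlgebra ℂ ℤ)
          (if m + n = 0 then c / 12 * ((m : ℂ) ^ 3 - (m : ℂ)) else 0))

/-- The universal enveloping algebra of the Virasoro algebra in which the central element has been
set equal to the number `c`. -/
abbrev VirU (c : ℂ) : Type := RingQuot (VirRel c)

/-- The Virasoro generator `L_n`. -/
def L (c : ℂ) (n : ℤ) : VirU c := RingQuot.mkAlgHom ℂ (VirRel c) (FreeAlgebra.ι ℂ n)

/-! ### Verma modules (ket vectors; left modules) -/

/-- The left ideal generated by `L_n`, `n > 0`, and `L_0 - Δ`. -/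
def vermaIdeal (c Δ : ℂ) : Submodule (VirU c) (VirU c) :=
  Submodule.span (VirU c)
    ({x | ∃ n : ℤ, 0 < n ∧ x = L c n} ∪ {L c 0 - algebraMap ℂ (VirU c) Δ})

/-- The Verma module `M_Δ`. -/
abbrev Verma (c Δ : ℂ) : Type := VirU c ⧸ vermaIdeal c Δ

/-- The highest weight vector `|Δ⟩`. -/
def ket (c Δ : ℂ) : Verma c Δ := (vermaIdeal c Δ).mkQ 1

/-- The action of `L_n` on `M_Δ`. -/
def ketAct (c Δ : ℂ) (n : ℤ) : Verma c Δ →ₗ[ℂ] Verma c Δ :=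
  Algebra.lsmul ℂ ℂ (Verma c Δ) (L c n)

/-- The right action of `L_n` on the full linear dual of `M_Δ`: `⟨f| L_n |x⟩ = ⟨f| (L_n |x⟩)`. -/
def dualAct (c Δ : ℂ) (n : ℤ) :
    Module.Dual ℂ (Verma c Δ) →ₗ[ℂ] Module.Dual ℂ (Verma c Δ) :=
  (ketAct c Δ n).dualMap

/-! ### Modules of bra vectors (right modules) -/

/-- The right ideal generated by `L_n - χ n`, `n ∈ S`. -/
def braIdeal (c : ℂ) (S : Set ℤ) (χ : ℤ → ℂ) : Submodule ℂ (VirU c) :=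
  Submodule.span ℂ
    {y | ∃ n ∈ S, ∃ x : VirU c, y = (L c n - algebraMap ℂ (VirU c) (χ n)) * x}

/-- The right module generated by a vector `⟨χ|` subject to the relations
`⟨χ| L_n = χ n ⟨χ|`, `n ∈ S`. -/
abbrev Bra (c : ℂ) (S : Set ℤ) (χ : ℤ → ℂ) : Type := VirU c ⧸ braIdeal c S χ

/-- The generating vector `⟨χ|`. -/
def braVac (c : ℂ) (S : Set ℤ) (χ : ℤ → ℂ) : Bra c S χ := (braIdeal c S χ).mkQ 1

theorem braIdeal_mul_right (c : ℂ) (S : Set ℤ) (χ : ℤ → ℂ) (a : VirU c) :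
    braIdeal c S χ ≤ (braIdeal c S χ).comap (LinearMap.mulRight ℂ a) := by
  unfold braIdeal
  rw [Submodule.span_le]
  rintro _ ⟨n, hn, x, rfl⟩
  exact Submodule.subset_span ⟨n, hn, x * a, by simp [mul_assoc]⟩

/-- The right action of `L_n` on bra vectors. -/
def braAct (c : ℂ) (S : Set ℤ) (χ : ℤ → ℂ) (n : ℤ) : Bra c S χ →ₗ[ℂ] Bra c S χ :=
  (braIdeal c S χ).mapQ (braIdeal c S χ) (LinearMap.mulRight ℂ (L c n))
    (braIdeal_mul_right c S χ (L c n))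

/-- The index set of the relations in the dual Verma modules. -/
def dualSet : Set ℤ := {n | n ≤ 0}

/-- `⟨Δ| L_0 = Δ ⟨Δ|` and `⟨Δ| L_n = 0` for `n < 0`. -/
def dualChar (Δ : ℂ) (n : ℤ) : ℂ := if n = 0 then Δ else 0

/-- The dual Verma module `M*_Δ`, generated by `⟨Δ|`. -/
abbrev DualVerma (c Δ : ℂ) : Type := Bra c dualSet (dualChar Δ)

/-- The index set of the relations in the Whittaker modules of rank 1. -/
def whitSet : Set ℤ := {n | n < 0}

/-- `⟨l₁, l₂| L_{-1} = l₁ ⟨l₁, l₂|`, `⟨l₁, l₂| L_{-2} = l₂ ⟨l₁, l₂|` and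
`⟨l₁, l₂| L_n = 0` for `n ≤ -3`. -/
def whitChar (l₁ l₂ : ℂ) (n : ℤ) : ℂ := if n = -1 then l₁ else if n = -2 then l₂ else 0

/-- The Whittaker module of rank 1 generated by `⟨l₁, l₂|`. -/
abbrev Whittaker (c l₁ l₂ : ℂ) : Type := Bra c whitSet (whitChar l₁ l₂)

/-- `p` is the canonical pairing between bra vectors and `M_Δ`: it is compatible with the
actions of the Virasoro algebra, `⟨u L_n | x⟩ = ⟨u | L_n x⟩`, and normalized by `⟨χ|Δ⟩ = 1`. -/
def IsCanonicalPairing (c : ℂ) (S : Set ℤ) (χ : ℤ → ℂ) (Δ : ℂ)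
    (p : Bra c S χ →ₗ[ℂ] Module.Dual ℂ (Verma c Δ)) : Prop :=
  (∀ (n : ℤ) (u : Bra c S χ) (x : Verma c Δ), p (braAct c S χ n u) x = p u (ketAct c Δ n x)) ∧
    p (braVac c S χ) (ket c Δ) = 1

/-! ### Formal series and vertex operators

A function `f : ℤ → N` stands for the formal expression `t ^ a * exp (b * t) * ∑_k f k * t ^ k`,
where the exponents `a` and `b` are kept track of separately. -/

section VertexOperators

variable {M N : Type} [AddCommGroup M] [Module ℂ M] [AddCommGroup N] [Module ℂ N]

/-- The operator `t ∂/∂t` on expressions `t ^ a * exp (b * t) * ∑_k f k * t ^ k`. -/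
def euler (a b : ℂ) (f : ℤ → N) : ℤ → N := fun k => ((k : ℂ) + a) • f k + b • f (k - 1)

/-- Multiplication by `t ^ n`. -/
def tpow (n : ℤ) (f : ℤ → N) : ℤ → N := fun k => f (k - n)

/-- The commutation relations of a chiral vertex operator `V(t)` of weight `Δ`, which acts on bra
vectors: for the right actions `actM`, `actN` of the Virasoro generators on `M` and `N`,
`⟨u| (L_n V(t) - V(t) L_n) = t ^ n (t ∂/∂t + (n + 1) Δ) ⟨u| V(t)`,
where `⟨u| V(t) = t ^ a * exp (b * t) * ∑_k V u k * t ^ k`. -/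
def IsVertexOperator (actM : ℤ → M →ₗ[ℂ] M) (actN : ℤ → N →ₗ[ℂ] N) (Δ a b : ℂ)
    (V : M →ₗ[ℂ] (ℤ → N)) : Prop :=
  ∀ (n : ℤ) (u : M),
    (fun k => V (actM n u) k - actN n (V u k)) =
      tpow n (euler a b (V u) + (((n : ℂ) + 1) * Δ) • V u)

end VertexOperators

/-- The chiral vertex operator `V(z)` of weight `Δ₂` from `M*_{Δ₁}` to `M*_{Δ₃}`, normalized as
`⟨Δ₁| V(z) = z ^ (Δ₁ - Δ₂ - Δ₃) (⟨Δ₃| + ∑_{n ≥ 1} z ^ (-n) ⟨v_n|)`. Its values are considered as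
linear functionals on `M_{Δ₃}`; the bra vector `⟨Δ₃|` is such a functional through the canonical
pairing `p`. -/
def IsRegularVertexOperator (c Δ₁ Δ₂ Δ₃ : ℂ)
    (p : DualVerma c Δ₃ →ₗ[ℂ] Module.Dual ℂ (Verma c Δ₃))
    (V : DualVerma c Δ₁ →ₗ[ℂ] (ℤ → Module.Dual ℂ (Verma c Δ₃))) : Prop :=
  IsVertexOperator (braAct c dualSet (dualChar Δ₁)) (dualAct c Δ₃) Δ₂ (Δ₁ - Δ₂ - Δ₃) 0 V ∧
    V (braVac c dualSet (dualChar Δ₁)) 0 = p (braVac c dualSet (dualChar Δ₃)) ∧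
    ∀ k : ℤ, 0 < k → V (braVac c dualSet (dualChar Δ₁)) k = 0

/-- `z` is the coefficient `F_k` of the regular conformal block
`⟨Δ∞| V^{Δ₁}_{Δ∞,Δ}(1) V^{Δt}_{Δ,Δ₀}(t) |Δ₀⟩ = t ^ (Δ - Δ₀ - Δt) * ∑_k F_k * t ^ k`.
Here `v` is the component `⟨v_k|` of level `k` in the expansion of `⟨Δ∞| V^{Δ₁}_{Δ∞,Δ}`, as a vector
of `M*_Δ`; it is unique if the canonical pairing of `M*_Δ` and `M_Δ` is nondegenerate at
level `k`. -/
def IsRegularBlockCoeff (c Δinf Δ₁ Δ Δt Δ₀ : ℂ) (k : ℕ) (z : ℂ) : Prop :=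
  ∃ (p : DualVerma c Δ →ₗ[ℂ] Module.Dual ℂ (Verma c Δ))
    (p₀ : DualVerma c Δ₀ →ₗ[ℂ] Module.Dual ℂ (Verma c Δ₀))
    (V₁ : DualVerma c Δinf →ₗ[ℂ] (ℤ → Module.Dual ℂ (Verma c Δ)))
    (V₂ : DualVerma c Δ →ₗ[ℂ] (ℤ → Module.Dual ℂ (Verma c Δ₀)))
    (v : DualVerma c Δ),
    IsCanonicalPairing c dualSet (dualChar Δ) Δ p ∧
    IsCanonicalPairing c dualSet (dualChar Δ₀) Δ₀ p₀ ∧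
    IsRegularVertexOperator c Δinf Δ₁ Δ p V₁ ∧
    IsRegularVertexOperator c Δ Δt Δ₀ p₀ V₂ ∧
    braAct c dualSet (dualChar Δ) 0 v = (Δ + k) • v ∧
    p v = V₁ (braVac c dualSet (dualChar Δinf)) (-(k : ℤ)) ∧
    z = V₂ v k (ket c Δ₀)

open Classical in
/-- The coefficient `F_k` of the regular conformal block, wherever it is well defined. -/
def regularBlockCoeff (c Δinf Δ₁ Δ Δt Δ₀ : ℂ) (k : ℕ) : ℂ :=
  if h : ∃! z, IsRegularBlockCoeff c Δinf Δ₁ Δ Δt Δ₀ k z then h.choose else 0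

/-- The conformal dimension with momentum `θ`. -/
def dim (c θ : ℂ) : ℂ := (c - 1) / 24 + θ ^ 2

/-- `IsRegularBlockCoeff` for the block with internal momentum `Λ / 2 + ν` in which the external
momenta are `θ₀` at `∞`, `(Λ + θs) / 2` at `1`, `θt` at `t` and `(Λ - θs) / 2` at `0`. -/
def IsUBlockCoeff (c θs θt ν θ₀ Λ : ℂ) (k : ℕ) (z : ℂ) : Prop :=
  IsRegularBlockCoeff c (dim c θ₀) (dim c ((Λ + θs) / 2)) (dim c (Λ / 2 + ν)) (dim c θt)
    (dim c ((Λ - θs) / 2)) k z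

/-- The coefficients of the same block. -/
def uBlockCoeff (c θs θt ν θ₀ Λ : ℂ) (k : ℕ) : ℂ :=
  regularBlockCoeff c (dim c θ₀) (dim c ((Λ + θs) / 2)) (dim c (Λ / 2 + ν)) (dim c θt)
    (dim c ((Λ - θs) / 2)) k

/-- The generalized binomial coefficient `A (A - 1) ⋯ (A - j + 1) / j!`. -/
def gbinom (A : ℂ) (j : ℕ) : ℂ := (∏ i ∈ Finset.range j, (A - i)) / (j.factorial : ℂ)

/-- The formal power series in `x = 1 / t`
`(1 - Λ x) ^ A * ∑_k F_k * (Λ x) ^ k`,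
with `A = (θs / 2 + ν) Λ + θs ^ 2 / 4 + Δt - ν ^ 2`. It is the rescaled block
`(t / Λ) ^ ((θs / 2 + ν) Λ - θs ^ 2 / 4 - Δt + ν ^ 2) * (1 - Λ / t) ^ A * F (Λ / t)`,
in which the power of `t / Λ` cancels the leading power
`(Λ / t) ^ (Δ - Δ₀ - Δt)` of the block, see `leading_power_cancels`. -/
def rescaledBlock (c θs θt ν θ₀ Λ : ℂ) : PowerSeries ℂ :=
  PowerSeries.mk (fun j =>
      gbinom ((θs / 2 + ν) * Λ + θs ^ 2 / 4 + dim c θt - ν ^ 2) j * (-Λ) ^ j) *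
    PowerSeries.mk (fun l => uBlockCoeff c θs θt ν θ₀ Λ l * Λ ^ l)

theorem leading_power_cancels (c θs θt ν Λ : ℂ) :
    (θs / 2 + ν) * Λ - θs ^ 2 / 4 - dim c θt + ν ^ 2 =
      dim c (Λ / 2 + ν) - dim c ((Λ - θs) / 2) - dim c θt := by
  unfold dim
  ring

/-! ### The irregular vertex operator and the confluent conformal block of the second kind -/

/-- The source of the irregular vertex operator. -/
abbrev IrrSource (c θs : ℂ) : Type := Whittaker c θs (1 / 4)

/-- The target of the irregular vertex operator. -/
abbrev IrrTarget (c θs ν : ℂ) : Type := Whittaker c (θs / 2 - ν) (1 / 4)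

/-- The power of `t` in the normalization of the irregular vertex operator. -/
def irrPower (θs ν : ℂ) : ℂ := θs ^ 2 / 2 - 2 * ν ^ 2

/-- The exponential rate in the normalization of the irregular vertex operator. -/
def irrRate (θs ν : ℂ) : ℂ := θs / 2 + ν

/-- The vertex operator `W(t)` of weight `Δt` from the Whittaker module of `⟨θs, 1/4|` to that of
`⟨θs/2 - ν, 1/4|`, with
`⟨θs, 1/4| W(t) = t ^ (θs^2/2 - 2ν^2) * exp ((θs/2 + ν) t) *
  (⟨θs/2 - ν, 1/4| + ∑_{n ≥ 1} t ^ (-n) ⟨w_n|)`. -/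
def IsIrregularVertexOperator (c θs ν Δt : ℂ)
    (W : IrrSource c θs →ₗ[ℂ] (ℤ → IrrTarget c θs ν)) : Prop :=
  IsVertexOperator (braAct c whitSet (whitChar θs (1 / 4)))
      (braAct c whitSet (whitChar (θs / 2 - ν) (1 / 4))) Δt (irrPower θs ν) (irrRate θs ν) W ∧
    W (braVac c whitSet (whitChar θs (1 / 4))) 0 =
      braVac c whitSet (whitChar (θs / 2 - ν) (1 / 4)) ∧
    ∀ k : ℤ, 0 < k → W (braVac c whitSet (whitChar θs (1 / 4))) k = 0

/-- The formal expression `t ^ power * exp (rate * t) * ∑_k coeff k * t ^ k`. -/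
structure ExpSeries where
  /-- the exponent of the power of `t` -/
  power : ℂ
  /-- the rate of the exponential -/
  rate : ℂ
  /-- the coefficients of the series -/
  coeff : ℤ → ℂ

/-- The irregular block `⟨θs, 1/4| W(t) |Δ₀⟩`. -/
def irregularBlock (c θs ν Δ₀ : ℂ)
    (p : IrrTarget c θs ν →ₗ[ℂ] Module.Dual ℂ (Verma c Δ₀))
    (W : IrrSource c θs →ₗ[ℂ] (ℤ → IrrTarget c θs ν)) : ExpSeries where
  power := irrPower θs ν
  rate := irrRate θs ν
  coeff := fun k => p (W (braVac c whitSet (whitChar θs (1 / 4))) k) (ket c Δ₀)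

/-- The formal series `∑_{k ≥ 0} D k * t ^ (-k)`. -/
def invSeries (D : ℕ → ℂ) : ℤ → ℂ := fun k => if k ≤ 0 then D (-k).toNat else 0

end ConfBlock

end

open Filter Topology

noncomputable section

namespace ConfBlock

/-! ### Representations of the Virasoro algebra as families of operators -/

/-! Let `Δ = Δ(Λ/2+ν)` be the intermediate weight and `A` the exponent of `1 - Λ/t`. The right
vertex operator of the block is encoded by descendants `ω_k` of level `k` in the Verma module `M_Δ`,
characterised for `n > 0` by `L_n ω_k = (κ + k - n + n Δ_t) ω_{k-n}` with `κ = Δ - Δ((Λ-θs)/2)`. For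
large `|Λ|` there is no singular vector up to a given level, because the part of `∑ L_{-n} L_n /
(2n)` linear in `Δ` is injective on every positive level (`lenEuler_injOn`, `perturbation`). Hence
`ω_k` exists, is unique and grows at most polynomially in `Λ`.

The left vertex operator is not evaluated at once. The vectors `ω_k` are mapped into a module
generated by a vector on which `L_n - Λ^{-n} L_0`, `n > 0`, acts by a scalar; the weight `Δ(θ₀)`
enters only at the very end, when `zeroChar` replaces `L_0` by a number and the other generators by
zero. As `Λ → ∞` the scalars for `n = 1, 2` tend to `θs/2 - ν` and `1/4`, so that the module
degenerates to the Whittaker module. All these modules are modelled on one space, the enveloping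
algebra of the `L_n`, `n ≤ 0`, and only the operators depend on `Λ`. Multiplication by `(1 - Λ/t)^A`
cancels the terms of the recurrences that grow with `Λ`. The resulting vectors `w_k(Λ)` satisfy
equations for `L_1` and `L_2` that are polynomial in `1/Λ` and whose formal limit is the system for
the coefficients of `W(t)`. That system has at most one solution, and since `L_1` and `L_2` generate
all `L_n`, `n > 0`, a solution yields `W`. Everything is reduced to the convergence of `w_k(Λ)`,
which also gives the existence of `W`.

For convergence, polynomial growth and a bootstrap (`IsConfluentFamily.expandable`) give an
asymptotic expansion `w_k ~ ∑ v_{k,i} Λ^{-i}` to all orders, and it must be shown that `v_{k,i} = 0`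
for `i < 0`. Induction on the diagonal `k + i = n` shows that the coefficients with `k > n` are
multiples `s_k` of the generating vector with `k s_k` independent of `k`. One number `S = k s_k` per
diagonal is left, and the two recurrences alone do not obviously kill it.

Setting formally `t = Λ`, that is, summing `v_{k,i}` along the diagonals, removes the explicit
factors `k` and leaves an inhomogeneous system whose only source is `S` (`eq_zero_of_defect`). This
system is transported to a Fock space with `c = 1 - 6β²`. There a coherent series is an eigenvector
of the operators `L_n - ε^n L_0`, `n = 1, 2`, where `ε` stands for `1/Λ`, and shifting its parameter
by the exponential rate gives an exact solution of the homogeneous system. Subtracting multiples of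
this solution order by order pushes the inhomogeneous one up to the order of the source. There a
vector on which `L_2` acts as on the vacuum, and `L_1` up to a multiple of the vacuum, must itself
be a multiple of the vacuum, so `S = 0`. -/

/-- The central term of `[L_m, L_n]`. -/
def cocyc (c : ℂ) (m n : ℤ) : ℂ := if m + n = 0 then c / 12 * ((m : ℂ) ^ 3 - (m : ℂ)) else 0

/-- The operators `ρ n` satisfy the Virasoro relations with central charge `c`. -/
def IsVirRep (c : ℂ) {X : Type*} [AddCommGroup X] [Module ℂ X] (ρ : ℤ → X →ₗ[ℂ] X) : Prop :=
  ∀ (m n : ℤ) (x : X), ρ m (ρ n x) - ρ n (ρ m x) =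
    ((m : ℂ) - (n : ℂ)) • ρ (m + n) x + cocyc c m n • x

theorem cocyc_swap (c : ℂ) (m n : ℤ) : cocyc c n m = -cocyc c m n := by
  unfold cocyc
  by_cases h : m + n = 0
  · have h' : n = -m := by lia
    subst h'
    simp
    ring
  · have h' : ¬ (n + m = 0) := by lia
    simp [h, h']

theorem cocyc_zero_right (c : ℂ) (m : ℤ) : cocyc c m 0 = 0 := by
  unfold cocyc
  split_ifs with h
  · have h' : m = 0 := by lia
    subst h'
    simp
  · rfl

theorem cocyc_zero_left (c : ℂ) (m : ℤ) : cocyc c 0 m = 0 := by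
  rw [cocyc_swap, cocyc_zero_right, neg_zero]

theorem cocyc_of_ne (c : ℂ) {m n : ℤ} (h : m + n ≠ 0) : cocyc c m n = 0 := by
  simp [cocyc, h]

/-- The cocycle condition behind the Jacobi identity of the central extension; the central terms in
`extAct_comm` and `opT_isVirRep` cancel by it. -/
theorem cocyc_jacobi (c : ℂ) (m n p : ℤ) :
    ((m : ℂ) - n) * cocyc c (m + n) p + ((n : ℂ) - p) * cocyc c (n + p) m
      + ((p : ℂ) - m) * cocyc c (p + m) n = 0 := by
  unfold cocyc
  by_cases h : m + n + p = 0
  · have h1 : p = -m - n := by lia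
    subst h1
    have e1 : m + n + (-m - n) = 0 := by ring
    have e2 : n + (-m - n) + m = 0 := by ring
    have e3 : -m - n + m + n = 0 := by ring
    simp only [e1, e2, e3, if_true]
    push_cast
    ring
  · have h2 : ¬ (n + p + m = 0) := by lia
    have h3 : ¬ (p + m + n = 0) := by lia
    simp [h, h2, h3]

/-! ### Universal properties of Verma modules and of modules of bra vectors -/

section Universal

variable {c : ℂ} {X : Type*} [AddCommGroup X] [Module ℂ X]

theorem virU_induction {P : VirU c → Prop} (halg : ∀ r : ℂ, P (algebraMap ℂ (VirU c) r))
    (hL : ∀ n, P (L c n)) (hmul : ∀ a b, P a → P b → P (a * b))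
    (hadd : ∀ a b, P a → P b → P (a + b)) (a : VirU c) : P a := by
  obtain ⟨b, rfl⟩ := RingQuot.mkAlgHom_surjective ℂ (VirRel c) a
  induction b using FreeAlgebra.induction with
  | grade0 r => rw [AlgHom.commutes]; exact halg r
  | grade1 x => exact hL x
  | mul a b ha hb => rw [map_mul]; exact hmul _ _ ha hb
  | add a b ha hb => rw [map_add]; exact hadd _ _ ha hb

theorem L_comm (c : ℂ) (m n : ℤ) : L c m * L c n - L c n * L c m =
    ((m : ℂ) - n) • L c (m + n) + algebraMap ℂ (VirU c) (cocyc c m n) := by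
  have h := RingQuot.mkAlgHom_rel ℂ (VirRel.comm (c := c) m n)
  simp only [map_sub, map_mul, map_add, map_smul, AlgHom.commutes] at h
  exact h

/-- The action of the enveloping algebra on a representation. -/
def virHom (ρ : ℤ → X →ₗ[ℂ] X) (hρ : IsVirRep c ρ) : VirU c →ₐ[ℂ] Module.End ℂ X :=
  RingQuot.liftAlgHom ℂ ⟨FreeAlgebra.lift ℂ (fun n => (ρ n : Module.End ℂ X)), by
    rintro _ _ ⟨m, n⟩
    ext x
    simp [Module.algebraMap_end_apply]
    simpa [cocyc] using hρ m n x⟩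

@[simp] theorem virHom_L (ρ : ℤ → X →ₗ[ℂ] X) (hρ : IsVirRep c ρ) (n : ℤ) :
    virHom ρ hρ (L c n) = ρ n := by
  unfold virHom L
  rw [RingQuot.liftAlgHom_mkAlgHom_apply]
  simp

theorem exists_verma_hom {ρ : ℤ → X →ₗ[ℂ] X} (hρ : IsVirRep c ρ) {Δ : ℂ} {v : X}
    (hpos : ∀ n : ℤ, 0 < n → ρ n v = 0) (hzero : ρ 0 v = Δ • v) :
    ∃ f : Verma c Δ →ₗ[ℂ] X, f (ket c Δ) = v ∧ ∀ n x, f (ketAct c Δ n x) = ρ n (f x) := by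
  let g : VirU c →ₗ[ℂ] X := (LinearMap.applyₗ v).comp (virHom ρ hρ).toLinearMap
  have hg : ∀ a, g a = virHom ρ hρ a v := fun a => rfl
  have hle : (vermaIdeal c Δ).restrictScalars ℂ ≤ LinearMap.ker g := by
    intro a ha
    rw [Submodule.restrictScalars_mem] at ha
    rw [LinearMap.mem_ker]
    unfold vermaIdeal at ha
    induction ha using Submodule.span_induction with
    | mem x hx =>
      rcases hx with ⟨n, hn, rfl⟩ | hx
      · rw [hg, virHom_L]; exact hpos n hn
      · rw [Set.mem_singleton_iff] at hx
        subst hx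
        rw [hg, map_sub, virHom_L, AlgHom.commutes]
        simp [Module.algebraMap_end_apply, hzero]
    | zero => simp
    | add x y _ _ hx hy => rw [map_add, hx, hy, add_zero]
    | smul r x _ hx =>
      rw [hg] at hx ⊢
      rw [smul_eq_mul, map_mul, Module.End.mul_apply, hx, map_zero]
  let f : Verma c Δ →ₗ[ℂ] X := (((vermaIdeal c Δ).restrictScalars ℂ).liftQ g hle).comp
    (Submodule.Quotient.restrictScalarsEquiv ℂ (vermaIdeal c Δ)).symm.toLinearMap
  have hf : ∀ a : VirU c, f ((vermaIdeal c Δ).mkQ a) = virHom ρ hρ a v := fun a => rfl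
  refine ⟨f, ?_, ?_⟩
  · unfold ket
    rw [hf, map_one, Module.End.one_apply]
  · intro n x
    obtain ⟨a, rfl⟩ := (vermaIdeal c Δ).mkQ_surjective x
    have : ketAct c Δ n ((vermaIdeal c Δ).mkQ a) = (vermaIdeal c Δ).mkQ (L c n * a) := rfl
    rw [this, hf, hf, map_mul, virHom_L, Module.End.mul_apply]

theorem ketAct_isVirRep (c Δ : ℂ) : IsVirRep c (ketAct c Δ) := by
  intro m n x
  have h := congrArg (fun a : VirU c => a • x) (L_comm c m n)
  simp only [sub_smul (M := Verma c Δ) (L c m * L c n), mul_smul, add_smul, algebraMap_smul, smul_assoc] at h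
  simpa [ketAct] using h

theorem ketAct_ket_pos (c Δ : ℂ) {n : ℤ} (hn : 0 < n) : ketAct c Δ n (ket c Δ) = 0 := by
  have : ketAct c Δ n (ket c Δ) = (vermaIdeal c Δ).mkQ (L c n * 1) := rfl
  rw [this, mul_one, ← LinearMap.mem_ker, Submodule.ker_mkQ]
  exact Submodule.subset_span (Or.inl ⟨n, hn, rfl⟩)

theorem ketAct_ket_zero (c Δ : ℂ) : ketAct c Δ 0 (ket c Δ) = Δ • ket c Δ := by
  have : ketAct c Δ 0 (ket c Δ) - Δ • ket c Δ =
      (vermaIdeal c Δ).mkQ (L c 0 - algebraMap ℂ (VirU c) Δ) := by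
    have h1 : ketAct c Δ 0 (ket c Δ) = (vermaIdeal c Δ).mkQ (L c 0 * 1) := rfl
    have h2 : Δ • ket c Δ = (vermaIdeal c Δ).mkQ (Δ • 1) := rfl
    rw [h1, h2, ← map_sub, mul_one, Algebra.algebraMap_eq_smul_one]
  rw [← sub_eq_zero, this, ← LinearMap.mem_ker, Submodule.ker_mkQ]
  exact Submodule.subset_span (Or.inr rfl)

theorem verma_induction {c Δ : ℂ} {P : Verma c Δ → Prop} (hket : P (ket c Δ))
    (hsmul : ∀ (r : ℂ) x, P x → P (r • x)) (hadd : ∀ x y, P x → P y → P (x + y))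
    (hact : ∀ n x, P x → P (ketAct c Δ n x)) (x : Verma c Δ) : P x := by
  obtain ⟨a, rfl⟩ := (vermaIdeal c Δ).mkQ_surjective x
  have key : ∀ a : VirU c, ∀ y : Verma c Δ, P y → P (a • y) := by
    intro a
    induction a using virU_induction with
    | halg r => intro y hy; rw [algebraMap_smul]; exact hsmul r y hy
    | hL n => intro y hy; exact hact n y hy
    | hmul a b ha hb => intro y hy; rw [mul_smul]; exact ha _ (hb _ hy)
    | hadd a b ha hb => intro y hy; rw [add_smul]; exact hadd _ _ (ha _ hy) (hb _ hy)
  have h := key a _ hket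
  have e : a • ket c Δ = (vermaIdeal c Δ).mkQ a := by
    unfold ket
    rw [← map_smul, smul_eq_mul, mul_one]
  rwa [e] at h

/-- The representation on bra vectors, turned into a left representation by `L_n ↦ L_{-n}`. -/
theorem braAct_mk (c : ℂ) (S : Set ℤ) (χ : ℤ → ℂ) (n : ℤ) (a : VirU c) :
    braAct c S χ n ((braIdeal c S χ).mkQ a) = (braIdeal c S χ).mkQ (a * L c n) := rfl

/-- `L_n ↦ L_{-n}` reverses brackets, so it makes a right module a left one. Bra and ket modules can
then be treated by the same constructions. -/
theorem isVirRep_braAct (c : ℂ) (S : Set ℤ) (χ : ℤ → ℂ) :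
    IsVirRep c (fun n => braAct c S χ (-n)) := by
  intro m n x
  obtain ⟨a, rfl⟩ := (braIdeal c S χ).mkQ_surjective x
  simp only [braAct_mk]
  have h := L_comm c (-n) (-m)
  have h2 := congrArg (fun b => (braIdeal c S χ).mkQ (a * b)) h
  simp only [mul_sub, mul_add, map_sub, map_add, ← mul_assoc] at h2
  rw [h2]
  have e1 : -n + -m = -(m + n) := by ring
  have e2 : cocyc c (-n) (-m) = cocyc c m n := by
    unfold cocyc
    by_cases h : m + n = 0
    · have h' : n = -m := by lia
      subst h'
      simp
    · have h' : ¬ (-n + -m = 0) := by lia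
      simp only [h, h', if_false]
  rw [e1, e2, Algebra.algebraMap_eq_smul_one, mul_smul_comm, mul_smul_comm, mul_one, map_smul,
    map_smul]
  congr 2
  push_cast
  ring

theorem braAct_vac (c : ℂ) {S : Set ℤ} (χ : ℤ → ℂ) {n : ℤ} (hn : n ∈ S) :
    braAct c S χ n (braVac c S χ) = χ n • braVac c S χ := by
  have : braAct c S χ n (braVac c S χ) - χ n • braVac c S χ =
      (braIdeal c S χ).mkQ ((L c n - algebraMap ℂ (VirU c) (χ n)) * 1) := by
    have h1 : braAct c S χ n (braVac c S χ) = (braIdeal c S χ).mkQ (1 * L c n) := rfl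
    have h2 : χ n • braVac c S χ = (braIdeal c S χ).mkQ (χ n • 1) := rfl
    rw [h1, h2, ← map_sub, mul_one, one_mul, Algebra.algebraMap_eq_smul_one]
  rw [← sub_eq_zero, this, ← LinearMap.mem_ker, Submodule.ker_mkQ]
  exact Submodule.subset_span ⟨n, hn, 1, rfl⟩

/-- Right multiplication reverses products, so the enveloping algebra is sent to the opposite of the
endomorphism algebra. Evaluating at `v` kills the defining right ideal by `hv`. -/
theorem exists_bra_hom {ρ : ℤ → X →ₗ[ℂ] X} (hρ : IsVirRep c ρ) {S : Set ℤ} {χ : ℤ → ℂ} {v : X}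
    (hv : ∀ n ∈ S, ρ (-n) v = χ n • v) :
    ∃ f : Bra c S χ →ₗ[ℂ] X, f (braVac c S χ) = v ∧
      ∀ n u, f (braAct c S χ n u) = ρ (-n) (f u) := by
  let σ : VirU c →ₐ[ℂ] (Module.End ℂ X)ᵐᵒᵖ :=
    RingQuot.liftAlgHom ℂ ⟨FreeAlgebra.lift ℂ
      (fun n => MulOpposite.op (ρ (-n) : Module.End ℂ X)), by
    rintro _ _ ⟨m, n⟩
    apply MulOpposite.unop_injective
    ext x
    have h := hρ (-n) (-m) x
    have e1 : -n + -m = -(m + n) := by ring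
    have e2 : cocyc c (-n) (-m) = cocyc c m n := by
      unfold cocyc
      by_cases h : m + n = 0
      · have h' : n = -m := by lia
        subst h'
        simp
      · have h' : ¬ (-n + -m = 0) := by lia
        simp only [h, h', if_false]
    rw [e1, e2] at h
    have e3 : ((-n : ℤ) : ℂ) - ((-m : ℤ) : ℂ) = (m : ℂ) - n := by push_cast; ring
    rw [e3] at h
    simp only [map_sub, map_mul, map_add, map_smul, FreeAlgebra.lift_ι_apply, AlgHom.commutes,
      MulOpposite.unop_sub, MulOpposite.unop_mul, MulOpposite.unop_op, LinearMap.sub_apply,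
      Module.End.mul_apply, MulOpposite.unop_add, MulOpposite.unop_smul, LinearMap.add_apply,
      LinearMap.smul_apply, MulOpposite.algebraMap_apply, Module.algebraMap_end_apply]
    exact h⟩
  have hσ : ∀ n, σ (L c n) = MulOpposite.op (ρ (-n) : Module.End ℂ X) := by
    intro n
    unfold σ L
    rw [RingQuot.liftAlgHom_mkAlgHom_apply]
    simp
  let g : VirU c →ₗ[ℂ] X := (LinearMap.applyₗ v).comp
    ((MulOpposite.opLinearEquiv ℂ).symm.toLinearMap.comp σ.toLinearMap)
  have hg : ∀ a, g a = (σ a).unop v := fun a => rfl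
  have hle : braIdeal c S χ ≤ LinearMap.ker g := by
    unfold braIdeal
    rw [Submodule.span_le]
    rintro _ ⟨n, hn, x, rfl⟩
    rw [SetLike.mem_coe, LinearMap.mem_ker, hg, map_mul, MulOpposite.unop_mul,
      Module.End.mul_apply, map_sub, hσ, AlgHom.commutes, MulOpposite.unop_sub]
    rw [MulOpposite.algebraMap_apply, MulOpposite.unop_op, MulOpposite.unop_op,
      LinearMap.sub_apply, Module.algebraMap_end_apply, hv n hn, sub_self, map_zero]
  refine ⟨(braIdeal c S χ).liftQ g hle, ?_, ?_⟩
  · unfold braVac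
    rw [Submodule.mkQ_apply, Submodule.liftQ_apply, hg, map_one]
    rfl
  · intro n u
    obtain ⟨a, rfl⟩ := (braIdeal c S χ).mkQ_surjective u
    rw [braAct_mk, Submodule.mkQ_apply, Submodule.mkQ_apply, Submodule.liftQ_apply,
      Submodule.liftQ_apply, hg, hg, map_mul, hσ, MulOpposite.unop_mul, Module.End.mul_apply]
    rfl

theorem bra_induction {c : ℂ} {S : Set ℤ} {χ : ℤ → ℂ} {P : Bra c S χ → Prop}
    (hvac : P (braVac c S χ))
    (hsmul : ∀ (r : ℂ) x, P x → P (r • x)) (hadd : ∀ x y, P x → P y → P (x + y))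
    (hact : ∀ n x, P x → P (braAct c S χ n x)) (x : Bra c S χ) : P x := by
  obtain ⟨a, rfl⟩ := (braIdeal c S χ).mkQ_surjective x
  have key : ∀ a : VirU c, ∀ b : VirU c, P ((braIdeal c S χ).mkQ b) →
      P ((braIdeal c S χ).mkQ (b * a)) := by
    intro a
    induction a using virU_induction with
    | halg r =>
      intro b hb
      rw [← Algebra.commutes, ← Algebra.smul_def, map_smul]
      exact hsmul r _ hb
    | hL n => intro b hb; rw [← braAct_mk]; exact hact n _ hb
    | hmul a a' ha ha' => intro b hb; rw [← mul_assoc]; exact ha' _ (ha _ hb)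
    | hadd a a' ha ha' => intro b hb; rw [mul_add, map_add]; exact hadd _ _ (ha _ hb) (ha' _ hb)
  simpa using key a 1 hvac

theorem bra_hom_ext {Y : Type*} [AddCommGroup Y] [Module ℂ Y] {ρ : ℤ → Y →ₗ[ℂ] Y} {S : Set ℤ}
    {χ : ℤ → ℂ} {f g : Bra c S χ →ₗ[ℂ] Y} (hf : ∀ n u, f (braAct c S χ n u) = ρ n (f u))
    (hg : ∀ n u, g (braAct c S χ n u) = ρ n (g u)) (h : f (braVac c S χ) = g (braVac c S χ)) :
    f = g := by
  refine LinearMap.ext fun u => ?_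
  induction u using bra_induction with
  | hvac => exact h
  | hsmul r x hx => rw [map_smul, map_smul, hx]
  | hadd x y hx hy => rw [map_add, map_add, hx, hy]
  | hact n x hx => rw [hf, hg, hx]

end Universal

/-! ### Models of highest weight and Whittaker modules

`Low o` is the enveloping algebra of the span of the `L_n`, `n ≤ -o`, for `o : ℕ`; its generator
`Low.gen o i` stands for `L_{-(i + o)}`. -/

inductive LowRel (o : ℕ) : FreeAlgebra ℂ ℕ → FreeAlgebra ℂ ℕ → Prop
  | comm (i j : ℕ) : LowRel o
      (FreeAlgebra.ι ℂ i * FreeAlgebra.ι ℂ j - FreeAlgebra.ι ℂ j * FreeAlgebra.ι ℂ i)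
      (((j : ℂ) - (i : ℂ)) • FreeAlgebra.ι ℂ (i + j + o))

/-- The enveloping algebra of the span of the `L_n`, `n ≤ -o`. -/
def Low (o : ℕ) : Type := RingQuot (LowRel o)

instance (o : ℕ) : Ring (Low o) := inferInstanceAs (Ring (RingQuot (LowRel o)))

instance (o : ℕ) : Algebra ℂ (Low o) := inferInstanceAs (Algebra ℂ (RingQuot (LowRel o)))

/-- The projection of the free algebra onto `Low o`. -/
def Low.mk (o : ℕ) : FreeAlgebra ℂ ℕ →ₐ[ℂ] Low o := RingQuot.mkAlgHom ℂ (LowRel o)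

theorem Low.mk_surjective (o : ℕ) : Function.Surjective (Low.mk o) :=
  RingQuot.mkAlgHom_surjective ℂ (LowRel o)

/-- The generator of `Low o` that stands for `L_{-(i + o)}`. -/
def Low.gen (o i : ℕ) : Low o := Low.mk o (FreeAlgebra.ι ℂ i)

theorem Low.gen_comm (o i j : ℕ) : Low.gen o i * Low.gen o j - Low.gen o j * Low.gen o i =
    ((j : ℂ) - i) • Low.gen o (i + j + o) := by
  have h : Low.mk o _ = Low.mk o _ := RingQuot.mkAlgHom_rel ℂ (LowRel.comm (o := o) i j)
  simp only [map_sub, map_mul, map_smul] at h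
  exact h

theorem Low.induction {o : ℕ} {P : Low o → Prop} (hone : P 1)
    (hsmul : ∀ (r : ℂ) x, P x → P (r • x)) (hadd : ∀ x y, P x → P y → P (x + y))
    (hgen : ∀ i x, P x → P (Low.gen o i * x)) (x : Low o) : P x := by
  obtain ⟨b, rfl⟩ := Low.mk_surjective o x
  have key : ∀ y, P y → P (Low.mk o b * y) := by
    induction b using FreeAlgebra.induction with
    | grade0 r => intro y hy; rw [AlgHom.commutes, ← Algebra.smul_def]; exact hsmul r y hy
    | grade1 i => intro y hy; exact hgen i y hy
    | mul a b ha hb => intro y hy; rw [map_mul, mul_assoc]; exact ha _ (hb _ hy)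
    | add a b ha hb => intro y hy; rw [map_add, add_mul]; exact hadd _ _ (ha _ hy) (hb _ hy)
  simpa using key 1 hone

/-- The universal property of `Low o`. -/
def Low.lift (o : ℕ) {B : Type*} [Ring B] [Algebra ℂ B] (f : ℕ → B)
    (hf : ∀ i j, f i * f j - f j * f i = ((j : ℂ) - i) • f (i + j + o)) : Low o →ₐ[ℂ] B :=
  RingQuot.liftAlgHom ℂ ⟨FreeAlgebra.lift ℂ f, by
    rintro _ _ ⟨i, j⟩
    simpa using hf i j⟩

@[simp] theorem Low.lift_gen (o : ℕ) {B : Type*} [Ring B] [Algebra ℂ B] (f : ℕ → B)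
    (hf : ∀ i j, f i * f j - f j * f i = ((j : ℂ) - i) • f (i + j + o)) (i : ℕ) :
    Low.lift o f hf (Low.gen o i) = f i := by
  have h : Low.lift o f hf (Low.gen o i) = FreeAlgebra.lift ℂ f (FreeAlgebra.ι ℂ i) :=
    RingQuot.liftAlgHom_mkAlgHom_apply ℂ _ _ _
  rw [h, FreeAlgebra.lift_ι_apply]

section LowHom

variable {c : ℂ} {X : Type*} [AddCommGroup X] [Module ℂ X]

theorem cocyc_nonpos (c : ℂ) {m n : ℤ} (hm : m ≤ 0) (hn : n ≤ 0) : cocyc c m n = 0 := by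
  by_cases h : m = 0
  · subst h; exact cocyc_zero_left c n
  · exact cocyc_of_ne c (by lia)

/-- The action of `Low o` on a representation of the Virasoro algebra. -/
def lowHom (o : ℕ) {ρ : ℤ → X →ₗ[ℂ] X} (hρ : IsVirRep c ρ) : Low o →ₐ[ℂ] Module.End ℂ X :=
  Low.lift o (fun i => (ρ (-((i : ℤ) + o)) : Module.End ℂ X)) (by
    intro i j
    ext x
    have h := hρ (-((i : ℤ) + o)) (-((j : ℤ) + o)) x
    rw [cocyc_nonpos c (by lia) (by lia), zero_smul, add_zero] at h
    have e : -((i : ℤ) + o) + -((j : ℤ) + o) = -(((i + j + o : ℕ) : ℤ) + o) := by push_cast; ring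
    rw [e] at h
    have e2 : ((-((i : ℤ) + o) : ℤ) : ℂ) - ((-((j : ℤ) + o) : ℤ) : ℂ) = (j : ℂ) - i := by
      push_cast; ring
    rw [e2] at h
    exact h)

@[simp] theorem lowHom_gen (o : ℕ) {ρ : ℤ → X →ₗ[ℂ] X} (hρ : IsVirRep c ρ) (i : ℕ) :
    lowHom o hρ (Low.gen o i) = ρ (-((i : ℤ) + o)) := Low.lift_gen o _ _ i

theorem lowHom_gen_mul (o : ℕ) {ρ : ℤ → X →ₗ[ℂ] X} (hρ : IsVirRep c ρ) (i : ℕ) (a : Low o)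
    (v : X) : lowHom o hρ (Low.gen o i * a) v = ρ (-((i : ℤ) + o)) (lowHom o hρ a v) := by
  rw [map_mul, lowHom_gen, Module.End.mul_apply]

end LowHom

/-- The operators by which `L_{-(i + o)}` acts on `x` together with all vectors `z n = L_n x`. -/
def extAct (c : ℂ) (o i : ℕ) : Module.End ℂ (Low o × (ℤ → Low o)) where
  toFun p := (Low.gen o i * p.1, fun n => Low.gen o i * p.2 n +
    ((n : ℂ) + i + o) • p.2 (n - i - o) + cocyc c n (-((i : ℤ) + o)) • p.1)
  map_add' p q := by
    refine Prod.ext (mul_add _ _ _) (funext fun n => ?_)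
    simp only [Prod.fst_add, Prod.snd_add, Pi.add_apply, mul_add, smul_add]
    abel
  map_smul' r p := by
    refine Prod.ext (mul_smul_comm _ _ _) (funext fun n => ?_)
    simp only [Prod.smul_fst, Prod.smul_snd, Pi.smul_apply, mul_smul_comm, smul_add,
      RingHom.id_apply, smul_comm r]

/-- In an induced module, `L_n (L_{-p} x)` is known as soon as `x` and all `L_m x` are. Hence left
multiplication extends to pairs `(x, (L_m x)_m)`, and consistency with the relations of `Low o` is
the Jacobi identity. This constructs induced actions on `Low o` without a Poincaré–Birkhoff–Witt
basis. -/
theorem extAct_comm (c : ℂ) (o i j : ℕ) : extAct c o i * extAct c o j - extAct c o j * extAct c o i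
    = ((j : ℂ) - i) • extAct c o (i + j + o) := by
  refine LinearMap.ext fun p => Prod.ext ?_ (funext fun n => ?_)
  · have h := congrArg (· * p.1) (Low.gen_comm o i j)
    simp only [sub_mul, mul_assoc, smul_mul_assoc] at h
    exact h
  · have h := congrArg (· * p.2 n) (Low.gen_comm o i j)
    simp only [sub_mul, mul_assoc, smul_mul_assoc] at h
    have hj := cocyc_jacobi c n (-((i : ℤ) + o)) (-((j : ℤ) + o))
    have h0 : cocyc c (-((i : ℤ) + o) + -((j : ℤ) + o)) n =
        - cocyc c n (-(((i + j + o : ℕ) : ℤ) + o)) := by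
      rw [cocyc_swap]
      congr 2
      push_cast
      ring
    have h1 : cocyc c (-((j : ℤ) + o) + n) (-((i : ℤ) + o)) =
        cocyc c (n - j - o) (-((i : ℤ) + o)) := by
      congr 1
      ring
    have h2 : cocyc c (n + -((i : ℤ) + o)) (-((j : ℤ) + o)) =
        cocyc c (n - i - o) (-((j : ℤ) + o)) := by
      congr 1
      ring
    rw [h0, h1, h2] at hj
    have e1 : n - i - o - j - o = n - ((i + j + o : ℕ) : ℤ) - o := by push_cast; ring
    have e2 : n - j - o - i - o = n - ((i + j + o : ℕ) : ℤ) - o := by push_cast; ring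
    simp only [LinearMap.sub_apply, Module.End.mul_apply, extAct, LinearMap.coe_mk,
      AddHom.coe_mk, LinearMap.smul_apply, Prod.snd_sub, Prod.smul_snd, Pi.sub_apply,
      Pi.smul_apply, e1, e2, mul_add, smul_add, mul_smul_comm]
    rw [sub_eq_iff_eq_add] at h
    rw [h]
    generalize cocyc c n (-(((i + j + o : ℕ) : ℤ) + o)) = A1 at hj ⊢
    generalize cocyc c (n - j - o) (-((i : ℤ) + o)) = A2 at hj ⊢
    generalize cocyc c (n - i - o) (-((j : ℤ) + o)) = A3 at hj ⊢
    push_cast at hj ⊢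
    match_scalars <;> first | ring1 | linear_combination hj

/-- The action of `Low o` on `Low o × (ℤ → Low o)`. -/
def extHom (c : ℂ) (o : ℕ) : Low o →ₐ[ℂ] Module.End ℂ (Low o × (ℤ → Low o)) :=
  Low.lift o (extAct c o) (extAct_comm c o)

/-- The action of `L_n` on the module generated by `1 : Low o`, on which it acts by
`L_n 1 = z n`. -/
def opT (c : ℂ) (o : ℕ) (z : ℤ → Low o) (n : ℤ) : Low o →ₗ[ℂ] Low o where
  toFun a := (extHom c o a (1, z)).2 n
  map_add' a b := by simp
  map_smul' r a := by simp

/-- The dependence of `opT` on the vectors `L_n 1`, which is affine. -/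
def opS (c : ℂ) (o : ℕ) (z : ℤ → Low o) (n : ℤ) : Low o →ₗ[ℂ] Low o where
  toFun a := (extHom c o a (0, z)).2 n
  map_add' a b := by simp
  map_smul' r a := by simp

/-! ### Induced actions with prescribed values on the generating vector -/

section opT

variable (c : ℂ) {o : ℕ} (z : ℤ → Low o)

theorem extHom_fst (a x : Low o) : (extHom c o a (x, z)).1 = a * x := by
  induction a using Low.induction with
  | hone => simp
  | hsmul r a ha => simp [ha]
  | hadd a b ha hb => simp [ha, hb, add_mul]
  | hgen i a ha =>
    rw [map_mul, Module.End.mul_apply]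
    simp only [extHom, Low.lift_gen] at ha ⊢
    rw [mul_assoc, ← ha]
    rfl

@[simp] theorem opT_one (n : ℤ) : opT c o z n 1 = z n := by simp [opT]

@[simp] theorem opS_one (n : ℤ) : opS c o z n 1 = z n := by simp [opS]

/-- The rule for moving `L_n` past a generator; together with `opT_one` it determines `opT`, and
nearly every later induction uses only these two facts. -/
theorem opT_gen_mul (n : ℤ) (i : ℕ) (a : Low o) : opT c o z n (Low.gen o i * a) =
    Low.gen o i * opT c o z n a + ((n : ℂ) + i + o) • opT c o z (n - i - o) a
      + cocyc c n (-((i : ℤ) + o)) • a := by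
  have h := extHom_fst c z a 1
  rw [mul_one] at h
  change (extHom c o (Low.gen o i * a) (1, z)).2 n = _
  rw [map_mul, Module.End.mul_apply]
  have e : (extHom c o (Low.gen o i) (extHom c o a (1, z))).2 n =
    Low.gen o i * opT c o z n a + ((n : ℂ) + i + o) • opT c o z (n - i - o) a +
      cocyc c n (-((i : ℤ) + o)) • (extHom c o a (1, z)).1 := by
    simp only [extHom, Low.lift_gen]
    rfl
  rw [e, h]

theorem opS_gen_mul (n : ℤ) (i : ℕ) (a : Low o) : opS c o z n (Low.gen o i * a) =
    Low.gen o i * opS c o z n a + ((n : ℂ) + i + o) • opS c o z (n - i - o) a := by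
  have h := extHom_fst c z a 0
  rw [mul_zero] at h
  change (extHom c o (Low.gen o i * a) (0, z)).2 n = _
  rw [map_mul, Module.End.mul_apply]
  have e : (extHom c o (Low.gen o i) (extHom c o a (0, z))).2 n =
    Low.gen o i * opS c o z n a + ((n : ℂ) + i + o) • opS c o z (n - i - o) a +
      cocyc c n (-((i : ℤ) + o)) • (extHom c o a (0, z)).1 := by
    simp only [extHom, Low.lift_gen]
    rfl
  rw [e, h, smul_zero, add_zero]

/-- The first component of the pair does not see `z'`, so the dependence on the prescribed vectors
is affine. This isolates the coefficient of `Δ` in a Verma module and the corrections in powers of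
`1/Λ`. -/
theorem opT_add (z' : ℤ → Low o) (n : ℤ) :
    opT c o (z + z') n = opT c o z n + opS c o z' n := by
  refine LinearMap.ext fun a => ?_
  have : ((1 : Low o), z + z') = (1, z) + (0, z') := by simp
  change (extHom c o a (1, z + z')).2 n = (extHom c o a (1, z)).2 n + (extHom c o a (0, z')).2 n
  rw [this, map_add]
  rfl

theorem opS_smul (r : ℂ) (n : ℤ) : opS c o (r • z) n = r • opS c o z n := by
  refine LinearMap.ext fun a => ?_
  have : ((0 : Low o), r • z) = r • (0, z) := by simp
  change (extHom c o a (0, r • z)).2 n = r • (extHom c o a (0, z)).2 n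
  rw [this, map_smul]
  rfl

/-- The vectors `L_n 1`, `n ≤ -o`, are the generators. -/
def IsBase (z : ℤ → Low o) : Prop := ∀ i : ℕ, z (-((i : ℤ) + o)) = Low.gen o i

variable {z}

theorem opT_neg (hz : IsBase z) (i : ℕ) (a : Low o) :
    opT c o z (-((i : ℤ) + o)) a = Low.gen o i * a := by
  induction a using Low.induction generalizing i with
  | hone => rw [opT_one, mul_one]; exact hz i
  | hsmul r a ha => rw [map_smul, ha, mul_smul_comm]
  | hadd a b ha hb => rw [map_add, ha, hb, mul_add]
  | hgen j a ha =>
    rw [opT_gen_mul, ha]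
    have e : -((i : ℤ) + o) - j - o = -(((i + j + o : ℕ) : ℤ) + o) := by push_cast; ring
    have h := congrArg (· * a) (Low.gen_comm o i j)
    simp only [sub_mul, mul_assoc, smul_mul_assoc] at h
    rw [e, ha, cocyc_nonpos c (by lia) (by lia), zero_smul, add_zero, sub_eq_iff_eq_add.mp h]
    push_cast
    module

/-- Relations involving a lowering generator are `opT_gen_mul` itself, and by the Jacobi identity a
relation that holds on `x` passes to a generator times `x`. What remains is `h1`, the relations of
the other operators on the single vector `1`. -/
theorem opT_isVirRep (hz : IsBase z)
    (h1 : ∀ m n : ℤ, -(o : ℤ) < m → -(o : ℤ) < n →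
      opT c o z m (z n) - opT c o z n (z m) = ((m : ℂ) - n) • z (m + n) + cocyc c m n • 1) :
    IsVirRep c (opT c o z) := by
  have hlow : ∀ (m : ℤ) (i : ℕ) (x : Low o), opT c o z m (opT c o z (-((i : ℤ) + o)) x) -
      opT c o z (-((i : ℤ) + o)) (opT c o z m x) =
      ((m : ℂ) - (-((i : ℤ) + o) : ℤ)) • opT c o z (m + -((i : ℤ) + o)) x
        + cocyc c m (-((i : ℤ) + o)) • x := by
    intro m i x
    have e : m + -((i : ℤ) + o) = m - i - o := by ring
    rw [opT_neg c hz, opT_neg c hz, opT_gen_mul, e]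
    push_cast
    module
  intro m n x
  induction x using Low.induction generalizing m n with
  | hone =>
    by_cases hn : -(o : ℤ) < n
    · by_cases hm : -(o : ℤ) < m
      · simpa using h1 m n hm hn
      · obtain ⟨i, hi⟩ : ∃ i : ℕ, m = -((i : ℤ) + o) := ⟨(-m - o).toNat, by lia⟩
        subst hi
        have h := hlow n i 1
        rw [cocyc_swap, add_comm n] at h
        rw [← neg_sub, h]
        module
    · obtain ⟨i, hi⟩ : ∃ i : ℕ, n = -((i : ℤ) + o) := ⟨(-n - o).toNat, by lia⟩
      subst hi
      exact hlow m i 1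
  | hsmul r x hx =>
    simp only [map_smul]
    rw [← smul_sub, hx, smul_add, smul_comm r, smul_comm r]
  | hadd x y hx hy =>
    have e := hx m n
    have e' := hy m n
    simp only [map_add, smul_add]
    rw [add_sub_add_comm, e, e']
    abel
  | hgen i x hx =>
    have e0 := hx m n
    have e1 := hx (m - i - o) n
    have e2 := hx m (n - i - o)
    have hj := cocyc_jacobi c m n (-((i : ℤ) + o))
    have h1 : cocyc c (n + -((i : ℤ) + o)) m = - cocyc c m (n - i - o) := by
      rw [cocyc_swap]
      congr 2
      ring
    have h2 : cocyc c (-((i : ℤ) + o) + m) n = cocyc c (m - i - o) n := by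
      congr 1
      ring
    rw [h1, h2] at hj
    have a1 : m - i - o + n = m + n - i - o := by ring
    have a2 : m + (n - i - o) = m + n - i - o := by ring
    rw [a1] at e1
    rw [a2] at e2
    simp only [opT_gen_mul, map_add, map_smul, smul_add]
    rw [sub_eq_iff_eq_add] at e0 e1 e2
    rw [e0, e1, e2]
    simp only [mul_add, mul_smul_comm]
    generalize cocyc c (m + n) (-((i : ℤ) + o)) = A1 at hj ⊢
    generalize cocyc c m (n - i - o) = A2 at hj ⊢
    generalize cocyc c (m - i - o) n = A3 at hj ⊢
    push_cast at hj ⊢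
    match_scalars <;> first | ring1 | linear_combination hj | linear_combination (-1 : ℂ) * hj

/-- The map from `Low o` to another representation intertwines all operators, if it does so on
the vector `1`. -/
theorem lowHom_opT {X : Type*} [AddCommGroup X] [Module ℂ X] {ρ : ℤ → X →ₗ[ℂ] X}
    (hρ : IsVirRep c ρ) {v : X} (hv : ∀ n, lowHom o hρ (z n) v = ρ n v) (n : ℤ) (a : Low o) :
    lowHom o hρ (opT c o z n a) v = ρ n (lowHom o hρ a v) := by
  induction a using Low.induction generalizing n with
  | hone => rw [opT_one, hv, map_one, Module.End.one_apply]
  | hsmul r a ha => simp [ha]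
  | hadd a b ha hb => simp [ha, hb]
  | hgen i a ha =>
    have h := hρ n (-((i : ℤ) + o)) (lowHom o hρ a v)
    have e : n + -((i : ℤ) + o) = n - i - o := by ring
    rw [e] at h
    rw [opT_gen_mul, map_add, map_add, LinearMap.add_apply, LinearMap.add_apply, lowHom_gen_mul,
      map_smul, map_smul, LinearMap.smul_apply, LinearMap.smul_apply, ha, ha, lowHom_gen_mul,
      sub_eq_iff_eq_add.mp h]
    push_cast
    module

end opT

/-! ### Dual representations and vertex operators as intertwiners -/

section Duals

variable {c : ℂ} {X : Type*} [AddCommGroup X] [Module ℂ X] {ρ : ℤ → X →ₗ[ℂ] X}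

theorem cocyc_neg_neg (c : ℂ) (m n : ℤ) : cocyc c (-n) (-m) = cocyc c m n := by
  unfold cocyc
  by_cases h : m + n = 0
  · have h' : n = -m := by lia
    subst h'
    simp
  · have h' : ¬ (-n + -m = 0) := by lia
    simp only [h, h', if_false]

theorem IsVirRep.dual (hρ : IsVirRep c ρ) : IsVirRep c (fun n => (ρ (-n)).dualMap) := by
  intro m n f
  refine LinearMap.ext fun x => ?_
  have h := congrArg f (hρ (-n) (-m) x)
  rw [cocyc_neg_neg, ← neg_add_rev] at h
  simp only [map_sub, map_add, map_smul, smul_eq_mul] at h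
  simp only [LinearMap.sub_apply, LinearMap.dualMap_apply, LinearMap.add_apply,
    LinearMap.smul_apply, smul_eq_mul]
  rw [h]
  push_cast
  ring

/-- The Virasoro operators on expressions `t ^ a * exp (b * t) * ∑_k f k * t ^ k` with coefficients
in a representation, such that vertex operators of weight `Δ` are the intertwiners into it. -/
def vertexRep (ρ : ℤ → X →ₗ[ℂ] X) (Δ a b : ℂ) (n : ℤ) : (ℤ → X) →ₗ[ℂ] (ℤ → X) where
  toFun f k := ρ n (f k) + ((k : ℂ) + n + a + (1 - n) * Δ) • f (k + n) + b • f (k + n - 1)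
  map_add' f g := by
    refine funext fun k => ?_
    simp only [Pi.add_apply, map_add, smul_add]
    abel
  map_smul' r f := by
    refine funext fun k => ?_
    simp only [Pi.smul_apply, map_smul, smul_add, RingHom.id_apply, smul_comm r]

theorem vertexRep_apply (Δ a b : ℂ) (n : ℤ) (f : ℤ → X) (k : ℤ) :
    vertexRep ρ Δ a b n f k =
      ρ n (f k) + ((k : ℂ) + n + a + (1 - n) * Δ) • f (k + n) + b • f (k + n - 1) := rfl

/-- The operators are a representation on the coefficients plus vector fields acting on densities in
`t`; the two parts commute, and the vector fields have central charge zero. A vertex operator is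
thereby a homomorphism from a cyclic module, fixed by the image of one vector. -/
theorem isVirRep_vertexRep (hρ : IsVirRep c ρ) (Δ a b : ℂ) : IsVirRep c (vertexRep ρ Δ a b) := by
  intro m n f
  refine funext fun k => ?_
  have h := hρ m n (f k)
  simp only [Pi.sub_apply, Pi.add_apply, Pi.smul_apply, vertexRep_apply, map_add, map_smul]
  rw [sub_eq_iff_eq_add.mp h]
  have e1 : k + n + m = k + (m + n) := by ring
  have e2 : k + m + n = k + (m + n) := by ring
  have e5 : k + n - 1 + m = k + (m + n) - 1 := by ring
  have e6 : k + m - 1 + n = k + (m + n) - 1 := by ring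
  have e7 : k + (m + n) - 1 - 1 = k + (m + n) - 2 := by ring
  simp only [e1, e2, e5, e6, e7]
  push_cast
  match_scalars <;> ring1

theorem isVertexOperator_iff {M N : Type} [AddCommGroup M] [Module ℂ M] [AddCommGroup N]
    [Module ℂ N] (actM : ℤ → M →ₗ[ℂ] M) (actN : ℤ → N →ₗ[ℂ] N) (Δ a b : ℂ)
    (V : M →ₗ[ℂ] (ℤ → N)) : IsVertexOperator actM actN Δ a b V ↔
      ∀ n u, V (actM n u) = vertexRep (fun m => actN (-m)) Δ a b (-n) (V u) := by
  unfold IsVertexOperator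
  refine forall_congr' fun n => forall_congr' fun u => ?_
  have e : (fun k => vertexRep (fun m => actN (-m)) Δ a b (-n) (V u) k - actN n (V u k)) =
      tpow n (euler a b (V u) + (((n : ℂ) + 1) * Δ) • V u) := by
    refine funext fun k => ?_
    simp only [vertexRep_apply, tpow, euler, Pi.add_apply, Pi.smul_apply, neg_neg]
    have e1 : k + -n = k - n := by ring
    rw [e1]
    push_cast
    match_scalars <;> ring1
  rw [← e]
  constructor
  · intro h
    refine funext fun k => ?_
    have := congrFun h k
    simpa using this
  · intro h
    rw [h]

end Duals

/-! ### The models -/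

/-- The value `L_n 1` in `Low o` for `n ≤ -o`, extended by zero. -/
def lowBase (o : ℕ) (n : ℤ) : Low o := if n ≤ -(o : ℤ) then Low.gen o (-n - o).toNat else 0

/-- The values `L_n 1` in the model of a Verma module. -/
def vermaBase (Δ : ℂ) : ℤ → Low 1 := lowBase 1 + Δ • (Pi.single 0 1 : ℤ → Low 1)

/-- The values `L_n 1` in the model of a module with `(L_n - e ^ n L_0 - χ n) 1 = 0`, `n > 0`. -/
def whitBase (e : ℂ) (χ : ℤ → ℂ) (n : ℤ) : Low 0 :=
  if n ≤ 0 then Low.gen 0 (-n).toNat else e ^ n • Low.gen 0 0 + χ n • 1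

theorem isBase_vermaBase (Δ : ℂ) : IsBase (vermaBase Δ) := by
  intro i
  have h : (-((i : ℤ) + (1 : ℕ))) ≤ -((1 : ℕ) : ℤ) := by lia
  have h2 : (-((i : ℤ) + (1 : ℕ))) ≠ 0 := by lia
  simp only [vermaBase, lowBase, Pi.add_apply, Pi.smul_apply, if_pos h, Pi.single_eq_of_ne h2,
    smul_zero, add_zero]
  congr 1
  lia

theorem vermaBase_zero (Δ : ℂ) : vermaBase Δ 0 = Δ • 1 := by
  simp [vermaBase, lowBase]

theorem vermaBase_pos (Δ : ℂ) {n : ℤ} (hn : 0 < n) : vermaBase Δ n = 0 := by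
  have h : ¬ (n ≤ -((1 : ℕ) : ℤ)) := by lia
  simp only [vermaBase, lowBase, Pi.add_apply, Pi.smul_apply, if_neg h,
    Pi.single_eq_of_ne hn.ne', smul_zero, add_zero]

theorem isBase_whitBase (e : ℂ) (χ : ℤ → ℂ) : IsBase (whitBase e χ) := by
  intro i
  have h : (-((i : ℤ) + (0 : ℕ))) ≤ 0 := by lia
  simp only [whitBase, if_pos h]
  congr 1
  lia

theorem whitBase_pos (e : ℂ) (χ : ℤ → ℂ) {n : ℤ} (hn : 0 < n) :
    whitBase e χ n = e ^ n • Low.gen 0 0 + χ n • 1 := by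
  simp [whitBase, not_le.mpr hn]

theorem whitBase_zero (e : ℂ) (χ : ℤ → ℂ) : whitBase e χ 0 = Low.gen 0 0 := by
  simp [whitBase]

theorem isVirRep_verma (c Δ : ℂ) : IsVirRep c (opT c 1 (vermaBase Δ)) := by
  refine opT_isVirRep c (isBase_vermaBase Δ) fun m n hm hn => ?_
  have hm' : 0 ≤ m := by lia
  have hn' : 0 ≤ n := by lia
  rcases hm'.eq_or_lt with rfl | hm'
  · rcases hn'.eq_or_lt with rfl | hn'
    · simp [cocyc_zero_left]
    · rw [vermaBase_pos Δ hn', vermaBase_zero, map_zero, map_smul, opT_one, vermaBase_pos Δ hn',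
        zero_add, vermaBase_pos Δ hn', cocyc_zero_left]
      simp
  · rcases hn'.eq_or_lt with rfl | hn'
    · rw [vermaBase_pos Δ hm', vermaBase_zero, map_zero, map_smul, opT_one, vermaBase_pos Δ hm',
        add_zero, vermaBase_pos Δ hm', cocyc_zero_right]
      simp
    · rw [vermaBase_pos Δ hm', vermaBase_pos Δ hn', vermaBase_pos Δ (by lia),
        cocyc_of_ne c (by lia)]
      simp

/-- The elements `L_n - e ^ n L_0`, `n > 0`, span a Lie subalgebra, and `hχ` says that `χ` is a
character of it. The value `e = 0` gives the Whittaker module, `e = 1 / Λ` its deformation. -/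
theorem isVirRep_whit (c e : ℂ) (χ : ℤ → ℂ) (hχ : ∀ m n : ℤ, 0 < m → 0 < n →
    m * e ^ n * χ m - n * e ^ m * χ n = ((m : ℂ) - n) * χ (m + n)) :
    IsVirRep c (opT c 0 (whitBase e χ)) := by
  refine opT_isVirRep c (isBase_whitBase e χ) fun m n hm hn => ?_
  have hm' : 0 < m := by lia
  have hn' : 0 < n := by lia
  have key : ∀ m n : ℤ, 0 < n → opT c 0 (whitBase e χ) m (whitBase e χ n) =
      e ^ n • (Low.gen 0 0 * whitBase e χ m + (m : ℂ) • whitBase e χ m) + χ n • whitBase e χ m := by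
    intro m n hn
    have h0 := opT_gen_mul c (whitBase e χ) m 0 1
    rw [mul_one] at h0
    rw [whitBase_pos e χ hn, map_add, map_smul, map_smul, opT_one, h0]
    simp [cocyc_zero_right]
  have h := hχ m n hm' hn'
  rw [key m n hn', key n m hm', whitBase_pos e χ hm', whitBase_pos e χ hn',
    whitBase_pos e χ (add_pos hm' hn'), cocyc_of_ne c (by lia), zero_smul, add_zero]
  simp only [mul_add, smul_add, mul_smul_comm, mul_one, smul_smul]
  have he : e ^ (m + n) = e ^ m * e ^ n := zpow_add' (by right; left; lia)
  rw [he]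
  match_scalars
  · ring
  · ring
  · linear_combination h

/-! ### Identification of the abstract modules with their models -/

section Equiv

variable {c : ℂ}

/-- The inverse of the map `f`, which comes from a universal property, is `a ↦ a v`. One composite
is the identity because both actions agree on generators, the other because `v` generates `M`. -/
theorem exists_model_equiv {o : ℕ} {z : ℤ → Low o} {M : Type*} [AddCommGroup M] [Module ℂ M]
    {ρ : ℤ → M →ₗ[ℂ] M} (hρ : IsVirRep c ρ) {v : M}
    (ind : ∀ P : M → Prop, P v → (∀ (r : ℂ) x, P x → P (r • x)) →
      (∀ x y, P x → P y → P (x + y)) → (∀ n x, P x → P (ρ n x)) → ∀ x, P x)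
    (hz : IsBase z) (hv : ∀ n, lowHom o hρ (z n) v = ρ n v)
    (hf : ∃ f : M →ₗ[ℂ] Low o, f v = 1 ∧ ∀ n x, f (ρ n x) = opT c o z n (f x)) :
    ∃ e : M ≃ₗ[ℂ] Low o, e v = 1 ∧ ∀ n x, e (ρ n x) = opT c o z n (e x) := by
  obtain ⟨f, hf1, hf2⟩ := hf
  let g : Low o →ₗ[ℂ] M := (LinearMap.applyₗ v).comp (lowHom o hρ).toLinearMap
  have hg : ∀ a, g a = lowHom o hρ a v := fun a => rfl
  refine ⟨LinearEquiv.ofLinearMap f g ?_ ?_, hf1, hf2⟩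
  · refine LinearMap.ext fun a => ?_
    rw [LinearMap.comp_apply, hg, LinearMap.id_apply]
    induction a using Low.induction with
    | hone => simp [hf1]
    | hsmul r a ha => simp [ha]
    | hadd a b ha hb => simp [ha, hb]
    | hgen i a ha => rw [lowHom_gen_mul, hf2, ha, opT_neg c hz]
  · refine LinearMap.ext fun x => ?_
    rw [LinearMap.comp_apply, LinearMap.id_apply]
    refine ind (fun x => g (f x) = x) ?_ ?_ ?_ ?_ x
    · rw [hf1, hg, map_one, Module.End.one_apply]
    · intro r x hx; rw [map_smul, map_smul, hx]
    · intro x y hx hy; rw [map_add, map_add, hx, hy]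
    · intro n x hx
      rw [hf2, hg, lowHom_opT c hρ hv, ← hg, hx]

theorem lowHom_vermaBase {M : Type*} [AddCommGroup M] [Module ℂ M]
    {ρ : ℤ → M →ₗ[ℂ] M} (hρ : IsVirRep c ρ) {v : M} {Δ : ℂ} (hpos : ∀ n : ℤ, 0 < n → ρ n v = 0)
    (hzero : ρ 0 v = Δ • v) (n : ℤ) : lowHom 1 hρ (vermaBase Δ n) v = ρ n v := by
  rcases lt_trichotomy n 0 with hn | rfl | hn
  · obtain ⟨i, hi⟩ : ∃ i : ℕ, n = -((i : ℤ) + (1 : ℕ)) := ⟨(-n - 1).toNat, by lia⟩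
    rw [hi, isBase_vermaBase, lowHom_gen]
  · rw [vermaBase_zero, hzero]
    simp
  · rw [vermaBase_pos Δ hn, hpos n hn]
    simp

theorem exists_vermaEquiv (c Δ : ℂ) : ∃ e : Verma c Δ ≃ₗ[ℂ] Low 1, e (ket c Δ) = 1 ∧
    ∀ n x, e (ketAct c Δ n x) = opT c 1 (vermaBase Δ) n (e x) := by
  have hρ := ketAct_isVirRep c Δ
  refine exists_model_equiv hρ (fun P h1 h2 h3 h4 x => verma_induction h1 h2 h3 h4 x)
    (isBase_vermaBase Δ)
    (lowHom_vermaBase hρ (fun n hn => ketAct_ket_pos c Δ hn) (ketAct_ket_zero c Δ)) ?_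
  refine exists_verma_hom (isVirRep_verma c Δ) ?_ ?_
  · intro n hn
    rw [opT_one, vermaBase_pos Δ hn]
  · rw [opT_one, vermaBase_zero]

/-- The model of a Verma module. -/
def vermaEquiv (c Δ : ℂ) : Verma c Δ ≃ₗ[ℂ] Low 1 := (exists_vermaEquiv c Δ).choose

@[simp] theorem vermaEquiv_ket (c Δ : ℂ) : vermaEquiv c Δ (ket c Δ) = 1 :=
  (exists_vermaEquiv c Δ).choose_spec.1

@[simp] theorem vermaEquiv_act (c Δ : ℂ) (n : ℤ) (x : Verma c Δ) :
    vermaEquiv c Δ (ketAct c Δ n x) = opT c 1 (vermaBase Δ) n (vermaEquiv c Δ x) :=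
  (exists_vermaEquiv c Δ).choose_spec.2 n x

theorem exists_bra_equiv {o : ℕ} {z : ℤ → Low o} {S : Set ℤ} {χ : ℤ → ℂ} (hz : IsBase z)
    (hT : IsVirRep c (opT c o z)) (h1 : ∀ n ∈ S, z (-n) = χ n • 1)
    (hv : ∀ n, lowHom o (isVirRep_braAct c S χ) (z n) (braVac c S χ) =
      braAct c S χ (-n) (braVac c S χ)) :
    ∃ e : Bra c S χ ≃ₗ[ℂ] Low o, e (braVac c S χ) = 1 ∧
      ∀ n x, e (braAct c S χ n x) = opT c o z (-n) (e x) := by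
  obtain ⟨e, he1, he2⟩ := exists_model_equiv (isVirRep_braAct c S χ) (v := braVac c S χ)
    (fun P h1 h2 h3 h4 x => bra_induction h1 h2 h3
      (fun n x hx => by simpa using h4 (-n) x hx) x) hz hv (by
    obtain ⟨f, hf1, hf2⟩ := exists_bra_hom (S := S) (χ := χ) (v := 1) hT (by
      intro n hn
      rw [opT_one, h1 n hn])
    exact ⟨f, hf1, fun n x => by rw [hf2, neg_neg]⟩)
  exact ⟨e, he1, fun n x => by simpa using he2 (-n) x⟩

theorem exists_dualEquiv (c Δ : ℂ) : ∃ e : DualVerma c Δ ≃ₗ[ℂ] Low 1,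
    e (braVac c dualSet (dualChar Δ)) = 1 ∧
      ∀ n x, e (braAct c dualSet (dualChar Δ) n x) = opT c 1 (vermaBase Δ) (-n) (e x) := by
  refine exists_bra_equiv (isBase_vermaBase Δ) (isVirRep_verma c Δ) ?_ ?_
  · intro n hn
    rcases (show n ≤ 0 from hn).eq_or_lt with rfl | hn
    · simp [vermaBase_zero, dualChar]
    · rw [vermaBase_pos Δ (by lia)]
      simp [dualChar, hn.ne]
  · refine lowHom_vermaBase _ ?_ ?_
    · intro n hn
      rw [braAct_vac c _ (show -n ∈ dualSet from neg_nonpos.mpr hn.le)]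
      simp [dualChar, hn.ne']
    · rw [neg_zero, braAct_vac c _ (show (0 : ℤ) ∈ dualSet from le_refl (0 : ℤ))]
      simp [dualChar]

/-- The model of a dual Verma module. -/
def dualEquiv (c Δ : ℂ) : DualVerma c Δ ≃ₗ[ℂ] Low 1 := (exists_dualEquiv c Δ).choose

@[simp] theorem dualEquiv_vac (c Δ : ℂ) : dualEquiv c Δ (braVac c dualSet (dualChar Δ)) = 1 :=
  (exists_dualEquiv c Δ).choose_spec.1

@[simp] theorem dualEquiv_act (c Δ : ℂ) (n : ℤ) (x : DualVerma c Δ) :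
    dualEquiv c Δ (braAct c dualSet (dualChar Δ) n x) =
      opT c 1 (vermaBase Δ) (-n) (dualEquiv c Δ x) :=
  (exists_dualEquiv c Δ).choose_spec.2 n x

/-- The values `L_n 1` in the model of the Whittaker module of `⟨l₁, l₂|`. -/
def whitBase₀ (l₁ l₂ : ℂ) : ℤ → Low 0 := whitBase 0 (fun n => whitChar l₁ l₂ (-n))

theorem whitBase₀_pos (l₁ l₂ : ℂ) {n : ℤ} (hn : 0 < n) :
    whitBase₀ l₁ l₂ n = whitChar l₁ l₂ (-n) • 1 := by
  rw [whitBase₀, whitBase_pos _ _ hn, zero_zpow n hn.ne', zero_smul, zero_add]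

theorem isVirRep_whit₀ (c l₁ l₂ : ℂ) : IsVirRep c (opT c 0 (whitBase₀ l₁ l₂)) := by
  refine isVirRep_whit c 0 _ fun m n hm hn => ?_
  rw [zero_zpow m hm.ne', zero_zpow n hn.ne']
  by_cases h : m = n
  · subst h; simp
  · have h1 : -(m + n) ≠ -1 := by lia
    have h2 : -(m + n) ≠ -2 := by lia
    simp only [whitChar, if_neg h1, if_neg h2]
    simp

theorem exists_whitEquiv (c l₁ l₂ : ℂ) : ∃ e : Whittaker c l₁ l₂ ≃ₗ[ℂ] Low 0,
    e (braVac c whitSet (whitChar l₁ l₂)) = 1 ∧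
      ∀ n x, e (braAct c whitSet (whitChar l₁ l₂) n x) =
        opT c 0 (whitBase₀ l₁ l₂) (-n) (e x) := by
  refine exists_bra_equiv (isBase_whitBase _ _) (isVirRep_whit₀ c l₁ l₂) ?_ ?_
  · intro n hn
    rw [whitBase₀_pos l₁ l₂ (show 0 < -n from neg_pos.mpr hn), neg_neg]
  · intro n
    by_cases hn : 0 < n
    · rw [whitBase₀_pos l₁ l₂ hn, braAct_vac c _ (show -n ∈ whitSet from neg_neg_of_pos hn)]
      simp
    · obtain ⟨i, hi⟩ : ∃ i : ℕ, n = -((i : ℤ) + (0 : ℕ)) := ⟨(-n).toNat, by lia⟩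
      rw [hi, whitBase₀, isBase_whitBase, lowHom_gen]

/-- The model of a Whittaker module. -/
def whitEquiv (c l₁ l₂ : ℂ) : Whittaker c l₁ l₂ ≃ₗ[ℂ] Low 0 := (exists_whitEquiv c l₁ l₂).choose

@[simp] theorem whitEquiv_vac (c l₁ l₂ : ℂ) :
    whitEquiv c l₁ l₂ (braVac c whitSet (whitChar l₁ l₂)) = 1 :=
  (exists_whitEquiv c l₁ l₂).choose_spec.1

@[simp] theorem whitEquiv_act (c l₁ l₂ : ℂ) (n : ℤ) (x : Whittaker c l₁ l₂) :
    whitEquiv c l₁ l₂ (braAct c whitSet (whitChar l₁ l₂) n x) =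
      opT c 0 (whitBase₀ l₁ l₂) (-n) (whitEquiv c l₁ l₂ x) :=
  (exists_whitEquiv c l₁ l₂).choose_spec.2 n x

end Equiv

/-! ### Canonical pairings -/

/-- The character of `Low o` with prescribed values on the generators. -/
def lowChar (o : ℕ) (χ : ℕ → ℂ) (hχ : ∀ i j : ℕ, ((j : ℂ) - i) * χ (i + j + o) = 0) :
    Low o →ₐ[ℂ] ℂ :=
  Low.lift o χ (fun i j => by rw [smul_eq_mul, hχ, mul_comm, sub_self])

theorem lowChar_gen_mul {o : ℕ} {χ : ℕ → ℂ} (hχ : ∀ i j : ℕ, ((j : ℂ) - i) * χ (i + j + o) = 0)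
    (i : ℕ) (a : Low o) : lowChar o χ hχ (Low.gen o i * a) = χ i * lowChar o χ hχ a := by
  rw [map_mul, lowChar, Low.lift_gen]

/-- A pairing is the same as the functional that the generating bra defines on `M_Δ`. Since `M_Δ` is
generated from the highest weight vector by the `L_n`, `n < 0`, and `S` contains all of these, the
functional is forced; it exists if some `f` is an eigenvector for all of `S`. -/
theorem existsUnique_pairing {c Δ : ℂ} {S : Set ℤ} {χ : ℤ → ℂ} (hS : ∀ n : ℤ, n < 0 → n ∈ S)
    {f : Module.Dual ℂ (Low 1)} (hf : f 1 = 1)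
    (hact : ∀ n ∈ S, ∀ x, f (opT c 1 (vermaBase Δ) n x) = χ n * f x) :
    ∃! p : Bra c S χ →ₗ[ℂ] Module.Dual ℂ (Verma c Δ), IsCanonicalPairing c S χ Δ p := by
  have hρ := (ketAct_isVirRep c Δ).dual
  obtain ⟨p, hp1, hp2⟩ := exists_bra_hom hρ (S := S) (χ := χ)
    (v := f.comp (vermaEquiv c Δ).toLinearMap) (by
      intro n hn
      refine LinearMap.ext fun x => ?_
      simp [hact n hn])
  have huniq : ∀ q, IsCanonicalPairing c S χ Δ q → q (braVac c S χ) =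
      f.comp (vermaEquiv c Δ).toLinearMap := by
    intro q hq
    have key : ∀ a : Low 1, q (braVac c S χ) ((vermaEquiv c Δ).symm a) = f a := by
      intro a
      induction a using Low.induction with
      | hone =>
        rw [hf, ← vermaEquiv_ket c Δ, LinearEquiv.symm_apply_apply]
        exact hq.2
      | hsmul r a ha => rw [map_smul, map_smul, map_smul, ha]
      | hadd a b ha hb => rw [map_add, map_add, map_add, ha, hb]
      | hgen i a ha =>
        have hn : (-((i : ℤ) + (1 : ℕ))) ∈ S := hS _ (by lia)
        rw [← opT_neg c (isBase_vermaBase Δ), hact _ hn, ← ha]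
        have e : (vermaEquiv c Δ).symm (opT c 1 (vermaBase Δ) (-((i : ℤ) + (1 : ℕ))) a) =
            ketAct c Δ (-((i : ℤ) + (1 : ℕ))) ((vermaEquiv c Δ).symm a) := by
          rw [LinearEquiv.symm_apply_eq, vermaEquiv_act, LinearEquiv.apply_symm_apply]
        rw [e, ← hq.1, braAct_vac c χ hn, map_smul]
        rfl
    refine LinearMap.ext fun x => ?_
    simpa using key (vermaEquiv c Δ x)
  refine ⟨p, ⟨?_, ?_⟩, ?_⟩
  · intro n u x
    rw [hp2]
    simp
  · rw [hp1]
    simp [hf]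
  · intro q hq
    refine bra_hom_ext (ρ := dualAct c Δ) ?_ ?_ ?_
    · intro n u
      refine LinearMap.ext fun x => ?_
      exact hq.1 n u x
    · intro n u
      rw [hp2, neg_neg]
      rfl
    · rw [huniq q hq, hp1]

theorem existsUnique_whittaker_pairing (c l₁ l₂ Δ : ℂ) :
    ∃! p : Whittaker c l₁ l₂ →ₗ[ℂ] Module.Dual ℂ (Verma c Δ),
      IsCanonicalPairing c whitSet (whitChar l₁ l₂) Δ p := by
  have hχ : ∀ i j : ℕ, ((j : ℂ) - i) * whitChar l₁ l₂ (-(((i + j + 1 : ℕ) : ℤ) + 1)) = 0 := by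
    intro i j
    by_cases h : i = j
    · subst h; simp
    · have h1 : -(((i + j + 1 : ℕ) : ℤ) + 1) ≠ -1 := by lia
      have h2 : -(((i + j + 1 : ℕ) : ℤ) + 1) ≠ -2 := by lia
      rw [whitChar, if_neg h1, if_neg h2, mul_zero]
  refine existsUnique_pairing (fun n hn => hn)
    (f := (lowChar 1 (fun i => whitChar l₁ l₂ (-((i : ℤ) + 1))) hχ).toLinearMap) (by simp) ?_
  intro n hn x
  obtain ⟨i, hi⟩ : ∃ i : ℕ, n = -((i : ℤ) + (1 : ℕ)) :=
    ⟨(-n - 1).toNat, by have : n < 0 := hn; lia⟩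
  rw [hi, opT_neg c (isBase_vermaBase Δ)]
  exact lowChar_gen_mul hχ i x

/-- The projection of `Low 1` to the span of `1` along the other levels. -/
def lowCounit : Low 1 →ₐ[ℂ] ℂ := lowChar 1 0 (by simp)

theorem lowCounit_gen_mul (i : ℕ) (a : Low 1) : lowCounit (Low.gen 1 i * a) = 0 := by
  unfold lowCounit
  rw [lowChar_gen_mul]
  simp

theorem lowCounit_opT_nonpos (c Δ : ℂ) {n : ℤ} (hn : n ≤ 0) (a : Low 1) :
    lowCounit (opT c 1 (vermaBase Δ) n a) = dualChar Δ n * lowCounit a := by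
  rcases hn.eq_or_lt with rfl | hn
  · induction a using Low.induction with
    | hone => simp [vermaBase_zero, dualChar]
    | hsmul r a ha => simp only [map_smul, ha, smul_eq_mul]; ring
    | hadd a b ha hb => simp only [map_add, ha, hb]; ring
    | hgen i a ha =>
      have e : (0 : ℤ) - i - (1 : ℕ) = -((i : ℤ) + (1 : ℕ)) := by ring
      rw [opT_gen_mul, e, opT_neg c (isBase_vermaBase Δ), cocyc_zero_left]
      simp [lowCounit_gen_mul]
  · obtain ⟨i, hi⟩ : ∃ i : ℕ, n = -((i : ℤ) + (1 : ℕ)) := ⟨(-n - 1).toNat, by lia⟩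
    rw [hi, opT_neg c (isBase_vermaBase Δ), lowCounit_gen_mul]
    have : -((i : ℤ) + (1 : ℕ)) ≠ 0 := by lia
    rw [dualChar, if_neg this, zero_mul]

theorem existsUnique_dual_pairing (c Δ : ℂ) :
    ∃! p : DualVerma c Δ →ₗ[ℂ] Module.Dual ℂ (Verma c Δ),
      IsCanonicalPairing c dualSet (dualChar Δ) Δ p :=
  existsUnique_pairing (fun n hn => hn.le) (f := lowCounit.toLinearMap) (by simp)
    (fun _ hn x => lowCounit_opT_nonpos c Δ hn x)

/-! ### Filtrations by the weight of words -/

section Words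

variable {X : Type*} [AddCommGroup X] [Module ℂ X]

/-- The vectors `l i₁ (l i₂ (⋯ v))` with `wt i₁ + wt i₂ + ⋯ = k`. -/
inductive Word (l : ℕ → X →ₗ[ℂ] X) (v : X) (wt : ℕ → ℕ) : ℕ → X → Prop
  | one : Word l v wt 0 v
  | app (i k : ℕ) (x : X) : Word l v wt k x → Word l v wt (k + wt i) (l i x)

/-- The span of the words of weight at most `k`. -/
def wordFil (l : ℕ → X →ₗ[ℂ] X) (v : X) (wt : ℕ → ℕ) (k : ℤ) : Submodule ℂ X :=
  Submodule.span ℂ {x | ∃ j : ℕ, (j : ℤ) ≤ k ∧ Word l v wt j x}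

/-- The span of the words of weight `k`. -/
def wordGr (l : ℕ → X →ₗ[ℂ] X) (v : X) (wt : ℕ → ℕ) (k : ℤ) : Submodule ℂ X :=
  Submodule.span ℂ {x | ∃ j : ℕ, (j : ℤ) = k ∧ Word l v wt j x}

variable {l : ℕ → X →ₗ[ℂ] X} {v : X} {wt : ℕ → ℕ}

theorem wordFil_mono {j k : ℤ} (h : j ≤ k) : wordFil l v wt j ≤ wordFil l v wt k :=
  Submodule.span_mono fun _ ⟨i, hi, hx⟩ => ⟨i, hi.trans h, hx⟩

theorem Word.mem_fil {j : ℕ} {k : ℤ} {x : X} (hx : Word l v wt j x) (h : (j : ℤ) ≤ k) :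
    x ∈ wordFil l v wt k := Submodule.subset_span ⟨j, h, hx⟩

theorem Word.mem_gr {j : ℕ} {x : X} (hx : Word l v wt j x) : x ∈ wordGr l v wt j :=
  Submodule.subset_span ⟨j, rfl, hx⟩

theorem wordFil_le {k : ℤ} {K : Submodule ℂ X}
    (h : ∀ j : ℕ, (j : ℤ) ≤ k → ∀ x, Word l v wt j x → x ∈ K) : wordFil l v wt k ≤ K :=
  Submodule.span_le.mpr fun x ⟨j, hj, hx⟩ => h j hj x hx

theorem wordGr_le {k : ℤ} {K : Submodule ℂ X}
    (h : ∀ j : ℕ, (j : ℤ) = k → ∀ x, Word l v wt j x → x ∈ K) : wordGr l v wt k ≤ K :=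
  Submodule.span_le.mpr fun x ⟨j, hj, hx⟩ => h j hj x hx

theorem wordGr_neg {k : ℤ} (hk : k < 0) : wordGr l v wt k = ⊥ :=
  le_bot_iff.mp (wordGr_le fun j hj _ _ => by lia)

theorem app_mem_wordFil (i : ℕ) {k : ℤ} {x : X} (hx : x ∈ wordFil l v wt k) :
    l i x ∈ wordFil l v wt (k + wt i) := by
  have : wordFil l v wt k ≤ (wordFil l v wt (k + wt i)).comap (l i) :=
    wordFil_le fun j hj x hx => (Word.app i j x hx).mem_fil (by push_cast; lia)
  exact this hx

theorem app_mem_wordGr (i : ℕ) {k : ℤ} {x : X} (hx : x ∈ wordGr l v wt k) :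
    l i x ∈ wordGr l v wt (k + wt i) := by
  have : wordGr l v wt k ≤ (wordGr l v wt (k + wt i)).comap (l i) :=
    wordGr_le fun j hj x hx => by
      have h := (Word.app i j x hx).mem_gr
      push_cast at h
      rwa [hj] at h
  exact this hx

theorem wordFil_zero (hwt : ∀ i, 0 < wt i) : wordFil l v wt 0 ≤ Submodule.span ℂ {v} := by
  refine wordFil_le fun j hj x hx => ?_
  cases hx with
  | one => exact Submodule.mem_span_singleton_self v
  | app i k x hx => have := hwt i; lia

/-- The condition `i < wt i` bounds every letter by the weight, and also the length, since each
letter has positive weight. -/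
theorem finite_words (hwt : ∀ i, i < wt i) (k : ℕ) : {x | Word l v wt k x}.Finite := by
  induction k using Nat.strong_induction_on with
  | _ k ih =>
    have hsub : {x | Word l v wt k x} ⊆
        {v} ∪ ⋃ i ∈ Finset.range k, ⋃ j ∈ Finset.range k, l i '' {x | j < k ∧ Word l v wt j x} := by
      intro x hx
      cases hx with
      | one => exact Or.inl rfl
      | app i j x hx =>
        have := hwt i
        refine Or.inr ?_
        simp only [Set.mem_iUnion]
        exact ⟨i, Finset.mem_range.mpr (by lia), j, Finset.mem_range.mpr (by lia), x,
          ⟨by lia, hx⟩, rfl⟩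
    refine Set.Finite.subset (Set.Finite.union (Set.finite_singleton v) ?_) hsub
    refine Set.Finite.biUnion (Finset.finite_toSet _) fun i _ => ?_
    refine Set.Finite.biUnion (Finset.finite_toSet _) fun j hj => Set.Finite.image _ ?_
    exact (ih j (Finset.mem_range.mp hj)).subset fun x hx => hx.2

theorem finiteDimensional_wordGr (hwt : ∀ i, i < wt i) (k : ℤ) :
    FiniteDimensional ℂ (wordGr l v wt k) := by
  refine FiniteDimensional.span_of_finite ℂ ?_
  refine (finite_words (l := l) (v := v) hwt k.toNat).subset ?_
  rintro x ⟨j, hj, hx⟩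
  have : k.toNat = j := by lia
  rw [Set.mem_ofPred_eq, this]
  exact hx

/-- Operators `Y n` that behave like `wt n * ∂ / ∂ (l n)` up to terms of lower weight lower the
weight. -/
theorem lower_mem_wordFil {Y : ℕ → X →ₗ[ℂ] X} (hv : ∀ n, Y n v = 0)
    (hcomm : ∀ n p k x, x ∈ wordFil l v wt k → Y n (l p x) - l p (Y n x) -
      (if n = p then (wt p : ℂ) else 0) • x ∈ wordFil l v wt (k + wt p - wt n - 1))
    (n : ℕ) {k : ℤ} {x : X} (hx : x ∈ wordFil l v wt k) : Y n x ∈ wordFil l v wt (k - wt n) := by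
  have key : ∀ (j : ℕ) (x : X), Word l v wt j x → Y n x ∈ wordFil l v wt (j - wt n) := by
    intro j x hx
    induction hx with
    | one => rw [hv]; exact zero_mem _
    | app p j x hx ih =>
      have h1 := hcomm n p j x (hx.mem_fil le_rfl)
      have h2 := app_mem_wordFil p ih
      have h3 : (if n = p then (wt p : ℂ) else 0) • x ∈ wordFil l v wt ((j + wt p : ℕ) - wt n) := by
        split_ifs with h
        · subst h
          exact Submodule.smul_mem _ _ (hx.mem_fil (by push_cast; lia))
        · rw [zero_smul]; exact zero_mem _
      have h4 := add_mem (add_mem (wordFil_mono (by push_cast; lia) h1)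
        (wordFil_mono (k := (j + wt p : ℕ) - wt n) (by push_cast; lia) h2)) h3
      convert h4 using 1
      abel
  have : wordFil l v wt k ≤ (wordFil l v wt (k - wt n)).comap (Y n) :=
    wordFil_le fun j hj x hx => wordFil_mono (by lia) (key j x hx)
  exact this hx

/-- The Euler operator `∑ l n ∘ Y n` is the weight up to terms of lower weight. -/
theorem euler_wordFil {Y : ℕ → X →ₗ[ℂ] X} (hv : ∀ n, Y n v = 0)
    (hcomm : ∀ n p k x, x ∈ wordFil l v wt k → Y n (l p x) - l p (Y n x) -
      (if n = p then (wt p : ℂ) else 0) • x ∈ wordFil l v wt (k + wt p - wt n - 1))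
    (hl : ∀ n p k x, x ∈ wordFil l v wt k →
      l n (l p x) - l p (l n x) ∈ wordFil l v wt (k + wt n + wt p - 1))
    {k : ℤ} {x : X} (hx : x ∈ wordFil l v wt k) :
    ∃ N₀ : ℕ, ∀ N ≥ N₀, ∑ n ∈ Finset.range N, l n (Y n x) - (k : ℂ) • x
      ∈ wordFil l v wt (k - 1) := by
  have key : ∀ (j : ℕ) (x : X), Word l v wt j x → ∃ N₀ : ℕ, ∀ N ≥ N₀,
      ∑ n ∈ Finset.range N, l n (Y n x) - (j : ℂ) • x ∈ wordFil l v wt (j - 1) := by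
    intro j x hx
    induction hx with
    | one => exact ⟨0, fun N _ => by simp [hv]⟩
    | app p j x hx ih =>
      obtain ⟨N₀, hN₀⟩ := ih
      refine ⟨max N₀ (p + 1), fun N hN => ?_⟩
      have h0 := app_mem_wordFil p (hN₀ N (le_of_max_le_left hN))
      have h1 : ∑ n ∈ Finset.range N, l n (Y n (l p x) - l p (Y n x) -
          (if n = p then (wt p : ℂ) else 0) • x) ∈ wordFil l v wt (j + wt p - 1) := by
        refine sum_mem fun n _ => ?_
        have := app_mem_wordFil n (hcomm n p j x (hx.mem_fil le_rfl))
        exact wordFil_mono (by lia) this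
      have h2 : ∑ n ∈ Finset.range N, (l n (l p (Y n x)) - l p (l n (Y n x)))
          ∈ wordFil l v wt (j + wt p - 1) := by
        refine sum_mem fun n _ => ?_
        have := hl n p _ _ (lower_mem_wordFil hv hcomm n (hx.mem_fil le_rfl))
        exact wordFil_mono (by lia) this
      have h3 : ∑ n ∈ Finset.range N, l n ((if n = p then (wt p : ℂ) else 0) • x) =
          (wt p : ℂ) • l p x := by
        rw [Finset.sum_eq_single_of_mem p (Finset.mem_range.mpr (by lia))]
        · simp
        · intro n _ hn
          simp [hn]
      have h4 := add_mem (add_mem h1 h2) (wordFil_mono (k := j + wt p - 1) (by lia) h0)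
      simp only [map_sub, Finset.sum_sub_distrib, h3, map_sum] at h4
      rw [map_smul] at h4
      have e : ((j + wt p : ℕ) : ℤ) - 1 = j + wt p - 1 := by push_cast; ring
      rw [e, Nat.cast_add, add_smul]
      convert h4 using 1
      abel
  unfold wordFil at hx
  induction hx using Submodule.span_induction with
  | mem x hx =>
    obtain ⟨j, hj, hx⟩ := hx
    obtain ⟨N₀, hN₀⟩ := key j x hx
    refine ⟨N₀, fun N hN => ?_⟩
    rcases hj.eq_or_lt with rfl | hj
    · exact_mod_cast hN₀ N hN
    · have h1 := wordFil_mono (k := k - 1) (by lia) (hN₀ N hN)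
      have h2 : ((j : ℂ) - k) • x ∈ wordFil l v wt (k - 1) :=
        Submodule.smul_mem _ _ (hx.mem_fil (by lia))
      convert add_mem h1 h2 using 1
      module
  | zero => exact ⟨0, fun N _ => by simp⟩
  | add x y _ _ hx hy =>
    obtain ⟨N₁, h1⟩ := hx
    obtain ⟨N₂, h2⟩ := hy
    refine ⟨max N₁ N₂, fun N hN => ?_⟩
    convert add_mem (h1 N (le_of_max_le_left hN)) (h2 N (le_of_max_le_right hN)) using 1
    simp only [map_add, Finset.sum_add_distrib]
    module
  | smul r x _ hx =>
    obtain ⟨N₁, h1⟩ := hx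
    refine ⟨N₁, fun N hN => ?_⟩
    convert Submodule.smul_mem _ r (h1 N hN) using 1
    simp only [map_smul, ← Finset.smul_sum]
    module

/-- The Euler operator is multiplication by `k` modulo weight `k - 1`. If it annihilates `x`, then
`x` drops one step of the filtration, and repeating this leads to weight `0`. -/
theorem mem_span_of_lower_eq_zero {Y : ℕ → X →ₗ[ℂ] X} (hwt : ∀ i, 0 < wt i)
    (hv : ∀ n, Y n v = 0)
    (hcomm : ∀ n p k x, x ∈ wordFil l v wt k → Y n (l p x) - l p (Y n x) -
      (if n = p then (wt p : ℂ) else 0) • x ∈ wordFil l v wt (k + wt p - wt n - 1))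
    (hl : ∀ n p k x, x ∈ wordFil l v wt k →
      l n (l p x) - l p (l n x) ∈ wordFil l v wt (k + wt n + wt p - 1))
    {k : ℕ} {x : X} (hx : x ∈ wordFil l v wt k)
    (h0 : ∃ N₁, ∀ N ≥ N₁, ∑ n ∈ Finset.range N, l n (Y n x) = 0) :
    x ∈ Submodule.span ℂ {v} := by
  obtain ⟨N₁, hN₁⟩ := h0
  induction k with
  | zero => exact wordFil_zero hwt (by simpa using hx)
  | succ k ih =>
    obtain ⟨N₀, hN₀⟩ := euler_wordFil hv hcomm hl hx
    have h := hN₀ (max N₀ N₁) (le_max_left _ _)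
    rw [hN₁ _ (le_max_right _ _), zero_sub, neg_mem_iff] at h
    have hk : (((k + 1 : ℕ) : ℤ) : ℂ) ≠ 0 := by exact_mod_cast Nat.succ_ne_zero k
    rw [Submodule.smul_mem_iff _ hk] at h
    exact ih (by simpa using h)

end Words

/-! ### Functions of polynomial growth with values in a vector space -/

section Small

open Asymptotics

variable {X Y : Type*} [AddCommGroup X] [Module ℂ X] [AddCommGroup Y] [Module ℂ Y]

/-- The functions of order `O(Λ ^ (-J))` as `Λ → ∞`. -/
def Small (X : Type*) [AddCommGroup X] [Module ℂ X] (J : ℤ) : Submodule ℂ (ℂ → X) :=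
  Submodule.span ℂ {f | ∃ (g : ℂ → ℂ) (x : X),
    g =O[Bornology.cobounded ℂ] (fun s : ℂ => s ^ (-J)) ∧
      ∀ᶠ s in Bornology.cobounded ℂ, f s = g s • x}

theorem small_smul_const {J : ℤ} {g : ℂ → ℂ}
    (hg : g =O[Bornology.cobounded ℂ] (fun s : ℂ => s ^ (-J))) (x : X) :
    (fun s => g s • x) ∈ Small X J :=
  Submodule.subset_span ⟨g, x, hg, Eventually.of_forall fun _ => rfl⟩

theorem small_congr {J : ℤ} {f g : ℂ → X} (hf : f ∈ Small X J)
    (h : ∀ᶠ s in Bornology.cobounded ℂ, g s = f s) : g ∈ Small X J := by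
  have : g - f ∈ Small X J := by
    refine Submodule.subset_span ⟨0, 0, isBigO_zero _ _, ?_⟩
    filter_upwards [h] with s hs
    simp [hs]
  simpa using add_mem this hf

theorem small_map (T : X →ₗ[ℂ] Y) {J : ℤ} {f : ℂ → X} (hf : f ∈ Small X J) :
    (fun s => T (f s)) ∈ Small Y J := by
  unfold Small at hf
  induction hf using Submodule.span_induction with
  | mem f hf =>
    obtain ⟨g, x, hg, h⟩ := hf
    refine small_congr (small_smul_const hg (T x)) ?_
    filter_upwards [h] with s hs
    rw [hs, map_smul]
  | zero => simp only [Pi.zero_apply, map_zero]; exact zero_mem _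
  | add f g _ _ hf hg => simp only [Pi.add_apply, map_add]; exact add_mem hf hg
  | smul r f _ hf => simp only [Pi.smul_apply, map_smul]; exact Submodule.smul_mem _ r hf

theorem isBigO_zpow_mul {I J : ℤ} {g h : ℂ → ℂ}
    (hg : g =O[Bornology.cobounded ℂ] (fun s : ℂ => s ^ (-I)))
    (hh : h =O[Bornology.cobounded ℂ] (fun s : ℂ => s ^ (-J))) :
    (fun s => g s * h s) =O[Bornology.cobounded ℂ] (fun s : ℂ => s ^ (-(I + J))) := by
  refine (hg.mul hh).congr' EventuallyEq.rfl ?_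
  filter_upwards [Bornology.eventually_ne_cobounded (0 : ℂ)] with s hs
  rw [← zpow_add₀ hs]
  congr 1
  ring

theorem small_smul {I J : ℤ} {g : ℂ → ℂ}
    (hg : g =O[Bornology.cobounded ℂ] (fun s : ℂ => s ^ (-I))) {f : ℂ → X} (hf : f ∈ Small X J) :
    (fun s => g s • f s) ∈ Small X (I + J) := by
  unfold Small at hf
  induction hf using Submodule.span_induction with
  | mem f hf =>
    obtain ⟨h, x, hh, hfx⟩ := hf
    refine small_congr (small_smul_const (isBigO_zpow_mul hg hh) x) ?_
    filter_upwards [hfx] with s hs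
    rw [hs, smul_smul]
  | zero => simp only [Pi.zero_apply, smul_zero]; exact zero_mem _
  | add f g _ _ hf hg => simp only [Pi.add_apply, smul_add]; exact add_mem hf hg
  | smul r f _ hf =>
    simp only [Pi.smul_apply, smul_comm _ r]
    exact Submodule.smul_mem _ r hf

theorem isBigO_zpow_zpow {I J : ℤ} (h : J ≤ I) :
    (fun s : ℂ => s ^ (-I)) =O[Bornology.cobounded ℂ] (fun s : ℂ => s ^ (-J)) := by
  refine IsBigO.of_bound 1 ?_
  filter_upwards [(tendsto_norm_cobounded_atTop (E := ℂ)).eventually_ge_atTop 1] with s hs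
  rw [norm_zpow, norm_zpow, one_mul]
  exact zpow_le_zpow_right₀ hs (by lia)

theorem small_mono {I J : ℤ} (h : J ≤ I) {f : ℂ → X} (hf : f ∈ Small X I) : f ∈ Small X J := by
  unfold Small at hf ⊢
  refine Submodule.span_mono ?_ hf
  rintro f ⟨g, x, hg, hfx⟩
  exact ⟨g, x, hg.trans (isBigO_zpow_zpow h), hfx⟩

theorem small_zpow_smul (I : ℤ) {J : ℤ} {f : ℂ → X} (hf : f ∈ Small X J) :
    (fun s => s ^ (-I) • f s) ∈ Small X (I + J) := small_smul (isBigO_refl _ _) hf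

theorem small_const (x : X) : (fun _ => x) ∈ Small X 0 := by
  have : (fun _ : ℂ => (1 : ℂ)) =O[Bornology.cobounded ℂ] (fun s : ℂ => s ^ (-(0 : ℤ))) := by
    simpa using isBigO_refl (fun _ : ℂ => (1 : ℂ)) (Bornology.cobounded ℂ)
  simpa using small_smul_const this x

theorem small_isBigO {E : Type*} [NormedAddCommGroup E] [NormedSpace ℂ E] {J : ℤ} {f : ℂ → E}
    (hf : f ∈ Small E J) : f =O[Bornology.cobounded ℂ] (fun s : ℂ => s ^ (-J)) := by
  unfold Small at hf
  induction hf using Submodule.span_induction with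
  | mem f hf =>
    obtain ⟨g, x, hg, hfx⟩ := hf
    have h1 : (fun s => g s • x) =O[Bornology.cobounded ℂ] (fun s : ℂ => s ^ (-J)) := by
      refine IsBigO.trans ?_ hg
      refine IsBigO.of_bound ‖x‖ (Eventually.of_forall fun s => ?_)
      rw [norm_smul, mul_comm]
    exact h1.congr' (hfx.mono fun s hs => hs.symm) EventuallyEq.rfl
  | zero => exact isBigO_zero _ _
  | add f g _ _ hf hg => exact hf.add hg
  | smul r f _ hf => exact hf.const_smul_left r

theorem small_tendsto {f : ℂ → ℂ} (hf : f ∈ Small ℂ 1) :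
    Tendsto f (Bornology.cobounded ℂ) (𝓝 0) := by
  refine (small_isBigO hf).trans_tendsto ?_
  simpa using tendsto_inv₀_cobounded (α := ℂ)

/-- A constant function of order `O(Λ ^ (-1))` vanishes. -/
theorem eq_zero_of_small_const {x : X} (hx : (fun _ => x) ∈ Small X 1) : x = 0 := by
  refine (Module.forall_dual_apply_eq_zero_iff ℂ x).mp fun f => ?_
  exact tendsto_nhds_unique tendsto_const_nhds (small_tendsto (small_map f hx))

/-- The solutions of linear equations with an operator `E₁ + Δ E₂` on a finite-dimensional space
such that `E₂` is injective, for large `Δ`. -/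
theorem perturbation (G : Submodule ℂ X) [FiniteDimensional ℂ G] (E₁ E₂ : X →ₗ[ℂ] Y)
    (hinj : ∀ x ∈ G, E₂ x = 0 → x = 0) :
    (∃ R : ℝ, ∀ Δ : ℂ, R < ‖Δ‖ → ∀ x ∈ G, E₁ x + Δ • E₂ x = 0 → x = 0) ∧
    ∀ (Δ : ℂ → ℂ) (f : ℂ → X) (y : ℂ → Y) (J : ℤ),
      Tendsto (fun s => ‖Δ s‖) (Bornology.cobounded ℂ) atTop →
      (∀ᶠ s in Bornology.cobounded ℂ, f s ∈ G) →
      (∀ᶠ s in Bornology.cobounded ℂ, E₁ (f s) + Δ s • E₂ (f s) = y s) →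
      y ∈ Small Y J → f ∈ Small X J := by
  let b := Module.finBasis ℂ G
  let n := Module.finrank ℂ G
  let e : G ≃ₗ[ℂ] (Fin n → ℂ) := b.equivFun
  let ι : (Fin n → ℂ) →ₗ[ℂ] X := G.subtype.comp e.symm.toLinearMap
  have hι : LinearMap.ker (E₂.comp ι) = ⊥ := by
    rw [LinearMap.ker_eq_bot']
    intro ξ hξ
    have := hinj (ι ξ) (e.symm ξ).2 hξ
    have h2 : e.symm ξ = 0 := Subtype.ext this
    simpa using h2
  -- In coordinates, a left inverse of `E₂` turns `E₁ + Δ E₂` into `A + Δ`. For `‖A‖ + 1 < ‖Δ‖` this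
  -- is bounded below by `1`, which gives both injectivity and the transfer of growth bounds from
  -- the right-hand side to the solution.
  obtain ⟨C, hC⟩ := LinearMap.exists_leftInverse_of_injective (E₂.comp ι) hι
  have hC' : ∀ ξ, C (E₂ (ι ξ)) = ξ := fun ξ => LinearMap.congr_fun hC ξ
  let A : (Fin n → ℂ) →L[ℂ] (Fin n → ℂ) := (C.comp (E₁.comp ι)).toContinuousLinearMap
  have hA : ∀ ξ, A ξ = C (E₁ (ι ξ)) := fun ξ => rfl
  have main : ∀ (Δ : ℂ) (ξ : Fin n → ℂ), ‖A‖ + 1 < ‖Δ‖ →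
      ‖ξ‖ ≤ ‖C (E₁ (ι ξ) + Δ • E₂ (ι ξ))‖ := by
    intro Δ ξ hΔ
    rw [map_add, map_smul, hC', ← hA]
    have h1 : ‖Δ • ξ‖ ≤ ‖A ξ + Δ • ξ‖ + ‖A ξ‖ := by
      have := norm_sub_le (A ξ + Δ • ξ) (A ξ)
      simpa using this
    have h2 := A.le_opNorm ξ
    rw [norm_smul] at h1
    nlinarith [norm_nonneg ξ]
  have hx : ∀ x ∈ G, ∃ ξ, ι ξ = x := fun x hx => ⟨e ⟨x, hx⟩, by simp [ι]⟩
  refine ⟨⟨‖A‖ + 1, fun Δ hΔ x hxG h => ?_⟩, fun Δ f y J hΔ hf hy hsmall => ?_⟩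
  · obtain ⟨ξ, rfl⟩ := hx x hxG
    have := main Δ ξ hΔ
    rw [h, map_zero, norm_zero] at this
    rw [norm_le_zero_iff.mp this, map_zero]
  · choose! ξ hξ using hx
    have h1 : (fun s => ξ (f s)) =O[Bornology.cobounded ℂ] (fun s : ℂ => s ^ (-J)) := by
      refine IsBigO.trans ?_ (small_isBigO (small_map C hsmall))
      refine IsBigO.of_bound 1 ?_
      filter_upwards [hf, hy, hΔ.eventually_gt_atTop (‖A‖ + 1)] with s hfs hys hΔs
      have := main (Δ s) (ξ (f s)) hΔs
      rw [hξ _ hfs, hys] at this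
      rwa [one_mul]
    have h2 : (fun s => ∑ i, ξ (f s) i • (ι (Pi.single i 1))) ∈ Small X J := by
      have : (fun s => ∑ i, ξ (f s) i • (ι (Pi.single i 1))) =
          ∑ i, fun s => ξ (f s) i • (ι (Pi.single i 1)) := by
        ext s
        rw [Finset.sum_apply]
      rw [this]
      refine sum_mem fun i _ => small_smul_const ?_ _
      exact (isBigO_pi.mp h1) i
    refine small_congr h2 ?_
    filter_upwards [hf] with s hs
    conv_lhs => rw [← hξ _ hs]
    simp only [← map_smul, ← map_sum]
    congr 1
    ext j
    simp [Finset.sum_apply, Pi.single_apply]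

end Small

/-! ### Levels of Verma modules and singular vectors -/

/-- Multiplication by a generator. -/
def lowMul (o i : ℕ) : Low o →ₗ[ℂ] Low o := LinearMap.mulLeft ℂ (Low.gen o i)

@[simp] theorem lowMul_apply (o i : ℕ) (x : Low o) : lowMul o i x = Low.gen o i * x := rfl

theorem lowMul_comm (o n p : ℕ) (x : Low o) : lowMul o n (lowMul o p x) -
    lowMul o p (lowMul o n x) = ((p : ℂ) - n) • lowMul o (n + p + o) x := by
  have h := congrArg (· * x) (Low.gen_comm o n p)
  simp only [sub_mul, mul_assoc, smul_mul_assoc] at h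
  exact h

theorem exists_mem_wordFil {o : ℕ} (wt : ℕ → ℕ) (x : Low o) :
    ∃ k : ℕ, x ∈ wordFil (lowMul o) 1 wt k := by
  induction x using Low.induction with
  | hone => exact ⟨0, Word.one.mem_fil le_rfl⟩
  | hsmul r x hx =>
    obtain ⟨k, hk⟩ := hx
    exact ⟨k, Submodule.smul_mem _ r hk⟩
  | hadd x y hx hy =>
    obtain ⟨k, hk⟩ := hx
    obtain ⟨j, hj⟩ := hy
    exact ⟨max k j, add_mem (wordFil_mono (by simp) hk) (wordFil_mono (by simp) hj)⟩
  | hgen i x hx =>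
    obtain ⟨k, hk⟩ := hx
    exact ⟨k + wt i, by simpa using app_mem_wordFil i hk⟩

/-- The vectors of level `k` in the model of a Verma module. -/
def lev (k : ℤ) : Submodule ℂ (Low 1) := wordGr (lowMul 1) 1 (fun i => i + 1) k

instance (k : ℤ) : FiniteDimensional ℂ (lev k) := finiteDimensional_wordGr (fun i => Nat.lt_succ_self i) k

theorem one_mem_lev : (1 : Low 1) ∈ lev 0 := Word.one.mem_gr

theorem gen_mul_mem_lev (i : ℕ) {k : ℤ} {x : Low 1} (hx : x ∈ lev k) :
    Low.gen 1 i * x ∈ lev (k + i + 1) := by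
  have := app_mem_wordGr i hx
  rw [Nat.cast_add, Nat.cast_one, ← add_assoc] at this
  exact this

theorem lev_induction {K : ℤ → Submodule ℂ (Low 1)} (h1 : 1 ∈ K 0)
    (hgen : ∀ (i : ℕ) (k : ℤ) (x : Low 1), x ∈ lev k → x ∈ K k → Low.gen 1 i * x ∈ K (k + i + 1))
    (k : ℤ) : lev k ≤ K k := by
  refine wordGr_le fun j hj x hx => ?_
  subst hj
  induction hx with
  | one => exact h1
  | app i j x hx ih =>
    have := hgen i j x hx.mem_gr ih
    push_cast
    rwa [← add_assoc]

theorem mem_iSup_lev (x : Low 1) : x ∈ ⨆ k, lev k := by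
  induction x using Low.induction with
  | hone => exact Submodule.mem_iSup_of_mem 0 one_mem_lev
  | hsmul r x hx => exact Submodule.smul_mem _ r hx
  | hadd x y hx hy => exact add_mem hx hy
  | hgen i x hx =>
    have : ⨆ k, lev k ≤ (⨆ k, lev k).comap (lowMul 1 i) :=
      iSup_le fun k x hx => Submodule.mem_iSup_of_mem _ (gen_mul_mem_lev i hx)
    exact this hx

theorem vermaBase_mem_lev (Δ : ℂ) (n : ℤ) : vermaBase Δ n ∈ lev (-n) := by
  rcases lt_trichotomy n 0 with hn | rfl | hn
  · obtain ⟨i, rfl⟩ : ∃ i : ℕ, n = -((i : ℤ) + (1 : ℕ)) := ⟨(-n - 1).toNat, by lia⟩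
    rw [isBase_vermaBase]
    have := gen_mul_mem_lev i one_mem_lev
    rw [mul_one] at this
    convert this using 1
    push_cast
    ring_nf
  · rw [vermaBase_zero, neg_zero]
    exact Submodule.smul_mem _ _ one_mem_lev
  · rw [vermaBase_pos Δ hn]
    exact zero_mem _

theorem opT_mem_lev (c Δ : ℂ) (n : ℤ) {k : ℤ} {x : Low 1} (hx : x ∈ lev k) :
    opT c 1 (vermaBase Δ) n x ∈ lev (k - n) := by
  have : lev k ≤ ⨅ n : ℤ, (lev (k - n)).comap (opT c 1 (vermaBase Δ) n) := by
    refine lev_induction (K := fun k => ⨅ n : ℤ, (lev (k - n)).comap (opT c 1 (vermaBase Δ) n))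
      ?_ ?_ k
    · rw [Submodule.mem_iInf]
      intro n
      rw [Submodule.mem_comap, opT_one, zero_sub]
      exact vermaBase_mem_lev Δ n
    · intro i k x hx ih
      rw [Submodule.mem_iInf] at ih ⊢
      intro n
      have h1 := ih n
      have h2 := ih (n - i - (1 : ℕ))
      rw [Submodule.mem_comap] at h1 h2 ⊢
      rw [opT_gen_mul]
      refine add_mem (add_mem ?_ (Submodule.smul_mem _ _ ?_)) ?_
      · convert gen_mul_mem_lev i h1 using 1
        ring_nf
      · convert h2 using 1
        push_cast
        ring_nf
      · by_cases h : n + -((i : ℤ) + (1 : ℕ)) = 0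
        · refine Submodule.smul_mem _ _ ?_
          convert hx using 2
          push_cast at h
          lia
        · rw [cocyc_of_ne c h, zero_smul]
          exact zero_mem _
  have h2 := this hx
  rw [Submodule.mem_iInf] at h2
  exact h2 n

theorem opT_zero_of_mem_lev (c Δ : ℂ) {k : ℤ} {x : Low 1} (hx : x ∈ lev k) :
    opT c 1 (vermaBase Δ) 0 x = (Δ + k) • x := by
  have : lev k ≤ LinearMap.ker (opT c 1 (vermaBase Δ) 0 - (Δ + k) • LinearMap.id) := by
    refine lev_induction (K := fun k : ℤ => LinearMap.ker
      (opT c 1 (vermaBase Δ) 0 - (Δ + k) • LinearMap.id)) ?_ ?_ k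
    · simp [vermaBase_zero]
    · intro i k x _ ih
      simp only [LinearMap.mem_ker, LinearMap.sub_apply, LinearMap.smul_apply, LinearMap.id_apply]
        at ih ⊢
      have e : (0 : ℤ) - i - (1 : ℕ) = -((i : ℤ) + (1 : ℕ)) := by ring
      rw [opT_gen_mul, e, opT_neg c (isBase_vermaBase Δ), cocyc_zero_left, sub_eq_zero.mp ih,
        mul_smul_comm]
      push_cast
      module
  have h := this hx
  simpa [sub_eq_zero] using h

/-- The coefficient of `Δ` in the action of `L_n` on the Verma module. -/
abbrev opΔ (c : ℂ) (n : ℤ) : Low 1 →ₗ[ℂ] Low 1 := opS c 1 (Pi.single 0 1) n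

theorem opT_vermaBase (c Δ : ℂ) (n : ℤ) (x : Low 1) :
    opT c 1 (vermaBase Δ) n x = opT c 1 (lowBase 1) n x + Δ • opΔ c n x := by
  rw [vermaBase, opT_add, opS_smul]
  rfl

theorem opΔ_neg (c : ℂ) {n : ℤ} (hn : n < 0) (x : Low 1) : opΔ c n x = 0 := by
  induction x using Low.induction generalizing n with
  | hone => rw [opS_one, Pi.single_eq_of_ne hn.ne]
  | hsmul r x hx => rw [map_smul, hx hn, smul_zero]
  | hadd x y hx hy => rw [map_add, hx hn, hy hn, add_zero]
  | hgen i x hx => rw [opS_gen_mul, hx hn, hx (by lia), mul_zero, smul_zero, add_zero]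

theorem opΔ_zero (c : ℂ) (x : Low 1) : opΔ c 0 x = x := by
  induction x using Low.induction with
  | hone => rw [opS_one, Pi.single_eq_same]
  | hsmul r x hx => rw [map_smul, hx]
  | hadd x y hx hy => rw [map_add, hx, hy]
  | hgen i x hx => rw [opS_gen_mul, hx, opΔ_neg c (by lia), smul_zero, add_zero]

theorem opΔ_mem_lev (c : ℂ) (n : ℤ) {k : ℤ} {x : Low 1} (hx : x ∈ lev k) :
    opΔ c n x ∈ lev (k - n) := by
  have h0 := opT_mem_lev c 0 n hx
  have h1 := opT_mem_lev c 1 n hx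
  rw [opT_vermaBase] at h0 h1
  have := sub_mem h1 h0
  simpa using this

/-- The filtration of the model of a Verma module by the length of words. -/
abbrev lenFil (k : ℤ) : Submodule ℂ (Low 1) := wordFil (lowMul 1) 1 (fun _ => 1) k

/-- The weight `Δ` appears only when `L_n` has been commuted down to `L_0`, and this uses up at
least one letter of the word. -/
theorem opΔ_mem_lenFil (c : ℂ) {n : ℤ} (hn : 0 < n) {k : ℤ} {x : Low 1} (hx : x ∈ lenFil k) :
    opΔ c n x ∈ lenFil (k - 1) := by
  have key : ∀ (j : ℕ) (x : Low 1), Word (lowMul 1) 1 (fun _ => 1) j x → ∀ n : ℤ, 0 < n →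
      opΔ c n x ∈ lenFil (j - 1) := by
    intro j x hx
    induction hx with
    | one =>
      intro n hn
      rw [opS_one, Pi.single_eq_of_ne hn.ne']
      exact zero_mem _
    | app i j x hx ih =>
      intro n hn
      rw [lowMul_apply, opS_gen_mul]
      refine add_mem ?_ (Submodule.smul_mem _ _ ?_)
      · exact wordFil_mono (by push_cast; lia) (app_mem_wordFil i (ih n hn))
      · rcases lt_trichotomy (n - i - (1 : ℕ)) 0 with h | h | h
        · rw [opΔ_neg c h]; exact zero_mem _
        · rw [h, opΔ_zero]; exact hx.mem_fil (by push_cast; lia)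
        · exact wordFil_mono (by push_cast; lia) (ih _ h)
  have : lenFil k ≤ (lenFil (k - 1)).comap (opΔ c n) :=
    wordFil_le fun j hj x hx => wordFil_mono (by lia) (key j x hx n hn)
  exact this hx

/-- The operators whose Euler operator is the length of words. -/
def lenLower (c : ℂ) (n : ℕ) : Low 1 →ₗ[ℂ] Low 1 := (2 * ((n : ℂ) + 1))⁻¹ • opΔ c (n + 1)

/-- An Euler operator on the vectors of level `k`. -/
def lenEuler (c : ℂ) (k : ℕ) : Low 1 →ₗ[ℂ] Low 1 :=
  ∑ n ∈ Finset.range k, (lowMul 1 n).comp (lenLower c n)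

/-- Modulo shorter words, the coefficient of `Δ` in `L_n` is `2 n` times the derivative with respect
to `L_{-n}`. Thus `lenEuler` counts letters to leading order and its kernel consists of multiples of
`1`, which do not have positive level. -/
theorem lenEuler_injOn (c : ℂ) {k : ℕ} (hk : 0 < k) {x : Low 1} (hx : x ∈ lev k)
    (h0 : lenEuler c k x = 0) : x = 0 := by
  obtain ⟨j, hj⟩ := exists_mem_wordFil (fun _ => 1) x
  have hspan : x ∈ Submodule.span ℂ {(1 : Low 1)} := by
    refine mem_span_of_lower_eq_zero (Y := lenLower c) (fun _ => Nat.one_pos) ?_ ?_ ?_ hj ?_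
    · intro n
      rw [lenLower, LinearMap.smul_apply, opS_one, Pi.single_eq_of_ne (by lia), smul_zero]
    · intro n p k x hx
      have h2 : (2 * ((n : ℂ) + 1)) ≠ 0 :=
        mul_ne_zero two_ne_zero (by exact_mod_cast Nat.succ_ne_zero n)
      simp only [lenLower, LinearMap.smul_apply, lowMul_apply, opS_gen_mul, smul_add,
        mul_smul_comm, add_sub_cancel_left, smul_smul]
      rcases lt_trichotomy n p with h | h | h
      · rw [if_neg h.ne, opΔ_neg c (by push_cast; lia)]
        simp
      · subst h
        have e : ((n : ℤ) + 1 - n - (1 : ℕ)) = 0 := by push_cast; ring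
        rw [e, opΔ_zero, if_pos rfl]
        have e2 : (2 * ((n : ℂ) + 1))⁻¹ * ((((n : ℤ) + 1 : ℤ) : ℂ) + n + (1 : ℕ)) = 1 := by
          push_cast
          field_simp
          ring
        rw [e2]
        simp
      · rw [if_neg h.ne', zero_smul, sub_zero]
        refine Submodule.smul_mem _ _ ?_
        exact wordFil_mono (by push_cast; lia) (opΔ_mem_lenFil c (by push_cast; lia) hx)
    · intro n p k x hx
      rw [lowMul_comm]
      refine Submodule.smul_mem _ _ ?_
      exact wordFil_mono (by push_cast; lia) (app_mem_wordFil _ hx)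
    · refine ⟨k, fun N hN => ?_⟩
      have e : ∑ n ∈ Finset.range N, lowMul 1 n (lenLower c n x) =
          ∑ n ∈ Finset.range k, lowMul 1 n (lenLower c n x) := by
        refine (Finset.sum_subset (Finset.range_mono hN) fun n _ hn => ?_).symm
        have hn' : k ≤ n := by simpa using hn
        have h1 := opΔ_mem_lev c ((n : ℤ) + 1) hx
        rw [lev, wordGr_neg (by lia), Submodule.mem_bot] at h1
        rw [lenLower, LinearMap.smul_apply, h1, smul_zero, map_zero]
      rw [e]
      simpa [lenEuler] using h0
  -- For `Δ = 0` the operator `L_0` kills `1` but acts by `k` on level `k`, so the multiple is zero.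
  obtain ⟨r, rfl⟩ := Submodule.mem_span_singleton.mp hspan
  have h1 := opT_zero_of_mem_lev c 0 hx
  rw [map_smul, opT_one, vermaBase_zero, zero_smul, smul_zero, zero_add] at h1
  exact (smul_eq_zero.mp h1.symm).resolve_left (by exact_mod_cast hk.ne')

/-- The operator `∑ L_{-n} L_n / (2 n)` on the vectors of level `k`. -/
def vermaEuler (c Δ : ℂ) (k : ℕ) : Low 1 →ₗ[ℂ] Low 1 :=
  ∑ n ∈ Finset.range k, (2 * ((n : ℂ) + 1))⁻¹ • (lowMul 1 n).comp (opT c 1 (vermaBase Δ) (n + 1))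

theorem vermaEuler_eq (c Δ : ℂ) (k : ℕ) (x : Low 1) :
    vermaEuler c Δ k x = vermaEuler c 0 k x + Δ • lenEuler c k x := by
  simp only [vermaEuler, lenEuler, lenLower, LinearMap.sum_apply, LinearMap.smul_apply,
    LinearMap.comp_apply, Finset.smul_sum, ← Finset.sum_add_distrib]
  refine Finset.sum_congr rfl fun n _ => ?_
  rw [opT_vermaBase c Δ, opT_vermaBase c 0]
  simp only [map_add, map_smul]
  module

/-- A singular vector is annihilated by `∑ L_{-n} L_n / (2 n)`, which is affine in `Δ` with
injective linear coefficient. The finitely many levels are handled with a common bound. -/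
theorem exists_no_singular (c : ℂ) (k : ℕ) : ∃ R : ℝ, ∀ Δ : ℂ, R < ‖Δ‖ → ∀ j : ℕ, 0 < j → j ≤ k →
    ∀ x ∈ lev j, (∀ n : ℤ, 0 < n → opT c 1 (vermaBase Δ) n x = 0) → x = 0 := by
  have h : ∀ j : ℕ, ∃ R : ℝ, ∀ Δ : ℂ, R < ‖Δ‖ → 0 < j →
      ∀ x ∈ lev j, (∀ n : ℤ, 0 < n → opT c 1 (vermaBase Δ) n x = 0) → x = 0 := by
    intro j
    by_cases hj : 0 < j
    · obtain ⟨R, hR⟩ := (perturbation (lev j) (vermaEuler c 0 j) (lenEuler c j)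
        (fun x hx h => lenEuler_injOn c hj hx h)).1
      refine ⟨R, fun Δ hΔ _ x hx h => hR Δ hΔ x hx ?_⟩
      rw [← vermaEuler_eq, vermaEuler, LinearMap.sum_apply]
      refine Finset.sum_eq_zero fun n _ => ?_
      rw [LinearMap.smul_apply, LinearMap.comp_apply, h _ (by lia), map_zero, smul_zero]
    · exact ⟨0, fun Δ _ h => absurd h hj⟩
  choose R hR using h
  obtain ⟨M, hM⟩ := ((Finset.range (k + 1)).image R).exists_le
  refine ⟨M, fun Δ hΔ j hj hjk => hR j Δ (lt_of_le_of_lt ?_ hΔ) hj⟩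
  exact hM _ (Finset.mem_image_of_mem R (Finset.mem_range.mpr (by lia)))

/-! ### The contravariant form -/

theorem isVirRep_vermaDual (c Δ : ℂ) :
    IsVirRep c (fun n => (opT c 1 (vermaBase Δ) (-n)).dualMap) := (isVirRep_verma c Δ).dual

/-- The contravariant form on the model of a Verma module. -/
def shap (c Δ : ℂ) : Low 1 →ₗ[ℂ] Module.Dual ℂ (Low 1) :=
  (LinearMap.applyₗ lowCounit.toLinearMap).comp
    (lowHom 1 (isVirRep_vermaDual c Δ)).toLinearMap

theorem shap_one (c Δ : ℂ) (y : Low 1) : shap c Δ 1 y = lowCounit y := by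
  simp [shap]

/-- The functional `lowCounit` is a highest weight vector of weight `Δ` in the dual representation,
so `x ↦ x · lowCounit` intertwines by `lowHom_opT`; contravariance is this intertwining property. -/
theorem shap_act (c Δ : ℂ) (n : ℤ) (x y : Low 1) :
    shap c Δ (opT c 1 (vermaBase Δ) n x) y = shap c Δ x (opT c 1 (vermaBase Δ) (-n) y) := by
  have hv := lowHom_vermaBase (isVirRep_vermaDual c Δ) (v := lowCounit.toLinearMap) (Δ := Δ)
    (by
      intro n hn
      refine LinearMap.ext fun y => ?_
      have := lowCounit_opT_nonpos c Δ (show -n ≤ 0 by lia) y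
      have hne : -n ≠ 0 := by lia
      rw [dualChar, if_neg hne, zero_mul] at this
      exact this)
    (by
      refine LinearMap.ext fun y => ?_
      have := lowCounit_opT_nonpos c Δ (le_refl 0) y
      rw [dualChar, if_pos rfl] at this
      rw [LinearMap.dualMap_apply, neg_zero]
      exact this)
  exact LinearMap.congr_fun (lowHom_opT c (isVirRep_vermaDual c Δ) hv n x) y

theorem shap_gen_mul (c Δ : ℂ) (i : ℕ) (x y : Low 1) : shap c Δ (Low.gen 1 i * x) y =
    shap c Δ x (opT c 1 (vermaBase Δ) (i + 1) y) := by
  rw [← opT_neg c (isBase_vermaBase Δ), shap_act]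
  congr 3

theorem shap_symm (c Δ : ℂ) (x y : Low 1) : shap c Δ x y = shap c Δ y x := by
  induction x using Low.induction generalizing y with
  | hone =>
    rw [shap_one]
    induction y using Low.induction with
    | hone => rw [shap_one]
    | hsmul r y hy => simp [hy]
    | hadd x y hx hy => simp [hx, hy]
    | hgen i y _ =>
      rw [lowCounit_gen_mul, shap_gen_mul, opT_one, vermaBase_pos Δ (by lia), map_zero]
  | hsmul r x hx => simp [hx]
  | hadd x y hx hy => simp [hx, hy]
  | hgen i x hx =>
    rw [shap_gen_mul, hx, shap_act, ← opT_neg c (isBase_vermaBase Δ)]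
    congr 2

theorem shap_lev_ne (c Δ : ℂ) {j k : ℤ} (h : j ≠ k) {x y : Low 1} (hx : x ∈ lev j)
    (hy : y ∈ lev k) : shap c Δ x y = 0 := by
  have h1 := shap_act c Δ 0 x y
  rw [neg_zero, opT_zero_of_mem_lev c Δ hx, opT_zero_of_mem_lev c Δ hy, map_smul, map_smul,
    LinearMap.smul_apply, smul_eq_mul, smul_eq_mul] at h1
  have h2 : ((j : ℂ) - k) * shap c Δ x y = 0 := by linear_combination h1
  exact (mul_eq_zero.mp h2).resolve_left (by exact_mod_cast sub_ne_zero.mpr h)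

/-- By contravariance `L_n x`, `n > 0`, is again in the radical and of lower level, hence zero by
induction. So `x` is singular. -/
theorem shap_nondegenerate {c Δ : ℂ} {k : ℕ} (hns : ∀ j : ℕ, 0 < j → j ≤ k → ∀ x ∈ lev j,
    (∀ n : ℤ, 0 < n → opT c 1 (vermaBase Δ) n x = 0) → x = 0) {j : ℤ} (hj : j ≤ k)
    {x : Low 1} (hx : x ∈ lev j) (h : ∀ y, shap c Δ x y = 0) : x = 0 := by
  rcases lt_or_ge j 0 with hj0 | hj0
  · rw [lev, wordGr_neg hj0] at hx
    exact hx
  obtain ⟨j, rfl⟩ := Int.eq_ofNat_of_zero_le hj0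
  induction j using Nat.strong_induction_on generalizing x with
  | _ j ih =>
    rcases Nat.eq_zero_or_pos j with rfl | hj1
    · have h0 : lev ((0 : ℕ) : ℤ) ≤ Submodule.span ℂ {(1 : Low 1)} := by
        refine wordGr_le fun i hi x hx => ?_
        cases hx with
        | one => exact Submodule.mem_span_singleton_self _
        | app i k x hx => lia
      obtain ⟨r, rfl⟩ := Submodule.mem_span_singleton.mp (h0 hx)
      have := h 1
      rw [map_smul, LinearMap.smul_apply, shap_one, map_one, smul_eq_mul, mul_one] at this
      rw [this, zero_smul]
    · refine hns j hj1 (by lia) x hx fun n hn => ?_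
      have h1 := opT_mem_lev c Δ n hx
      have h2 : ∀ y, shap c Δ (opT c 1 (vermaBase Δ) n x) y = 0 := fun y => by rw [shap_act, h]
      rcases lt_or_ge ((j : ℤ) - n) 0 with h3 | h3
      · rw [lev, wordGr_neg h3] at h1
        exact h1
      · obtain ⟨i, hi⟩ := Int.eq_ofNat_of_zero_le h3
        rw [hi] at h1
        exact ih i (by lia) h2 (by lia) h1 (by lia)

/-- On the finite-dimensional level `k` a nondegenerate form is an isomorphism onto the dual. The
other levels do not interfere, because distinct levels are orthogonal and `f` vanishes on them. -/
theorem exists_shap_eq {c Δ : ℂ} {k : ℕ} (hns : ∀ j : ℕ, 0 < j → j ≤ k → ∀ x ∈ lev j,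
    (∀ n : ℤ, 0 < n → opT c 1 (vermaBase Δ) n x = 0) → x = 0) {f : Module.Dual ℂ (Low 1)}
    (hf : ∀ j : ℤ, j ≠ k → ∀ y ∈ lev j, f y = 0) :
    ∃ x ∈ lev k, ∀ y, shap c Δ x y = f y := by
  let B : lev k →ₗ[ℂ] Module.Dual ℂ (lev k) :=
    ((lev k).subtype.dualMap).comp ((shap c Δ).comp (lev k).subtype)
  have hB : ∀ x y, B x y = shap c Δ x y := fun _ _ => rfl
  have hinj : Function.Injective B := by
    rw [injective_iff_map_eq_zero]
    intro x hx
    refine Subtype.ext (shap_nondegenerate hns le_rfl x.2 fun y => ?_)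
    have hy := mem_iSup_lev y
    induction hy using Submodule.iSup_induction' with
    | mem j y hy =>
      by_cases hjk : j = k
      · subst hjk
        rw [← hB x ⟨y, hy⟩, hx]
        rfl
      · exact shap_lev_ne c Δ (Ne.symm hjk) x.2 hy
    | zero => exact map_zero _
    | add y z _ _ hy hz => rw [map_add, hy, hz, add_zero]
  have hsurj : Function.Surjective B :=
    (LinearMap.injective_iff_surjective_of_finrank_eq_finrank
      (Subspace.dual_finrank_eq (K := ℂ) (V := lev k)).symm).mp hinj
  obtain ⟨x, hx⟩ := hsurj ((lev k).subtype.dualMap f)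
  refine ⟨x, x.2, fun y => ?_⟩
  have hy := mem_iSup_lev y
  induction hy using Submodule.iSup_induction' with
  | mem j y hy =>
    by_cases hjk : j = k
    · subst hjk
      rw [← hB x ⟨y, hy⟩, hx]
      rfl
    · rw [shap_lev_ne c Δ (Ne.symm hjk) x.2 hy, hf j hjk y hy]
  | zero => rw [map_zero, map_zero]
  | add y z _ _ hy hz => rw [map_add, map_add, hy, hz]

/-! ### Coefficients of regular blocks -/

/-- The operators by which the generators act on sequences of matrix elements. -/
def gamAct (δ κ : ℂ) (i : ℕ) : Module.End ℂ (ℤ → ℂ) where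
  toFun f k := (κ + k - (i + 1) + (i + 1) * δ) * f (k - (i + 1))
  map_add' f g := by
    ext k
    simp only [Pi.add_apply]
    ring
  map_smul' r f := by
    ext k
    simp only [Pi.smul_apply, smul_eq_mul, RingHom.id_apply]
    ring

theorem gamAct_comm (δ κ : ℂ) (i j : ℕ) : gamAct δ κ i * gamAct δ κ j - gamAct δ κ j * gamAct δ κ i
    = ((j : ℂ) - i) • gamAct δ κ (i + j + 1) := by
  refine LinearMap.ext fun f => funext fun k => ?_
  simp only [LinearMap.sub_apply, Module.End.mul_apply, LinearMap.smul_apply, gamAct,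
    LinearMap.coe_mk, AddHom.coe_mk, Pi.sub_apply, Pi.smul_apply, smul_eq_mul]
  have e1 : k - ((i : ℤ) + 1) - (j + 1) = k - (((i + j + 1 : ℕ) : ℤ) + 1) := by push_cast; lia
  have e2 : k - ((j : ℤ) + 1) - (i + 1) = k - (((i + j + 1 : ℕ) : ℤ) + 1) := by push_cast; lia
  rw [e1, e2]
  push_cast
  ring

/-- The matrix elements of a chiral vertex operator of weight `δ`, where `κ` is the difference of
the two other weights. -/
def gam (δ κ : ℂ) (k : ℤ) : Module.Dual ℂ (Low 1) :=
  (LinearMap.proj k).comp ((LinearMap.applyₗ (Pi.single 0 1 : ℤ → ℂ)).comp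
    (Low.lift 1 (gamAct δ κ) (gamAct_comm δ κ)).toLinearMap)

theorem gam_one (δ κ : ℂ) (k : ℤ) : gam δ κ k 1 = if k = 0 then 1 else 0 := by
  simp [gam, Pi.single_apply]

theorem gam_gen_mul (δ κ : ℂ) (k : ℤ) (i : ℕ) (x : Low 1) : gam δ κ k (Low.gen 1 i * x) =
    (κ + k - (i + 1) + (i + 1) * δ) * gam δ κ (k - (i + 1)) x := by
  simp [gam, gamAct]

theorem gam_lev_ne (δ κ : ℂ) {j k : ℤ} (h : j ≠ k) {x : Low 1} (hx : x ∈ lev j) :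
    gam δ κ k x = 0 := by
  have : lev j ≤ ⨅ k : {k // j ≠ k}, LinearMap.ker (gam δ κ k) := by
    refine lev_induction (K := fun j => ⨅ k : {k // j ≠ k}, LinearMap.ker (gam δ κ k)) ?_ ?_ j
    · rw [Submodule.mem_iInf]
      rintro ⟨k, hk⟩
      rw [LinearMap.mem_ker, gam_one, if_neg hk.symm]
    · intro i j x _ hx
      rw [Submodule.mem_iInf] at hx ⊢
      rintro ⟨k, hk⟩
      have := hx ⟨k - (i + 1), by lia⟩
      rw [LinearMap.mem_ker] at this ⊢
      rw [gam_gen_mul, this, mul_zero]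
  have h2 := this hx
  rw [Submodule.mem_iInf] at h2
  exact h2 ⟨k, h⟩

theorem gam_neg (δ κ : ℂ) {k : ℤ} (hk : k < 0) (x : Low 1) : gam δ κ k x = 0 := by
  induction x using Low.induction generalizing k with
  | hone => rw [gam_one, if_neg hk.ne]
  | hsmul r x hx => rw [map_smul, hx hk, smul_zero]
  | hadd x y hx hy => rw [map_add, hx hk, hy hk, add_zero]
  | hgen i x hx => rw [gam_gen_mul, hx (by lia), mul_zero]

theorem gam_opT_zero (c δ κ Δ : ℂ) (k : ℤ) (x : Low 1) :
    gam δ κ k (opT c 1 (vermaBase Δ) 0 x) = (Δ + k) * gam δ κ k x := by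
  have hx := mem_iSup_lev x
  induction hx using Submodule.iSup_induction' with
  | mem j y hy =>
    rw [opT_zero_of_mem_lev c Δ hy, map_smul, smul_eq_mul]
    by_cases h : j = k
    · rw [h]
    · rw [gam_lev_ne δ κ h hy, mul_zero, mul_zero]
  | zero => simp
  | add y z _ _ hy hz => rw [map_add, map_add, map_add, hy, hz, mul_add]

theorem pairing_eq_shap {c Δ : ℂ} {p : DualVerma c Δ →ₗ[ℂ] Module.Dual ℂ (Verma c Δ)}
    (hp : IsCanonicalPairing c dualSet (dualChar Δ) Δ p) (u : DualVerma c Δ) (x : Verma c Δ) :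
    p u x = shap c Δ (dualEquiv c Δ u) (vermaEquiv c Δ x) := by
  have h : IsCanonicalPairing c dualSet (dualChar Δ) Δ
      ((vermaEquiv c Δ).toLinearMap.dualMap.comp ((shap c Δ).comp
        (dualEquiv c Δ).toLinearMap)) := by
    refine ⟨fun n u x => ?_, ?_⟩
    · change shap c Δ (dualEquiv c Δ _) (vermaEquiv c Δ x) =
        shap c Δ (dualEquiv c Δ u) (vermaEquiv c Δ _)
      rw [dualEquiv_act, vermaEquiv_act, shap_act, neg_neg]
    · change shap c Δ (dualEquiv c Δ _) (vermaEquiv c Δ _) = 1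
      rw [dualEquiv_vac, vermaEquiv_ket, shap_one, map_one]
  rw [(existsUnique_dual_pairing c Δ).unique hp h]
  rfl

theorem pairing_vac {c Δ : ℂ} {p : DualVerma c Δ →ₗ[ℂ] Module.Dual ℂ (Verma c Δ)}
    (hp : IsCanonicalPairing c dualSet (dualChar Δ) Δ p) (x : Verma c Δ) :
    p (braVac c dualSet (dualChar Δ)) x = lowCounit (vermaEquiv c Δ x) := by
  rw [pairing_eq_shap hp, dualEquiv_vac, shap_one]

/-! ### Matrix elements of regular vertex operators -/

section VertexOperator

variable {c Δ₁ Δ₂ Δ₃ : ℂ} {p : DualVerma c Δ₃ →ₗ[ℂ] Module.Dual ℂ (Verma c Δ₃)}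
  {V : DualVerma c Δ₁ →ₗ[ℂ] (ℤ → Module.Dual ℂ (Verma c Δ₃))}

theorem IsRegularVertexOperator.act (hV : IsRegularVertexOperator c Δ₁ Δ₂ Δ₃ p V) (n k : ℤ)
    (u : DualVerma c Δ₁) (x : Verma c Δ₃) : V (braAct c dualSet (dualChar Δ₁) n u) k x =
      V u k (ketAct c Δ₃ n x) + (k - n + (Δ₁ - Δ₃) + n * Δ₂) * V u (k - n) x := by
  have h := (isVertexOperator_iff _ _ _ _ _ _).mp hV.1 n u
  have h2 := LinearMap.congr_fun (congrFun h k) x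
  rw [h2, vertexRep_apply]
  simp only [zero_smul, add_zero, LinearMap.add_apply, LinearMap.smul_apply, neg_neg, dualAct,
    LinearMap.dualMap_apply, smul_eq_mul]
  rw [← sub_eq_add_neg]
  push_cast
  ring

/-- Moving `L_n`, `n < 0`, from the ket through `V` to the bra, which it annihilates, leaves only
the differential part of the commutator. This is the recursion that defines `gam`. -/
theorem IsRegularVertexOperator.vac_eq (hp : IsCanonicalPairing c dualSet (dualChar Δ₃) Δ₃ p)
    (hV : IsRegularVertexOperator c Δ₁ Δ₂ Δ₃ p V) (k : ℤ) (x : Verma c Δ₃) :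
    V (braVac c dualSet (dualChar Δ₁)) (-k) x = gam Δ₂ (Δ₃ - Δ₁) k (vermaEquiv c Δ₃ x) := by
  obtain ⟨y, rfl⟩ := (vermaEquiv c Δ₃).symm.surjective x
  rw [LinearEquiv.apply_symm_apply]
  induction y using Low.induction generalizing k with
  | hone =>
    have hk : (vermaEquiv c Δ₃).symm 1 = ket c Δ₃ := by
      rw [LinearEquiv.symm_apply_eq, vermaEquiv_ket]
    rw [hk, gam_one]
    split_ifs with h
    · rw [h, neg_zero, hV.2.1, pairing_vac hp, vermaEquiv_ket, map_one]
    · have h0 := hV.act 0 (-k) (braVac c dualSet (dualChar Δ₁)) (ket c Δ₃)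
      rw [braAct_vac c _ (show (0 : ℤ) ∈ dualSet from le_refl (0 : ℤ)), ketAct_ket_zero, dualChar,
        if_pos rfl, sub_zero, map_smul, map_smul, Pi.smul_apply, LinearMap.smul_apply, smul_eq_mul,
        smul_eq_mul] at h0
      -- The `L_0` relation makes the matrix element between the two extremal vectors homogeneous,
      -- so only the power normalized by the canonical pairing survives.
      have h1 : (k : ℂ) * V (braVac c dualSet (dualChar Δ₁)) (-k) (ket c Δ₃) = 0 := by
        push_cast at h0
        linear_combination h0
      exact (mul_eq_zero.mp h1).resolve_left (by exact_mod_cast h)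
  | hsmul r x hx => simp [hx]
  | hadd x y hx hy => simp [hx, hy]
  | hgen i x hx =>
    have hi : (vermaEquiv c Δ₃).symm (Low.gen 1 i * x) =
        ketAct c Δ₃ (-((i : ℤ) + (1 : ℕ))) ((vermaEquiv c Δ₃).symm x) := by
      rw [LinearEquiv.symm_apply_eq, vermaEquiv_act, LinearEquiv.apply_symm_apply,
        opT_neg c (isBase_vermaBase Δ₃)]
    have h0 := hV.act (-((i : ℤ) + (1 : ℕ))) (-k) (braVac c dualSet (dualChar Δ₁))
      ((vermaEquiv c Δ₃).symm x)
    have hS : -((i : ℤ) + (1 : ℕ)) ∈ dualSet := by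
      change -((i : ℤ) + (1 : ℕ)) ≤ 0
      push_cast
      lia
    have e : -k - -((i : ℤ) + (1 : ℕ)) = -(k - (i + 1)) := by push_cast; lia
    rw [braAct_vac c _ hS, dualChar, if_neg (by push_cast; lia), zero_smul, map_zero, Pi.zero_apply,
      LinearMap.zero_apply, ← hi, e, hx] at h0
    rw [gam_gen_mul]
    push_cast at h0
    linear_combination -h0

/-- The mirror computation: now `L_n`, `n > 0`, acts on the bra, and its action on the highest
weight vector drops out. The difference of weights enters with the opposite sign. -/
theorem IsRegularVertexOperator.ket_eq (hp : IsCanonicalPairing c dualSet (dualChar Δ₃) Δ₃ p)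
    (hV : IsRegularVertexOperator c Δ₁ Δ₂ Δ₃ p V) (k : ℤ) (u : DualVerma c Δ₁) :
    V u k (ket c Δ₃) = gam Δ₂ (Δ₁ - Δ₃) k (dualEquiv c Δ₁ u) := by
  obtain ⟨y, rfl⟩ := (dualEquiv c Δ₁).symm.surjective u
  rw [LinearEquiv.apply_symm_apply]
  induction y using Low.induction generalizing k with
  | hone =>
    have hk : (dualEquiv c Δ₁).symm 1 = braVac c dualSet (dualChar Δ₁) := by
      rw [LinearEquiv.symm_apply_eq, dualEquiv_vac]
    have := hV.vac_eq hp (-k) (ket c Δ₃)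
    rw [neg_neg, vermaEquiv_ket, gam_one] at this
    rw [hk, this, gam_one]
    simp
  | hsmul r x hx => simp [hx]
  | hadd x y hx hy => simp [hx, hy]
  | hgen i x hx =>
    have hi : (dualEquiv c Δ₁).symm (Low.gen 1 i * x) =
        braAct c dualSet (dualChar Δ₁) ((i : ℤ) + (1 : ℕ)) ((dualEquiv c Δ₁).symm x) := by
      rw [LinearEquiv.symm_apply_eq, dualEquiv_act, LinearEquiv.apply_symm_apply,
        opT_neg c (isBase_vermaBase Δ₁)]
    rw [hi, hV.act, ketAct_ket_pos c _ (by push_cast; lia), map_zero, zero_add, hx, gam_gen_mul]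
    push_cast
    ring

theorem exists_regularVertexOperator (Δ₁ Δ₂ : ℂ)
    (hp : IsCanonicalPairing c dualSet (dualChar Δ₃) Δ₃ p) :
    ∃ V, IsRegularVertexOperator c Δ₁ Δ₂ Δ₃ p V := by
  have hρ : IsVirRep c (vertexRep (fun n => dualAct c Δ₃ (-n)) Δ₂ (Δ₁ - Δ₂ - Δ₃) 0) :=
    isVirRep_vertexRep (ketAct_isVirRep c Δ₃).dual _ _ _
  obtain ⟨V, hV1, hV2⟩ := exists_bra_hom hρ (S := dualSet) (χ := dualChar Δ₁)
    (v := fun k => (gam Δ₂ (Δ₃ - Δ₁) (-k)).comp (vermaEquiv c Δ₃).toLinearMap) (by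
      intro n hn
      refine funext fun k => LinearMap.ext fun x => ?_
      rw [vertexRep_apply]
      simp only [zero_smul, add_zero, LinearMap.add_apply, LinearMap.smul_apply, neg_neg, dualAct,
        LinearMap.dualMap_apply, smul_eq_mul, Pi.smul_apply, LinearMap.comp_apply,
        LinearEquiv.coe_coe, vermaEquiv_act]
      rcases (show n ≤ 0 from hn).eq_or_lt with rfl | hn
      · rw [gam_opT_zero, dualChar, if_pos rfl]
        push_cast
        rw [neg_zero, add_zero]
        ring_nf
      · obtain ⟨i, rfl⟩ : ∃ i : ℕ, n = -((i : ℤ) + (1 : ℕ)) := ⟨(-n - 1).toNat, by lia⟩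
        have e : -(k + -(-((i : ℤ) + (1 : ℕ)))) = -k - (i + 1) := by push_cast; lia
        rw [opT_neg c (isBase_vermaBase Δ₃), gam_gen_mul, dualChar, if_neg hn.ne, e]
        push_cast
        ring)
  refine ⟨V, (isVertexOperator_iff _ _ _ _ _ _).mpr hV2, ?_, fun k hk => ?_⟩
  · rw [hV1]
    refine LinearMap.ext fun x => ?_
    rw [pairing_vac hp]
    change gam _ _ (-0) _ = _
    rw [neg_zero]
    generalize vermaEquiv c Δ₃ x = y
    induction y using Low.induction with
    | hone => rw [gam_one, if_pos rfl, map_one]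
    | hsmul r x hx => simp [hx]
    | hadd x y hx hy => simp [hx, hy]
    | hgen i x hx => rw [gam_gen_mul, lowCounit_gen_mul, gam_neg _ _ (by lia), mul_zero]
  · rw [hV1]
    refine LinearMap.ext fun x => ?_
    exact gam_neg _ _ (by lia) _

end VertexOperator

theorem isRegularBlockCoeff_iff (c Δinf Δ₁ Δ Δt Δ₀ : ℂ) (k : ℕ) (z : ℂ) :
    IsRegularBlockCoeff c Δinf Δ₁ Δ Δt Δ₀ k z ↔ ∃ x : Low 1,
      opT c 1 (vermaBase Δ) 0 x = (Δ + k) • x ∧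
      (∀ y, shap c Δ x y = gam Δ₁ (Δ - Δinf) k y) ∧ z = gam Δt (Δ - Δ₀) k x := by
  constructor
  · rintro ⟨p, p₀, V₁, V₂, v, hp, hp₀, hV₁, hV₂, h0, h1, rfl⟩
    refine ⟨dualEquiv c Δ v, ?_, fun y => ?_, hV₂.ket_eq hp₀ k v⟩
    · have := congrArg (dualEquiv c Δ) h0
      rwa [dualEquiv_act, map_smul, neg_zero] at this
    · obtain ⟨x, rfl⟩ := (vermaEquiv c Δ).surjective y
      rw [← pairing_eq_shap hp, h1, hV₁.vac_eq hp]
  · rintro ⟨x, h0, h1, rfl⟩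
    obtain ⟨p, hp⟩ := (existsUnique_dual_pairing c Δ).exists
    obtain ⟨p₀, hp₀⟩ := (existsUnique_dual_pairing c Δ₀).exists
    obtain ⟨V₁, hV₁⟩ := exists_regularVertexOperator Δinf Δ₁ hp
    obtain ⟨V₂, hV₂⟩ := exists_regularVertexOperator Δ Δt hp₀
    refine ⟨p, p₀, V₁, V₂, (dualEquiv c Δ).symm x, hp, hp₀, hV₁, hV₂, ?_, ?_, ?_⟩
    · apply (dualEquiv c Δ).injective
      rw [dualEquiv_act, map_smul, LinearEquiv.apply_symm_apply, neg_zero, h0]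
    · refine LinearMap.ext fun y => ?_
      rw [pairing_eq_shap hp, LinearEquiv.apply_symm_apply, h1, hV₁.vac_eq hp]
    · rw [hV₂.ket_eq hp₀, LinearEquiv.apply_symm_apply]

/-- There is no singular vector of level between `1` and `k` in the Verma module. -/
def NoSingular (c Δ : ℂ) (k : ℕ) : Prop := ∀ j : ℕ, 0 < j → j ≤ k → ∀ x ∈ lev j,
  (∀ n : ℤ, 0 < n → opT c 1 (vermaBase Δ) n x = 0) → x = 0

/-- The coefficient is the contravariant pairing of two vectors, one for each vertex operator. By
symmetry it may be computed from `ω`, the vector of the right vertex operator, with the left one as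
functional. The weight `Δinf` then occurs only in the functional. -/
theorem isRegularBlockCoeff_iff_of_noSingular {c Δ : ℂ} {k : ℕ} (h : NoSingular c Δ k)
    (Δinf Δ₁ Δt Δ₀ : ℂ) {ω : Low 1}
    (hω : ∀ y, shap c Δ ω y = gam Δt (Δ - Δ₀) k y) (z : ℂ) :
    IsRegularBlockCoeff c Δinf Δ₁ Δ Δt Δ₀ k z ↔ z = gam Δ₁ (Δ - Δinf) k ω := by
  rw [isRegularBlockCoeff_iff]
  have key : ∀ x : Low 1, (∀ y, shap c Δ x y = gam Δ₁ (Δ - Δinf) k y) →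
      gam Δt (Δ - Δ₀) k x = gam Δ₁ (Δ - Δinf) k ω := fun x hx => by
    rw [← hω, shap_symm, hx]
  constructor
  · rintro ⟨x, _, h1, rfl⟩
    exact key x h1
  · rintro rfl
    obtain ⟨x, hx, h1⟩ := exists_shap_eq h (f := gam Δ₁ (Δ - Δinf) k)
      fun j hj y hy => gam_lev_ne _ _ hj hy
    exact ⟨x, opT_zero_of_mem_lev c Δ hx, h1, (key x h1).symm⟩

/-! ### The vectors that represent the matrix elements of a vertex operator -/

theorem gam_zero (δ κ : ℂ) (x : Low 1) : gam δ κ 0 x = lowCounit x := by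
  induction x using Low.induction with
  | hone => rw [gam_one, if_pos rfl, map_one]
  | hsmul r x hx => simp [hx]
  | hadd x y hx hy => simp [hx, hy]
  | hgen i x hx => rw [gam_gen_mul, lowCounit_gen_mul, gam_neg _ _ (by lia), mul_zero]

theorem eventually_noSingular (c : ℂ) (k : ℕ) {Δ : ℂ → ℂ}
    (hΔ : Tendsto (fun s => ‖Δ s‖) (Bornology.cobounded ℂ) atTop) :
    ∀ᶠ s in Bornology.cobounded ℂ, NoSingular c (Δ s) k := by
  obtain ⟨R, hR⟩ := exists_no_singular c k
  filter_upwards [hΔ.eventually_gt_atTop R] with s hs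
  exact hR _ hs

/-- The family `ω` represents the matrix elements `gam δ κ k`. -/
structure IsDescendantFamily (c δ : ℂ) (Δ κ : ℂ → ℂ) (ω : ℤ → ℂ → Low 1) : Prop where
  neg : ∀ k < 0, ∀ s, ω k s = 0
  zero : ∀ s, ω 0 s = 1
  mem_lev : ∀ k, ∀ᶠ s in Bornology.cobounded ℂ, ω k s ∈ lev k
  shap_eq : ∀ k, ∀ᶠ s in Bornology.cobounded ℂ, ∀ y, shap c (Δ s) (ω k s) y = gam δ (κ s) k y

theorem exists_descendantFamily (c δ : ℂ) {Δ : ℂ → ℂ} (κ : ℂ → ℂ)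
    (hΔ : Tendsto (fun s => ‖Δ s‖) (Bornology.cobounded ℂ) atTop) :
    ∃ ω, IsDescendantFamily c δ Δ κ ω := by
  have h : ∀ (k : ℕ) (s : ℂ), ∃ x, NoSingular c (Δ s) k →
      x ∈ lev k ∧ ∀ y, shap c (Δ s) x y = gam δ (κ s) k y := by
    intro k s
    by_cases hs : NoSingular c (Δ s) k
    · obtain ⟨x, hx⟩ := exists_shap_eq hs (f := gam δ (κ s) k) fun j hj y hy => gam_lev_ne _ _ hj hy
      exact ⟨x, fun _ => hx⟩
    · exact ⟨0, fun h => absurd h hs⟩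
  choose x hx using h
  refine ⟨fun k s => if k < 0 then 0 else if k = 0 then 1 else x k.toNat s, ?_, ?_, ?_, ?_⟩
  · intro k hk s
    simp [hk]
  · intro s
    simp
  · intro k
    filter_upwards [eventually_noSingular c k.toNat hΔ] with s hs
    split_ifs with h1 h2
    · exact zero_mem _
    · rw [h2]; exact one_mem_lev
    · have := (hx _ _ hs).1
      rwa [Int.toNat_of_nonneg (by lia)] at this
  · intro k
    filter_upwards [eventually_noSingular c k.toNat hΔ] with s hs y
    split_ifs with h1 h2
    · rw [gam_neg _ _ h1, map_zero, LinearMap.zero_apply]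
    · rw [h2, shap_one, gam_zero]
    · have := (hx _ _ hs).2 y
      rwa [Int.toNat_of_nonneg (by lia)] at this

/-! ### Recurrences and polynomial growth of the descendants -/

section Family

variable {c δ : ℂ} {Δ κ : ℂ → ℂ} {ω : ℤ → ℂ → Low 1}

/-- Both sides have the same level and the same contravariant pairing with every vector, and the
form is nondegenerate there for large `Λ`. -/
theorem IsDescendantFamily.opT_eq (hω : IsDescendantFamily c δ Δ κ ω)
    (hΔ : Tendsto (fun s => ‖Δ s‖) (Bornology.cobounded ℂ) atTop) (k : ℤ) (i : ℕ) :
    ∀ᶠ s in Bornology.cobounded ℂ, opT c 1 (vermaBase (Δ s)) (i + 1) (ω k s) =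
      (κ s + k - (i + 1) + (i + 1) * δ) • ω (k - (i + 1)) s := by
  filter_upwards [eventually_noSingular c k.toNat hΔ, hω.mem_lev k, hω.mem_lev (k - (i + 1)),
    hω.shap_eq k, hω.shap_eq (k - (i + 1))] with s hs h1 h2 h3 h4
  rw [← sub_eq_zero]
  refine shap_nondegenerate (k := k.toNat) hs (j := k - (i + 1)) (by lia) ?_ fun y => ?_
  · exact sub_mem (opT_mem_lev c _ _ h1) (Submodule.smul_mem _ _ h2)
  · have e : -((i : ℤ) + 1) = -((i : ℤ) + (1 : ℕ)) := by push_cast; rfl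
    rw [map_sub, map_smul, LinearMap.sub_apply, LinearMap.smul_apply, shap_act, h3, h4, e,
      opT_neg c (isBase_vermaBase _), gam_gen_mul, smul_eq_mul, sub_self]

/-- Applying `∑ L_{-n} L_n / (2 n)` to `ω_k` expresses the result through earlier descendants. The
operator is affine in `Δ`, so `perturbation` transfers their polynomial bounds to `ω_k`. -/
theorem IsDescendantFamily.small (hω : IsDescendantFamily c δ Δ κ ω)
    (hΔ : Tendsto (fun s => ‖Δ s‖) (Bornology.cobounded ℂ) atTop) {J : ℤ}
    (hκ : ∀ z : ℂ, (fun s => κ s + z) =O[Bornology.cobounded ℂ] (fun s : ℂ => s ^ (-J))) (k : ℕ) :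
    ∃ I, ω k ∈ Small (Low 1) I := by
  induction k using Nat.strong_induction_on with
  | _ k ih =>
    rcases Nat.eq_zero_or_pos k with rfl | hk
    · refine ⟨0, small_congr (small_const 1) (Eventually.of_forall fun s => hω.zero s)⟩
    have hterm : ∀ n ∈ Finset.range k, ∃ I, (fun s => (2 * ((n : ℂ) + 1))⁻¹ • lowMul 1 n
        ((κ s + (k - (n + 1) + (n + 1) * δ)) • ω (k - (n + 1)) s)) ∈ Small (Low 1) I := by
      intro n hn
      have hn := Finset.mem_range.mp hn
      obtain ⟨I, hI⟩ := ih (k - (n + 1)) (by lia)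
      have e : ((k - (n + 1) : ℕ) : ℤ) = k - (n + 1) := by lia
      rw [e] at hI
      exact ⟨J + I, Submodule.smul_mem _ _ (small_map _ (small_smul (hκ _) hI))⟩
    choose! I hI using hterm
    obtain ⟨M, hM⟩ := ((Finset.range k).image (fun n => -I n)).exists_le
    have hy : (fun s => ∑ n ∈ Finset.range k, (2 * ((n : ℂ) + 1))⁻¹ • lowMul 1 n
        ((κ s + (k - (n + 1) + (n + 1) * δ)) • ω (k - (n + 1)) s)) ∈ Small (Low 1) (-M) := by
      have : (fun s => ∑ n ∈ Finset.range k, (2 * ((n : ℂ) + 1))⁻¹ • lowMul 1 n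
          ((κ s + (k - (n + 1) + (n + 1) * δ)) • ω (k - (n + 1)) s)) =
          ∑ n ∈ Finset.range k, fun s => (2 * ((n : ℂ) + 1))⁻¹ • lowMul 1 n
          ((κ s + (k - (n + 1) + (n + 1) * δ)) • ω (k - (n + 1)) s) := by
        ext s
        rw [Finset.sum_apply]
      rw [this]
      refine sum_mem fun n hn => small_mono ?_ (hI n hn)
      have := hM _ (Finset.mem_image_of_mem _ hn)
      lia
    refine ⟨-M, (perturbation (lev k) (vermaEuler c 0 k) (lenEuler c k)
      (fun x hx h => lenEuler_injOn c hk hx h)).2 Δ (ω k) _ _ hΔ (hω.mem_lev k) ?_ hy⟩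
    filter_upwards [(Finset.range k).eventually_all.mpr fun n _ => hω.opT_eq hΔ k n] with s hs
    rw [← vermaEuler_eq, vermaEuler, LinearMap.sum_apply]
    refine Finset.sum_congr rfl fun n hn => ?_
    rw [LinearMap.smul_apply, LinearMap.comp_apply, hs n hn]
    have e : κ s + ((k : ℤ) : ℂ) - (n + 1) + (n + 1) * δ =
        κ s + (k - (n + 1) + (n + 1) * δ) := by push_cast; ring
    rw [e]

end Family

/-! ### The representation of the Virasoro algebra on series of vectors -/

/-- The representation of the Virasoro algebra on Laurent series in `t` which is built from a
representation `ρ` and an action by vector fields. -/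
def seriesRep {X : Type*} [AddCommGroup X] [Module ℂ X] (ρ : ℤ → X →ₗ[ℂ] X) (e δ Δ : ℂ) (n : ℤ) :
    (ℤ → X) →ₗ[ℂ] (ℤ → X) where
  toFun f k := ρ n (f (k + n)) - e ^ n • ρ 0 (f (k + n)) +
    (e ^ n * (Δ + k + n - n * δ)) • f (k + n)
  map_add' f g := by
    refine funext fun k => ?_
    simp only [Pi.add_apply, map_add, smul_add]
    abel
  map_smul' r f := by
    refine funext fun k => ?_
    simp only [Pi.smul_apply, map_smul, RingHom.id_apply]
    module

section SeriesRep

variable {X : Type*} [AddCommGroup X] [Module ℂ X] {c : ℂ} {ρ : ℤ → X →ₗ[ℂ] X}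

theorem seriesRep_apply (e δ Δ : ℂ) (n : ℤ) (f : ℤ → X) (k : ℤ) : seriesRep ρ e δ Δ n f k =
    ρ n (f (k + n)) - e ^ n • ρ 0 (f (k + n)) + (e ^ n * (Δ + k + n - n * δ)) • f (k + n) := rfl

/-- The bracket of `L_m - e ^ m L_0` and `L_n - e ^ n L_0` contains extra multiples of these same
elements, with coefficients `m e ^ n` and `n e ^ m`. The scalar terms depend on the degree `k`, and
their commutators with the shifts of degree compensate exactly this. -/
theorem isVirRep_seriesRep (hρ : IsVirRep c ρ) {e : ℂ} (he : e ≠ 0) (δ Δ : ℂ) :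
    IsVirRep c (seriesRep ρ e δ Δ) := by
  intro m n f
  refine funext fun k => ?_
  simp only [Pi.sub_apply, Pi.add_apply, Pi.smul_apply, seriesRep_apply, map_add, map_smul, map_sub]
  have e1 : k + m + n = k + (m + n) := by ring
  have e2 : k + n + m = k + (m + n) := by ring
  have e3 : cocyc c m n • f k = cocyc c m n • f (k + (m + n)) := by
    by_cases h : m + n = 0
    · rw [h, add_zero]
    · rw [cocyc_of_ne c h, zero_smul, zero_smul]
  rw [e1, e2, e3]
  generalize hx : f (k + (m + n)) = x
  have h1 := hρ m n x
  have h2 := hρ m 0 x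
  have h3 := hρ 0 n x
  rw [cocyc_zero_right, add_zero, zero_smul, add_zero] at h2
  rw [cocyc_zero_left, zero_add, zero_smul, add_zero] at h3
  rw [zpow_add₀ he]
  rw [sub_eq_iff_eq_add] at h1 h2 h3
  rw [h1, h2, h3]
  push_cast
  module

end SeriesRep

/-! ### Functions of at most polynomial growth -/

section Tame

variable {X Y : Type*} [AddCommGroup X] [Module ℂ X] [AddCommGroup Y] [Module ℂ Y]

/-- The functions of at most polynomial growth with values in a finite-dimensional subspace. -/
def Tame (X : Type*) [AddCommGroup X] [Module ℂ X] : Submodule ℂ (ℂ → X) where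
  carrier := {f | ∃ J : ℤ, f ∈ Small X J}
  add_mem' := by
    rintro f g ⟨I, hI⟩ ⟨J, hJ⟩
    exact ⟨min I J, add_mem (small_mono (min_le_left _ _) hI) (small_mono (min_le_right _ _) hJ)⟩
  zero_mem' := ⟨0, zero_mem _⟩
  smul_mem' := by
    rintro r f ⟨I, hI⟩
    exact ⟨I, Submodule.smul_mem _ r hI⟩

theorem tame_const (x : X) : (fun _ => x) ∈ Tame X := ⟨0, small_const x⟩

theorem tame_map (T : X →ₗ[ℂ] Y) {f : ℂ → X} (hf : f ∈ Tame X) : (fun s => T (f s)) ∈ Tame Y := by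
  obtain ⟨J, hJ⟩ := hf
  exact ⟨J, small_map T hJ⟩

theorem tame_smul {g : ℂ → ℂ} {f : ℂ → X} (hg : g ∈ Tame ℂ) (hf : f ∈ Tame X) :
    (fun s => g s • f s) ∈ Tame X := by
  obtain ⟨I, hI⟩ := hg
  obtain ⟨J, hJ⟩ := hf
  exact ⟨I + J, small_smul (small_isBigO hI) hJ⟩

theorem tame_congr {f g : ℂ → X} (hf : f ∈ Tame X)
    (h : ∀ᶠ s in Bornology.cobounded ℂ, g s = f s) : g ∈ Tame X := by
  obtain ⟨J, hJ⟩ := hf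
  exact ⟨J, small_congr hJ h⟩

theorem tame_zpow (n : ℤ) : (fun s : ℂ => s ^ n) ∈ Tame ℂ := by
  have := small_zpow_smul (-n) (small_const (1 : ℂ))
  simp only [neg_neg, smul_eq_mul, mul_one] at this
  exact ⟨_, this⟩

theorem tame_id : (fun s : ℂ => s) ∈ Tame ℂ := by simpa using tame_zpow 1

theorem tame_mul {g f : ℂ → ℂ} (hg : g ∈ Tame ℂ) (hf : f ∈ Tame ℂ) : (fun s => g s * f s) ∈ Tame ℂ :=
  tame_smul hg hf

theorem tame_pow {g : ℂ → ℂ} (hg : g ∈ Tame ℂ) (n : ℕ) : (fun s => g s ^ n) ∈ Tame ℂ := by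
  induction n with
  | zero => simpa using tame_const (1 : ℂ)
  | succ n ih => simpa only [pow_succ] using tame_mul ih hg

theorem tame_add {g f : ℂ → X} (hg : g ∈ Tame X) (hf : f ∈ Tame X) : (fun s => g s + f s) ∈ Tame X :=
  add_mem hg hf

theorem tame_sub {g f : ℂ → X} (hg : g ∈ Tame X) (hf : f ∈ Tame X) : (fun s => g s - f s) ∈ Tame X :=
  sub_mem hg hf

theorem tame_sum {ι : Type*} (t : Finset ι) {f : ι → ℂ → X} (hf : ∀ i ∈ t, f i ∈ Tame X) :
    (fun s => ∑ i ∈ t, f i s) ∈ Tame X := by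
  have : (fun s => ∑ i ∈ t, f i s) = ∑ i ∈ t, f i := by
    ext s
    rw [Finset.sum_apply]
  rw [this]
  exact sum_mem hf

theorem tame_prod {ι : Type*} (t : Finset ι) {f : ι → ℂ → ℂ} (hf : ∀ i ∈ t, f i ∈ Tame ℂ) :
    (fun s => ∏ i ∈ t, f i s) ∈ Tame ℂ := by
  classical
  induction t using Finset.induction_on with
  | empty => simpa using tame_const (1 : ℂ)
  | insert i t hi ih =>
    simp only [Finset.prod_insert hi]
    exact tame_mul (hf i (Finset.mem_insert_self _ _))
      (ih fun j hj => hf j (Finset.mem_insert_of_mem hj))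

theorem tame_dim (c : ℂ) {g : ℂ → ℂ} (hg : g ∈ Tame ℂ) : (fun s => dim c (g s)) ∈ Tame ℂ :=
  tame_add (tame_const _) (tame_pow hg 2)

theorem tame_gbinom {g : ℂ → ℂ} (hg : g ∈ Tame ℂ) (j : ℕ) : (fun s => gbinom (g s) j) ∈ Tame ℂ := by
  simp only [gbinom, div_eq_mul_inv]
  exact tame_mul (tame_prod _ fun i _ => tame_sub hg (tame_const _)) (tame_const _)

/-- A family of linear maps which is tame at every vector maps tame functions to tame
functions. -/
theorem tame_apply {F : ℂ → X →ₗ[ℂ] Y} (hF : ∀ x, (fun s => F s x) ∈ Tame Y) {f : ℂ → X}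
    (hf : f ∈ Tame X) : (fun s => F s (f s)) ∈ Tame Y := by
  obtain ⟨J, hJ⟩ := hf
  unfold Small at hJ
  induction hJ using Submodule.span_induction with
  | mem f hf =>
    obtain ⟨g, x, hg, h⟩ := hf
    have hg' : g ∈ Tame ℂ := ⟨J, by simpa using small_smul_const hg (1 : ℂ)⟩
    refine tame_congr (tame_smul hg' (hF x)) ?_
    filter_upwards [h] with s hs
    rw [hs, map_smul]
  | zero => simpa using tame_const (0 : Y)
  | add f g _ _ hf hg => simpa only [Pi.add_apply, map_add] using tame_add hf hg
  | smul r f _ hf => simpa only [Pi.smul_apply, map_smul] using tame_smul (tame_const r) hf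

end Tame

/-! ### The map from the Verma module to series of vectors -/

/-- The eigenvalues of `L_n - e ^ n L_0`, `n > 0`. -/
def confChar (e Δb Δ : ℂ) (n : ℤ) : ℂ := e ^ n * (n * Δb - Δ)

theorem isVirRep_conf (c : ℂ) {e : ℂ} (he : e ≠ 0) (Δb Δ : ℂ) :
    IsVirRep c (opT c 0 (whitBase e (confChar e Δb Δ))) := by
  refine isVirRep_whit c e _ fun m n _ _ => ?_
  simp only [confChar, zpow_add₀ he]
  push_cast
  ring

/-- `F` maps the Verma module to series of vectors. -/
structure IsSeriesHom (c e Δb Δ : ℂ) (F : Low 1 →ₗ[ℂ] (ℤ → Low 0)) : Prop where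
  one : F 1 = Pi.single 0 1
  act : ∀ n x, F (opT c 1 (vermaBase Δ) n x) =
    seriesRep (opT c 0 (whitBase e (confChar e Δb Δ))) e Δb Δ n (F x)

/-- The constant series `1` is a highest weight vector of weight `Δ`: in degree `-n` the eigenvalue
`e ^ n (n Δb - Δ)` of `L_n - e ^ n L_0` cancels the scalar term. So the Verma module maps to series.
-/
theorem exists_seriesHom (c : ℂ) {e : ℂ} (he : e ≠ 0) (Δb Δ : ℂ) :
    ∃ F, IsSeriesHom c e Δb Δ F := by
  have hρ := isVirRep_seriesRep (isVirRep_conf c he Δb Δ) he Δb Δ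
  have hv := lowHom_vermaBase hρ (v := (Pi.single 0 1 : ℤ → Low 0)) (Δ := Δ)
    (by
      intro n hn
      refine funext fun k => ?_
      rw [seriesRep_apply]
      by_cases hk : k + n = 0
      · have hk' : k = -n := by lia
        rw [hk, Pi.single_eq_same, opT_one, opT_one, whitBase_pos _ _ hn, whitBase_zero, confChar,
          hk']
        push_cast
        simp only [Pi.zero_apply]
        module
      · rw [Pi.single_eq_of_ne hk]
        simp)
    (by
      refine funext fun k => ?_
      rw [seriesRep_apply, Pi.smul_apply, add_zero]
      by_cases hk : k = 0
      · rw [hk]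
        simp
      · rw [Pi.single_eq_of_ne hk]
        simp)
  exact ⟨(LinearMap.applyₗ (Pi.single 0 1 : ℤ → Low 0)).comp (lowHom 1 hρ).toLinearMap,
    by simp, fun n x => lowHom_opT c hρ hv n x⟩

/-- The character of `Low 0` that maps `L_0` to `Δ` and the other generators to `0`. -/
def zeroChar (Δ : ℂ) : Low 0 →ₐ[ℂ] ℂ := lowChar 0 (fun i => if i = 0 then Δ else 0) (by
  intro i j
  by_cases h : i = 0
  · by_cases h' : j = 0
    · simp [h, h']
    · simp [h, h']
  · simp [h])

theorem zeroChar_gen_mul (Δ : ℂ) (i : ℕ) (x : Low 0) :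
    zeroChar Δ (Low.gen 0 i * x) = (if i = 0 then Δ else 0) * zeroChar Δ x := lowChar_gen_mul _ i x

section SeriesHom

variable {c e Δb Δ : ℂ} {F : Low 1 →ₗ[ℂ] (ℤ → Low 0)}

theorem IsSeriesHom.gen_mul (hF : IsSeriesHom c e Δb Δ F) (i : ℕ) (x : Low 1) (k : ℤ) :
    F (Low.gen 1 i * x) k = Low.gen 0 (i + 1) * F x (k - (i + 1)) -
      e ^ (-((i : ℤ) + 1)) • (Low.gen 0 0 * F x (k - (i + 1))) +
      (e ^ (-((i : ℤ) + 1)) * (Δ + k - (i + 1) + (i + 1) * Δb)) • F x (k - (i + 1)) := by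
  have e1 : -((i : ℤ) + (1 : ℕ)) = -(((i + 1 : ℕ) : ℤ) + (0 : ℕ)) := by push_cast; ring
  have e2 : (0 : ℤ) = -(((0 : ℕ) : ℤ) + (0 : ℕ)) := by simp
  have e3 : k + -(((i + 1 : ℕ) : ℤ) + (0 : ℕ)) = k - (i + 1) := by push_cast; ring
  rw [← opT_neg c (isBase_vermaBase Δ), hF.act, seriesRep_apply, e1,
    opT_neg c (isBase_whitBase _ _), e2, opT_neg c (isBase_whitBase _ _), e3]
  have e4 : -(((i + 1 : ℕ) : ℤ) + (0 : ℕ)) = -((i : ℤ) + 1) := by push_cast; ring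
  rw [e4]
  congr 3
  push_cast
  ring

/-- `F` is a universal form of the left vertex operator in which the weight at infinity is the
operator `L_0`. Specializing `L_0` to the number `Δi` recovers the matrix elements, and with `e = 1
/ Λ` the factor is the power `Λ ^ k` of the rescaled block. -/
theorem IsSeriesHom.zeroChar_eq (hF : IsSeriesHom c e Δb Δ F) (he : e ≠ 0) (Δi : ℂ) (k : ℤ)
    (x : Low 1) : zeroChar Δi (F x k) = e ^ (-k) * gam Δb (Δ - Δi) k x := by
  induction x using Low.induction generalizing k with
  | hone =>
    rw [hF.one, gam_one]
    by_cases hk : k = 0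
    · rw [hk]
      simp
    · rw [Pi.single_eq_of_ne hk, if_neg hk, map_zero, mul_zero]
  | hsmul r x hx =>
    simp only [map_smul, Pi.smul_apply, hx, smul_eq_mul]
    ring
  | hadd x y hx hy =>
    simp only [map_add, Pi.add_apply, hx, hy]
    ring
  | hgen i x hx =>
    rw [hF.gen_mul, map_add, map_sub, map_smul, map_smul, zeroChar_gen_mul, zeroChar_gen_mul,
      if_neg (Nat.succ_ne_zero i), if_pos rfl, hx, gam_gen_mul, smul_eq_mul, smul_eq_mul]
    have : e ^ (-k) = e ^ (-((i : ℤ) + 1)) * e ^ (-(k - (i + 1))) := by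
      rw [← zpow_add₀ he]
      congr 1
      ring
    rw [this]
    ring

/-- The intertwining relation is read off in degree `k - m`, so that the left side involves `F x k`.
The term `e ^ m * k` is the degree-dependent part of the scalar term in `seriesRep`. -/
theorem IsSeriesHom.lower_eq (hF : IsSeriesHom c e Δb Δ F) {x y : Low 1} {r : ℂ} {m : ℤ}
    (h : opT c 1 (vermaBase Δ) m x = r • y) (k : ℤ) :
    opT c 0 (whitBase e (confChar e Δb Δ)) m (F x k) -
      e ^ m • opT c 0 (whitBase e (confChar e Δb Δ)) 0 (F x k) - confChar e Δb Δ m • F x k =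
      r • F y (k - m) - (e ^ m * k) • F x k := by
  have h1 := congrFun (congrArg F h) (k - m)
  rw [hF.act, seriesRep_apply, sub_add_cancel, map_smul, Pi.smul_apply] at h1
  rw [← h1, confChar]
  push_cast
  module

theorem tame_seriesHom {Δb Δ : ℂ → ℂ} (hΔb : Δb ∈ Tame ℂ) (hΔ : Δ ∈ Tame ℂ)
    {F : ℂ → Low 1 →ₗ[ℂ] (ℤ → Low 0)}
    (hF : ∀ s ≠ 0, IsSeriesHom c s⁻¹ (Δb s) (Δ s) (F s)) (k : ℤ) (x : Low 1) :
    (fun s => F s x k) ∈ Tame (Low 0) := by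
  induction x using Low.induction generalizing k with
  | hone =>
    refine tame_congr (tame_const ((Pi.single 0 1 : ℤ → Low 0) k)) ?_
    filter_upwards [Bornology.eventually_ne_cobounded (0 : ℂ)] with s hs
    rw [(hF s hs).one]
  | hsmul r x hx =>
    simp only [map_smul, Pi.smul_apply]
    exact Submodule.smul_mem _ r (hx k)
  | hadd x y hx hy =>
    simp only [map_add, Pi.add_apply]
    exact tame_add (hx k) (hy k)
  | hgen i x hx =>
    have h1 := hx (k - (i + 1))
    have h2 : (fun s : ℂ => s⁻¹ ^ (-((i : ℤ) + 1))) ∈ Tame ℂ := by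
      simpa using tame_zpow (i + 1)
    have h3 : (fun s => Low.gen 0 (i + 1) * F s x (k - (i + 1)) -
        s⁻¹ ^ (-((i : ℤ) + 1)) • (Low.gen 0 0 * F s x (k - (i + 1))) +
        (s⁻¹ ^ (-((i : ℤ) + 1)) * (Δ s + k - (i + 1) + (i + 1) * Δb s)) • F s x (k - (i + 1)))
        ∈ Tame (Low 0) :=
      tame_add (tame_sub (tame_map (lowMul 0 (i + 1)) h1)
        (tame_smul h2 (tame_map (lowMul 0 0) h1)))
        (tame_smul (tame_mul h2 (tame_add (tame_sub (tame_add hΔ (tame_const _)) (tame_const _))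
          (tame_mul (tame_const _) hΔb))) h1)
    refine tame_congr h3 ?_
    filter_upwards [Bornology.eventually_ne_cobounded (0 : ℂ)] with s hs
    exact (hF s hs).gen_mul i x k

end SeriesHom

/-! ### Multiplication by a power of `1 - Λ / t` -/

theorem gbinom_succ (A : ℂ) (j : ℕ) : ((j : ℂ) + 1) * gbinom A (j + 1) = (A - j) * gbinom A j := by
  have h1 : (j.factorial : ℂ) ≠ 0 := by exact_mod_cast j.factorial_ne_zero
  have h2 : (j : ℂ) + 1 ≠ 0 := by exact_mod_cast j.succ_ne_zero
  rw [gbinom, gbinom, Finset.prod_range_succ, Nat.factorial_succ]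
  push_cast
  field_simp

section Binomial

variable {X : Type*} [AddCommGroup X] [Module ℂ X]

/-- The product of the binomial series of `(1 - s x) ^ A` and a series. -/
def binomMul (A s : ℂ) (u : ℤ → X) (k : ℤ) : X :=
  ∑ i ∈ Finset.range (k.toNat + 1), (gbinom A i * (-s) ^ i) • u (k - i)

theorem binomMul_eq (A s : ℂ) {u : ℤ → X} (hu : ∀ k < 0, u k = 0) {k : ℤ} {N : ℕ}
    (hN : k < N) : binomMul A s u k =
      ∑ i ∈ Finset.range N, (gbinom A i * (-s) ^ i) • u (k - i) := by
  rcases lt_or_ge k 0 with hk | hk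
  · rw [binomMul, Finset.sum_eq_zero, Finset.sum_eq_zero]
    · intro i _
      rw [hu _ (by lia), smul_zero]
    · intro i _
      rw [hu _ (by lia), smul_zero]
  · refine Finset.sum_subset (Finset.range_mono (by lia)) fun i _ hi => ?_
    rw [Finset.mem_range] at hi
    rw [hu _ (by lia), smul_zero]

theorem binomMul_neg (A s : ℂ) {u : ℤ → X} (hu : ∀ k < 0, u k = 0) {k : ℤ} (hk : k < 0) :
    binomMul A s u k = 0 := by
  rw [binomMul_eq A s hu (N := 0) (by exact_mod_cast hk), Finset.sum_range_zero]

theorem binomMul_zero (A s : ℂ) (u : ℤ → X) : binomMul A s u 0 = u 0 := by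
  simp [binomMul, gbinom]

/-- The coefficient form of the differential equation `(1 - s x) g' = -s A g` for `g = (1 - s x) ^
A`. -/
theorem sum_gbinom_shift (A : ℂ) {s : ℂ} (hs : s ≠ 0) (y : ℕ → X) (N : ℕ) :
    s⁻¹ • ∑ i ∈ Finset.range (N + 1), ((i : ℂ) * (gbinom A i * (-s) ^ i)) • y i =
      ∑ i ∈ Finset.range N, (((i : ℂ) - A) * (gbinom A i * (-s) ^ i)) • y (i + 1) := by
  rw [Finset.sum_range_succ', Nat.cast_zero, zero_mul, zero_smul, add_zero, Finset.smul_sum]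
  refine Finset.sum_congr rfl fun i _ => ?_
  rw [smul_smul]
  congr 1
  have h := gbinom_succ A i
  rw [pow_succ]
  push_cast
  field_simp
  linear_combination (-s) ^ i * -h

/-- On generating series `D` is `x (r + 1) - s⁻¹ (1 - s x) x ∂`. Conjugation by `(1 - s x) ^ A` adds
`-A x`: the factor `1 - s x` cancels the pole of the logarithmic derivative, so `r` is replaced by
`r - A`. -/
theorem binomMul_lower_one {A s r : ℂ} (hs : s ≠ 0) {u : ℤ → X} (hu : ∀ k < 0, u k = 0)
    {D : X →ₗ[ℂ] X} {k : ℤ} (hD : ∀ j ≤ k, D (u j) = (r + j) • u (j - 1) - (s⁻¹ * j) • u j) :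
    D (binomMul A s u k) = (r + k - A) • binomMul A s u (k - 1) -
      (s⁻¹ * k) • binomMul A s u k := by
  have hN : k < ((k.toNat + 1 : ℕ) : ℤ) := by lia
  have h1 := sum_gbinom_shift A hs (fun i => u (k - i)) (k.toNat + 1)
  rw [binomMul_eq A s hu (k := k - 1) (N := k.toNat + 1) (by lia),
    binomMul_eq A s hu (k := k) (N := k.toNat + 1 + 1) (by lia), map_sum, Finset.smul_sum,
    Finset.smul_sum]
  rw [Finset.smul_sum] at h1
  have h2 : ∀ i : ℕ, (gbinom A i * (-s) ^ i) • D (u (k - i)) =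
      ((gbinom A i * (-s) ^ i) * (r + k - i)) • u (k - 1 - i) -
      (s⁻¹ * k) • (gbinom A i * (-s) ^ i) • u (k - i) +
      s⁻¹ • ((i : ℂ) * (gbinom A i * (-s) ^ i)) • u (k - i) := by
    intro i
    have e : k - i - 1 = k - 1 - i := by ring
    rw [hD _ (by lia), e]
    push_cast
    module
  simp only [map_smul, h2, Finset.sum_add_distrib, Finset.sum_sub_distrib, h1]
  have h3 : ∑ i ∈ Finset.range (k.toNat + 1 + 1), ((gbinom A i * (-s) ^ i) * (r + k - i)) •
      u (k - 1 - i) = ∑ i ∈ Finset.range (k.toNat + 1), ((gbinom A i * (-s) ^ i) * (r + k - i)) •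
      u (k - 1 - i) := by
    rw [Finset.sum_range_succ, hu _ (by lia), smul_zero, add_zero]
  rw [h3, sub_add_eq_add_sub, ← Finset.sum_add_distrib]
  congr 1
  refine Finset.sum_congr rfl fun i _ => ?_
  have e : k - ((i + 1 : ℕ) : ℤ) = k - 1 - i := by push_cast; ring
  rw [e]
  module

/-- The derivative now has the coefficient `-s⁻² (1 - s² x²) x`, so conjugation adds `-A x² - s⁻¹ A
x`. As `A` grows linearly in `s`, the second term has a finite limit; it becomes the exponential
rate of the irregular block. -/
theorem binomMul_lower_two {A s r : ℂ} (hs : s ≠ 0) {u : ℤ → X} (hu : ∀ k < 0, u k = 0)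
    {D : X →ₗ[ℂ] X} {k : ℤ} (hD : ∀ j ≤ k, D (u j) = (r + j) • u (j - 2) - (s⁻¹ ^ 2 * j) • u j) :
    D (binomMul A s u k) = (r + k - A) • binomMul A s u (k - 2) -
      (s⁻¹ * A) • binomMul A s u (k - 1) - (s⁻¹ ^ 2 * k) • binomMul A s u k := by
  have h1 := sum_gbinom_shift A hs (fun i => u (k - i)) (k.toNat + 1 + 1)
  have h1' := sum_gbinom_shift A hs (fun i => u (k - 1 - i)) (k.toNat + 1)
  rw [binomMul_eq A s hu (k := k - 2) (N := k.toNat + 1) (by lia),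
    binomMul_eq A s hu (k := k - 1) (N := k.toNat + 1 + 1) (by lia),
    binomMul_eq A s hu (k := k) (N := k.toNat + 1 + 1 + 1) (by lia), map_sum, Finset.smul_sum,
    Finset.smul_sum, Finset.smul_sum]
  rw [Finset.smul_sum] at h1 h1'
  have h2 : ∀ i : ℕ, (gbinom A i * (-s) ^ i) • D (u (k - i)) =
      ((gbinom A i * (-s) ^ i) * (r + k - i)) • u (k - 2 - i) -
      (s⁻¹ ^ 2 * k) • (gbinom A i * (-s) ^ i) • u (k - i) +
      s⁻¹ • s⁻¹ • ((i : ℂ) * (gbinom A i * (-s) ^ i)) • u (k - i) := by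
    intro i
    have e : k - i - 2 = k - 2 - i := by ring
    rw [hD _ (by lia), e]
    push_cast
    module
  have h4 : ∀ i : ℕ, s⁻¹ • (((i : ℂ) - A) * (gbinom A i * (-s) ^ i)) • u (k - ((i + 1 : ℕ) : ℤ)) =
      s⁻¹ • ((i : ℂ) * (gbinom A i * (-s) ^ i)) • u (k - 1 - i) -
      (s⁻¹ * A) • (gbinom A i * (-s) ^ i) • u (k - 1 - i) := by
    intro i
    have e : k - ((i + 1 : ℕ) : ℤ) = k - 1 - i := by push_cast; ring
    rw [e]
    module
  simp only [map_smul, h2, Finset.sum_add_distrib, Finset.sum_sub_distrib]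
  rw [← Finset.smul_sum (r := s⁻¹) (f := fun i : ℕ => s⁻¹ • ((i : ℂ) * (gbinom A i * (-s) ^ i)) •
    u (k - i)), h1, Finset.smul_sum]
  simp only [h4, Finset.sum_sub_distrib, h1']
  have h3 : ∑ i ∈ Finset.range (k.toNat + 1 + 1 + 1), ((gbinom A i * (-s) ^ i) * (r + k - i)) •
      u (k - 2 - i) = ∑ i ∈ Finset.range (k.toNat + 1), ((gbinom A i * (-s) ^ i) * (r + k - i)) •
      u (k - 2 - i) := by
    rw [Finset.sum_range_succ, hu _ (by lia), smul_zero, add_zero, Finset.sum_range_succ,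
      hu _ (by lia), smul_zero, add_zero]
  have h5 : ∀ i : ℕ, ((gbinom A i * (-s) ^ i) * (r + k - i)) • u (k - 2 - i) =
      (r + k - A) • (gbinom A i * (-s) ^ i) • u (k - 2 - i) -
      (((i : ℂ) - A) * (gbinom A i * (-s) ^ i)) • u (k - 1 - ((i + 1 : ℕ) : ℤ)) := by
    intro i
    have e : k - 1 - ((i + 1 : ℕ) : ℤ) = k - 2 - i := by push_cast; ring
    rw [e]
    module
  rw [h3]
  simp only [h5, Finset.sum_sub_distrib]
  abel

end Binomial

/-! ### The dependence of the lowering operators on `1 / Λ` -/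

/-- Moving an operator past generators of `Low o` never raises its index. Hence for `L_1` and `L_2`
only the prescribed vectors with index at most `2` matter, and these are polynomial in `1 / Λ`. -/
theorem opT_congr (c : ℂ) {o : ℕ} {z z' : ℤ → Low o} {m : ℤ} (h : ∀ n ≤ m, z n = z' n) :
    opT c o z m = opT c o z' m := by
  refine LinearMap.ext fun x => ?_
  have : ∀ n ≤ m, opT c o z n x = opT c o z' n x := by
    induction x using Low.induction with
    | hone => intro n hn; rw [opT_one, opT_one, h n hn]
    | hsmul r x hx => intro n hn; rw [map_smul, map_smul, hx n hn]
    | hadd x y hx hy => intro n hn; rw [map_add, map_add, hx n hn, hy n hn]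
    | hgen i x hx => intro n hn; rw [opT_gen_mul, opT_gen_mul, hx n hn, hx _ (by lia)]
  exact this m le_rfl

/-- The eigenvalue of `L_1` on the Whittaker vector of the target. -/
abbrev targetChar (θs ν : ℂ) : ℂ := θs / 2 - ν

/-- The operators `L_n` on the model of the target of the irregular vertex operator. -/
abbrev targetT (c θs ν : ℂ) (n : ℤ) : Low 0 →ₗ[ℂ] Low 0 :=
  opT c 0 (whitBase₀ (targetChar θs ν) (1 / 4)) n

/-- The corrections of order `1 / Λ` to the vectors `L_1 1` and `L_2 1`. -/
def corrBase (θs ν : ℂ) : ℤ → Low 0 :=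
  (Pi.single 1 (Low.gen 0 0 + (θs ^ 2 / 4 - ν ^ 2) • 1) : ℤ → Low 0) +
    (Pi.single 2 ((θs - ν) • 1) : ℤ → Low 0)

/-- The corrections of order `1 / Λ ^ 2` to the vectors `L_1 1` and `L_2 1`. -/
def corrBase₂ (c θs ν : ℂ) : ℤ → Low 0 :=
  Pi.single 2 (Low.gen 0 0 + ((c - 1) / 24 + θs ^ 2 / 2 - ν ^ 2) • 1)

theorem whitBase_conf (c θs ν : ℂ) {s : ℂ} (hs : s ≠ 0) {n : ℤ} (hn : n ≤ 2) :
    whitBase s⁻¹ (confChar s⁻¹ (dim c ((s + θs) / 2)) (dim c (s / 2 + ν))) n =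
      (whitBase₀ (targetChar θs ν) (1 / 4) + s⁻¹ • corrBase θs ν +
        s⁻¹ ^ 2 • corrBase₂ c θs ν) n := by
  have h2 : ∀ x : ℤ → Low 0, (s⁻¹ • x) n = s⁻¹ • x n := fun _ => rfl
  simp only [Pi.add_apply, Pi.smul_apply, corrBase, corrBase₂]
  rcases le_or_gt n 0 with h | h
  · rw [whitBase, if_pos h, whitBase₀, whitBase, if_pos h, Pi.single_eq_of_ne (by lia),
      Pi.single_eq_of_ne (by lia), Pi.single_eq_of_ne (by lia)]
    simp
  · obtain rfl | rfl : n = 1 ∨ n = 2 := by lia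
    · rw [whitBase_pos _ _ h, whitBase₀_pos _ _ h, Pi.single_eq_same,
        Pi.single_eq_of_ne (by norm_num), Pi.single_eq_of_ne (by norm_num), whitChar,
        if_pos rfl, confChar]
      match_scalars
      · simp
      · simp only [dim, zpow_one]
        field_simp
        ring
    · rw [whitBase_pos _ _ h, whitBase₀_pos _ _ h, Pi.single_eq_same,
        Pi.single_eq_of_ne (by norm_num), whitChar,
        if_neg (by norm_num), if_pos rfl, confChar]
      have e : s⁻¹ ^ (2 : ℤ) = s⁻¹ ^ 2 := by norm_cast
      rw [e, Pi.single_eq_same]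
      match_scalars
      · simp
      · simp only [dim]
        field_simp
        ring

/-- The operator `L_m - χ_m` on the model of the target, which vanishes on the Whittaker vector. -/
def lowerA (c θs ν : ℂ) (m : ℤ) : Low 0 →ₗ[ℂ] Low 0 :=
  targetT c θs ν m - whitChar (targetChar θs ν) (1 / 4) (-m) • LinearMap.id

/-- The correction of order `1 / Λ` to `lowerA 1`. -/
def lowerB₁ (c θs ν : ℂ) : Low 0 →ₗ[ℂ] Low 0 :=
  opS c 0 (corrBase θs ν) 1 - lowMul 0 0 - (θs ^ 2 / 4 - ν ^ 2) • LinearMap.id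

/-- The correction of order `1 / Λ` to `lowerA 2`. -/
def lowerB₂ (c θs ν : ℂ) : Low 0 →ₗ[ℂ] Low 0 :=
  opS c 0 (corrBase θs ν) 2 - (θs - ν) • LinearMap.id

/-- The correction of order `1 / Λ ^ 2` to `lowerA 2`. -/
def lowerC (c θs ν : ℂ) : Low 0 →ₗ[ℂ] Low 0 :=
  opS c 0 (corrBase₂ c θs ν) 2 - lowMul 0 0 - ((c - 1) / 24 + θs ^ 2 / 2 - ν ^ 2) • LinearMap.id

theorem lowerA_apply (c θs ν : ℂ) (m : ℤ) (x : Low 0) : lowerA c θs ν m x =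
    targetT c θs ν m x - whitChar (targetChar θs ν) (1 / 4) (-m) • x := rfl

theorem lowerA_vac (c θs ν : ℂ) {m : ℤ} (hm : 0 < m) : lowerA c θs ν m 1 = 0 := by
  rw [lowerA_apply, targetT, opT_one, whitBase₀_pos _ _ hm, sub_self]

theorem lowerB₁_vac (c θs ν : ℂ) : lowerB₁ c θs ν 1 = 0 := by
  simp [lowerB₁, corrBase]

theorem lowerB₂_vac (c θs ν : ℂ) : lowerB₂ c θs ν 1 = 0 := by
  simp [lowerB₂, corrBase]

theorem lowerC_vac (c θs ν : ℂ) : lowerC c θs ν 1 = 0 := by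
  simp [lowerC, corrBase₂]

theorem opT_whit_zero (c e : ℂ) (χ : ℤ → ℂ) (x : Low 0) :
    opT c 0 (whitBase e χ) 0 x = Low.gen 0 0 * x := opT_neg c (isBase_whitBase e χ) 0 x

theorem opS_corrBase₂_one (c θs ν : ℂ) (x : Low 0) : opS c 0 (corrBase₂ c θs ν) 1 x = 0 := by
  have h := opT_congr c (m := 1) (z := (0 : ℤ → Low 0) + corrBase₂ c θs ν) (z' := 0) (by
    intro n hn
    rw [Pi.add_apply, corrBase₂, Pi.single_eq_of_ne (by lia), add_zero])
  rw [opT_add] at h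
  simpa using LinearMap.congr_fun h x

theorem opT_conf (c θs ν : ℂ) {s : ℂ} (hs : s ≠ 0) {m : ℤ} (hm : m ≤ 2) (x : Low 0) :
    opT c 0 (whitBase s⁻¹ (confChar s⁻¹ (dim c ((s + θs) / 2)) (dim c (s / 2 + ν)))) m x =
      targetT c θs ν m x + s⁻¹ • opS c 0 (corrBase θs ν) m x +
        s⁻¹ ^ 2 • opS c 0 (corrBase₂ c θs ν) m x := by
  rw [opT_congr c fun n hn => whitBase_conf c θs ν hs (hn.trans hm), opT_add, opT_add, opS_smul,
    opS_smul]
  rfl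

theorem conf_lower_one (c θs ν : ℂ) {s : ℂ} (hs : s ≠ 0) (x : Low 0) :
    opT c 0 (whitBase s⁻¹ (confChar s⁻¹ (dim c ((s + θs) / 2)) (dim c (s / 2 + ν)))) 1 x -
      s⁻¹ ^ (1 : ℤ) • opT c 0 (whitBase s⁻¹ (confChar s⁻¹ (dim c ((s + θs) / 2))
        (dim c (s / 2 + ν)))) 0 x -
      confChar s⁻¹ (dim c ((s + θs) / 2)) (dim c (s / 2 + ν)) 1 • x =
    lowerA c θs ν 1 x + s⁻¹ • lowerB₁ c θs ν x := by
  rw [opT_conf c θs ν hs (by norm_num), opS_corrBase₂_one, opT_whit_zero, lowerA_apply, whitChar,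
    if_pos rfl]
  have e : confChar s⁻¹ (dim c ((s + θs) / 2)) (dim c (s / 2 + ν)) 1 =
      targetChar θs ν + s⁻¹ * (θs ^ 2 / 4 - ν ^ 2) := by
    simp only [confChar, dim, zpow_one]
    push_cast
    field_simp
    ring
  rw [e]
  simp only [lowerB₁, LinearMap.sub_apply, LinearMap.smul_apply, LinearMap.id_apply, lowMul_apply,
    zpow_one]
  module

theorem conf_lower_two (c θs ν : ℂ) {s : ℂ} (hs : s ≠ 0) (x : Low 0) :
    opT c 0 (whitBase s⁻¹ (confChar s⁻¹ (dim c ((s + θs) / 2)) (dim c (s / 2 + ν)))) 2 x -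
      s⁻¹ ^ (2 : ℤ) • opT c 0 (whitBase s⁻¹ (confChar s⁻¹ (dim c ((s + θs) / 2))
        (dim c (s / 2 + ν)))) 0 x -
      confChar s⁻¹ (dim c ((s + θs) / 2)) (dim c (s / 2 + ν)) 2 • x =
    lowerA c θs ν 2 x + s⁻¹ • lowerB₂ c θs ν x + s⁻¹ ^ 2 • lowerC c θs ν x := by
  rw [opT_conf c θs ν hs le_rfl, opT_whit_zero, lowerA_apply, whitChar, if_neg (by norm_num),
    if_pos rfl]
  have e : confChar s⁻¹ (dim c ((s + θs) / 2)) (dim c (s / 2 + ν)) 2 =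
      1 / 4 + s⁻¹ * (θs - ν) + s⁻¹ ^ 2 * ((c - 1) / 24 + θs ^ 2 / 2 - ν ^ 2) := by
    simp only [confChar, dim]
    have e : s⁻¹ ^ (2 : ℤ) = s⁻¹ ^ 2 := by norm_cast
    rw [e]
    push_cast
    field_simp
    ring
  have e2 : s⁻¹ ^ (2 : ℤ) = s⁻¹ ^ 2 := by norm_cast
  rw [e, e2]
  simp only [lowerB₂, lowerC, LinearMap.sub_apply, LinearMap.smul_apply, LinearMap.id_apply,
    lowMul_apply]
  module

/-! ### The vectors that represent the rescaled block -/

/-- The exponent that is subtracted from `θt` in the second recurrence. -/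
abbrev confShift (θs ν Δt : ℂ) : ℂ := θs ^ 2 / 4 + Δt - ν ^ 2

/-- The vectors `w k` satisfy the recurrences of the rescaled blocks. -/
structure IsConfluentFamily (c θs ν Δt : ℂ) (w : ℤ → ℂ → Low 0) : Prop where
  neg : ∀ k < 0, ∀ s, w k s = 0
  zero : ∀ᶠ s in Bornology.cobounded ℂ, w 0 s = 1
  tame : ∀ k, w k ∈ Tame (Low 0)
  lower_one : ∀ k : ℤ, ∀ᶠ s in Bornology.cobounded ℂ,
    lowerA c θs ν 1 (w k s) + s⁻¹ • lowerB₁ c θs ν (w k s) =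
      (k - 1 - irrPower θs ν) • w (k - 1) s - (s⁻¹ * k) • w k s
  lower_two : ∀ k : ℤ, ∀ᶠ s in Bornology.cobounded ℂ,
    lowerA c θs ν 2 (w k s) + s⁻¹ • lowerB₂ c θs ν (w k s) + s⁻¹ ^ 2 • lowerC c θs ν (w k s) =
      (Δt - irrPower θs ν + k - 2) • w (k - 2) s -
        (irrRate θs ν + s⁻¹ * confShift θs ν Δt) • w (k - 1) s - (s⁻¹ ^ 2 * k) • w k s

theorem tendsto_norm_dim (c : ℂ) (ν : ℂ) :
    Tendsto (fun s : ℂ => ‖dim c (s / 2 + ν)‖) (Bornology.cobounded ℂ) atTop := by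
  refine tendsto_norm_cobounded_atTop.comp ?_
  have h1 : Tendsto (fun s : ℂ => s / 2 + ν) (Bornology.cobounded ℂ) (Bornology.cobounded ℂ) := by
    refine (tendsto_add_const_cobounded ν).comp ?_
    simpa [div_eq_mul_inv] using
      tendsto_mul_right_cobounded (α := ℂ) (a := (2 : ℂ)⁻¹) (by norm_num)
  exact (tendsto_const_add_cobounded _).comp ((tendsto_pow_cobounded_cobounded two_ne_zero).comp h1)

/-- The vector `w k` is the coefficient of `(1 - Λ x) ^ A` times the series of images of the
descendants. The recurrences of the descendants pass through `F` and through the binomial factor,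
and `zeroChar` turns `w k` into the coefficient of the rescaled block. -/
theorem exists_confluentFamily (c θs θt ν θ₀ : ℂ) :
    (∀ k : ℕ, ∀ᶠ Λ : ℂ in Bornology.cobounded ℂ, ∃! z : ℂ, IsUBlockCoeff c θs θt ν θ₀ Λ k z) ∧
    ∃ w, IsConfluentFamily c θs ν (dim c θt) w ∧ ∀ k : ℕ, ∀ᶠ s in Bornology.cobounded ℂ,
      PowerSeries.coeff k (rescaledBlock c θs θt ν θ₀ s) = zeroChar (dim c θ₀) (w k s) := by
  have hΔ := tendsto_norm_dim c ν
  have tΔ : (fun s : ℂ => dim c (s / 2 + ν)) ∈ Tame ℂ := by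
    refine tame_dim c (tame_add ?_ (tame_const ν))
    simpa only [div_eq_mul_inv] using tame_mul tame_id (tame_const _)
  have tΔb : (fun s : ℂ => dim c ((s + θs) / 2)) ∈ Tame ℂ := by
    refine tame_dim c ?_
    simpa only [div_eq_mul_inv] using tame_mul (tame_add tame_id (tame_const θs)) (tame_const _)
  have tΔa : (fun s : ℂ => dim c ((s - θs) / 2)) ∈ Tame ℂ := by
    refine tame_dim c ?_
    simpa only [div_eq_mul_inv] using tame_mul (tame_sub tame_id (tame_const θs)) (tame_const _)
  obtain ⟨ω, hω⟩ := exists_descendantFamily c (dim c θt)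
    (fun s => dim c (s / 2 + ν) - dim c ((s - θs) / 2)) hΔ
  have hF : ∀ s : ℂ, ∃ F, s ≠ 0 →
      IsSeriesHom c s⁻¹ (dim c ((s + θs) / 2)) (dim c (s / 2 + ν)) F := fun s => by
    by_cases hs : s = 0
    · exact ⟨0, fun h => absurd hs h⟩
    · obtain ⟨F, hF⟩ := exists_seriesHom c (inv_ne_zero hs) (dim c ((s + θs) / 2)) (dim c (s / 2 + ν))
      exact ⟨F, fun _ => hF⟩
  choose F hF using hF
  have hblock : ∀ k : ℕ, ∀ᶠ s in Bornology.cobounded ℂ, ∀ z, IsUBlockCoeff c θs θt ν θ₀ s k z ↔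
      z = gam (dim c ((s + θs) / 2)) (dim c (s / 2 + ν) - dim c θ₀) k (ω k s) := by
    intro k
    filter_upwards [eventually_noSingular c k hΔ, hω.shap_eq k] with s h1 h2 z
    exact isRegularBlockCoeff_iff_of_noSingular h1 _ _ _ _ h2 z
  have hunique : ∀ k : ℕ, ∀ᶠ s in Bornology.cobounded ℂ,
      ∃! z : ℂ, IsUBlockCoeff c θs θt ν θ₀ s k z := by
    intro k
    filter_upwards [hblock k] with s hs
    exact ⟨_, (hs _).mpr rfl, fun z hz => (hs z).mp hz⟩
  refine ⟨hunique, ?_⟩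
  let u : ℤ → ℂ → Low 0 := fun k s => F s (ω k s) k
  let A : ℂ → ℂ := fun s => (θs / 2 + ν) * s + θs ^ 2 / 4 + dim c θt - ν ^ 2
  have hu : ∀ s, ∀ k < 0, u k s = 0 := fun s k hk => by simp only [u, hω.neg k hk, map_zero, Pi.zero_apply]
  have tu : ∀ k, u k ∈ Tame (Low 0) := by
    intro k
    have tω : ω k ∈ Tame (Low 1) := by
      rcases lt_or_ge k 0 with hk | hk
      · exact tame_congr (tame_const 0) (Eventually.of_forall fun s => hω.neg k hk s)
      · obtain ⟨J, hJ⟩ := tame_sub tΔ tΔa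
        have h1 := hω.small (J := min J 0) hΔ (fun z => small_isBigO (add_mem
          (small_mono (min_le_left _ _) hJ) (small_mono (min_le_right _ _) (small_const z)))) k.toNat
        rwa [Int.toNat_of_nonneg hk] at h1
    exact tame_apply (F := fun s => (LinearMap.proj k).comp (F s))
      (fun x => tame_seriesHom tΔb tΔ hF k x) tω
  have hlow : ∀ (i : ℕ) (k : ℤ), ∀ᶠ s in Bornology.cobounded ℂ, ∀ m : ℤ, m = i + 1 →
      opT c 0 (whitBase s⁻¹ (confChar s⁻¹ (dim c ((s + θs) / 2)) (dim c (s / 2 + ν)))) m (u k s) -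
      s⁻¹ ^ m • opT c 0 (whitBase s⁻¹ (confChar s⁻¹ (dim c ((s + θs) / 2))
        (dim c (s / 2 + ν)))) 0 (u k s) -
      confChar s⁻¹ (dim c ((s + θs) / 2)) (dim c (s / 2 + ν)) m • u k s =
      (dim c (s / 2 + ν) - dim c ((s - θs) / 2) + k - m + m * dim c θt) • u (k - m) s -
        (s⁻¹ ^ m * k) • u k s := by
    intro i k
    filter_upwards [hω.opT_eq hΔ k i, Bornology.eventually_ne_cobounded (0 : ℂ)] with s h1 hs m hm
    rw [← hm] at h1
    have := (hF s hs).lower_eq h1 k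
    rw [this]
    have e : dim c (s / 2 + ν) - dim c ((s - θs) / 2) + (k : ℂ) - (i + 1) + (i + 1) * dim c θt =
        dim c (s / 2 + ν) - dim c ((s - θs) / 2) + k - m + m * dim c θt := by
      rw [hm]
      push_cast
      ring
    rw [e]
  refine ⟨fun k s => binomMul (A s) s (fun j => u j s) k, ⟨?_, ?_, ?_, ?_, ?_⟩, ?_⟩
  · exact fun k hk s => binomMul_neg _ _ (hu s) hk
  · filter_upwards [Bornology.eventually_ne_cobounded (0 : ℂ)] with s hs
    simp only [binomMul_zero, u, hω.zero, (hF s hs).one, Pi.single_eq_same]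
  · intro k
    have tA : A ∈ Tame ℂ := tame_sub (tame_add (tame_add (tame_mul (tame_const _) tame_id)
      (tame_const _)) (tame_const _)) (tame_const _)
    refine tame_sum _ fun i _ => tame_smul (tame_mul (tame_gbinom tA i) (tame_pow ?_ i)) (tu _)
    simpa using tame_sub (tame_const 0) tame_id
  · intro k
    filter_upwards [(Finset.Icc 0 k).eventually_all.mpr fun j _ => hlow 0 j,
      Bornology.eventually_ne_cobounded (0 : ℂ)] with s h1 hs
    have h2 := binomMul_lower_one (A := A s) hs (hu s) (D := lowerA c θs ν 1 + s⁻¹ • lowerB₁ c θs ν)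
      (r := dim c (s / 2 + ν) - dim c ((s - θs) / 2) - 1 + dim c θt) (k := k) (fun j hj => by
        rcases lt_or_ge j 0 with hj0 | hj0
        · simp only [hu s j hj0, hu s (j - 1) (by lia), map_zero, smul_zero, sub_zero]
        · have h := h1 j (Finset.mem_Icc.mpr ⟨hj0, hj⟩) 1 (by simp)
          rw [conf_lower_one c θs ν hs] at h
          rw [LinearMap.add_apply, LinearMap.smul_apply, h]
          rw [zpow_one]
          push_cast
          module)
    rw [LinearMap.add_apply, LinearMap.smul_apply] at h2
    rw [h2]
    -- The contributions to `r - A` that are linear in `s`, and those of `Δ_t`, cancel; what remains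
    -- is `-1 - irrPower`.
    congr 2
    simp only [A, dim, irrPower]
    ring
  · intro k
    filter_upwards [(Finset.Icc 0 k).eventually_all.mpr fun j _ => hlow 1 j,
      Bornology.eventually_ne_cobounded (0 : ℂ)] with s h1 hs
    have h2 := binomMul_lower_two (A := A s) hs (hu s)
      (D := lowerA c θs ν 2 + s⁻¹ • lowerB₂ c θs ν + s⁻¹ ^ 2 • lowerC c θs ν)
      (r := dim c (s / 2 + ν) - dim c ((s - θs) / 2) - 2 + 2 * dim c θt) (k := k) (fun j hj => by
        rcases lt_or_ge j 0 with hj0 | hj0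
        · simp only [hu s j hj0, hu s (j - 2) (by lia), map_zero, smul_zero, sub_zero]
        · have h := h1 j (Finset.mem_Icc.mpr ⟨hj0, hj⟩) 2 (by norm_num)
          rw [conf_lower_two c θs ν hs] at h
          have e2 : s⁻¹ ^ (2 : ℤ) = s⁻¹ ^ 2 := by norm_cast
          rw [LinearMap.add_apply, LinearMap.add_apply, LinearMap.smul_apply,
            LinearMap.smul_apply, h, e2]
          push_cast
          module)
    rw [LinearMap.add_apply, LinearMap.add_apply, LinearMap.smul_apply, LinearMap.smul_apply] at h2
    rw [h2]
    congr 3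
    · simp only [A, dim, irrPower]
      ring
    -- `s⁻¹ * A` is exactly `irrRate + s⁻¹ * confShift`.
    · simp only [A, irrRate, confShift]
      field_simp
      ring
  · intro k
    filter_upwards [(Finset.range (k + 1)).eventually_all.mpr fun j _ => hblock j,
      (Finset.range (k + 1)).eventually_all.mpr fun j _ => hunique j,
      Bornology.eventually_ne_cobounded (0 : ℂ)] with s h1 h2 hs
    have hcoeff : ∀ j ∈ Finset.range (k + 1), zeroChar (dim c θ₀) (u j s) =
        uBlockCoeff c θs θt ν θ₀ s j * s ^ j := by
      intro j hj
      have h3 := h2 j hj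
      unfold uBlockCoeff regularBlockCoeff
      unfold IsUBlockCoeff at h3
      rw [dif_pos h3, (h1 j hj _).mp h3.choose_spec.1, (hF s hs).zeroChar_eq (inv_ne_zero hs)]
      simp [mul_comm]
    rw [rescaledBlock, PowerSeries.coeff_mul,
      Finset.Nat.sum_antidiagonal_eq_sum_range_succ
        (fun i j => PowerSeries.coeff i (PowerSeries.mk fun j =>
          gbinom ((θs / 2 + ν) * s + θs ^ 2 / 4 + dim c θt - ν ^ 2) j * (-s) ^ j) *
        PowerSeries.coeff j (PowerSeries.mk fun l => uBlockCoeff c θs θt ν θ₀ s l * s ^ l)) k]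
    simp only [PowerSeries.coeff_mk, binomMul, map_sum, map_smul, smul_eq_mul, Int.toNat_natCast]
    refine Finset.sum_congr rfl fun i hi => ?_
    have e : ((k : ℤ) - i) = ((k - i : ℕ) : ℤ) := by
      rw [Finset.mem_range] at hi
      lia
    rw [e, hcoeff (k - i) (by rw [Finset.mem_range]; lia)]

/-! ### Whittaker vectors -/

/-- For `n ≥ 2`, `L_{n+1}` is a nonzero multiple of `[L_1, L_n]`. The error `σ v` does no harm: for
`n = 2` the vectors `x` and `v` have the same `L_2`-eigenvalue, and for `n ≥ 3` both are killed by
`L_n`. -/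
theorem whittaker_of_lower {X : Type*} [AddCommGroup X] [Module ℂ X] {c : ℂ} {ρ : ℤ → X →ₗ[ℂ] X}
    (hρ : IsVirRep c ρ) {v x : X} {l₁ l₂ σ : ℂ} (h2v : ρ 2 v = l₂ • v)
    (h3v : ∀ n : ℤ, 3 ≤ n → ρ n v = 0) (h1 : ρ 1 x = l₁ • x + σ • v) (h2 : ρ 2 x = l₂ • x)
    (n : ℤ) (hn : 3 ≤ n) : ρ n x = 0 := by
  obtain ⟨j, rfl⟩ : ∃ j : ℕ, n = j + 3 := ⟨(n - 3).toNat, by lia⟩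
  clear hn
  induction j with
  | zero =>
    have h := hρ 1 2 x
    rw [cocyc_of_ne c (by norm_num), h1, h2, map_smul, map_add, map_smul, map_smul, h1, h2, h2v,
      zero_smul, add_zero] at h
    have e : ρ (1 + 2) x = 0 := by
      have : ((1 : ℤ) : ℂ) - (2 : ℤ) = -1 := by norm_num
      rw [this] at h
      have h4 : -ρ (1 + 2) x = 0 := by
        rw [← neg_one_smul ℂ, ← h]
        module
      exact neg_eq_zero.mp h4
    exact e
  | succ j ih =>
    have h := hρ 1 (j + 3) x
    rw [cocyc_of_ne c (by lia), h1, ih, map_zero, map_add, map_smul, map_smul, ih,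
      h3v _ (by lia), smul_zero, smul_zero, zero_smul, add_zero, add_zero, sub_zero] at h
    have e : (1 : ℤ) + (j + 3) = ((j + 1 : ℕ) : ℤ) + 3 := by push_cast; ring
    rw [e] at h
    refine (smul_eq_zero.mp h.symm).resolve_left ?_
    have : ((1 : ℤ) : ℂ) - ((j + 3 : ℤ) : ℂ) = -((j + 2 : ℕ) : ℂ) := by push_cast; ring
    rw [this, neg_eq_zero]
    exact_mod_cast Nat.succ_ne_zero (j + 1)

/-! ### Lowering operators on the Whittaker module -/

section Target

variable {c θs ν : ℂ}

/-- The filtration of the model of a Whittaker module in which `L_{-n}` has weight `n + 1`. -/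
abbrev whitFil (k : ℤ) : Submodule ℂ (Low 0) := wordFil (lowMul 0) 1 (fun i => i + 1) k

theorem targetT_nonpos (p : ℕ) (x : Low 0) : targetT c θs ν (-p) x = Low.gen 0 p * x := by
  have := opT_neg c (isBase_whitBase 0 (fun n => whitChar (targetChar θs ν) (1 / 4) (-n))) p x
  rwa [Nat.cast_zero, add_zero] at this

theorem gen_mul_mem_whitFil (p : ℕ) {k : ℤ} {x : Low 0} (hx : x ∈ whitFil k) :
    Low.gen 0 p * x ∈ whitFil (k + p + 1) := by
  have := app_mem_wordFil p hx
  rw [Nat.cast_add, Nat.cast_one, ← add_assoc] at this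
  exact this

theorem targetT_eq (m : ℤ) (x : Low 0) : targetT c θs ν m x =
    lowerA c θs ν m x + whitChar (targetChar θs ν) (1 / 4) (-m) • x := by
  rw [lowerA_apply, sub_add_cancel]

theorem targetT_gen_mul (m : ℤ) (p : ℕ) (x : Low 0) : targetT c θs ν m (Low.gen 0 p * x) =
    Low.gen 0 p * targetT c θs ν m x + ((m : ℂ) + p) • targetT c θs ν (m - p) x
      + cocyc c m (-p) • x := by
  have h := opT_gen_mul c (whitBase₀ (targetChar θs ν) (1 / 4)) m p x
  rwa [Nat.cast_zero, Nat.cast_zero, add_zero, sub_zero, add_zero] at h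

theorem targetT_mem_of_lowerA {k : ℤ} {x : Low 0} (hx : x ∈ whitFil k)
    (h : ∀ m : ℤ, 0 < m → lowerA c θs ν m x ∈ whitFil (k - m + 1)) {m : ℤ} (hm : m ≠ 2) :
    targetT c θs ν m x ∈ whitFil (k - m + 1) := by
  rcases le_or_gt m 0 with hm0 | hm0
  · obtain ⟨p, rfl⟩ : ∃ p : ℕ, m = -(p : ℤ) := ⟨(-m).toNat, by lia⟩
    rw [targetT_nonpos]
    convert gen_mul_mem_whitFil p hx using 2
    ring
  · rw [targetT_eq]
    refine add_mem (h m hm0) ?_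
    by_cases h1 : m = 1
    · exact Submodule.smul_mem _ _ (wordFil_mono (by lia) hx)
    · rw [whitChar, if_neg (by lia), if_neg (by lia), zero_smul]
      exact zero_mem _

/-- The weight of `L_{-n}` is `n + 1` because `L_2` is a nonzero scalar to leading order: `L_m` can
absorb the letter `L_{-(m-2)}`, whose weight is `m - 1`, and produce that scalar. -/
theorem lowerA_mem_whitFil {m : ℤ} (hm : 0 < m) {k : ℤ} {x : Low 0} (hx : x ∈ whitFil k) :
    lowerA c θs ν m x ∈ whitFil (k - m + 1) := by
  have key : ∀ (j : ℕ) (x : Low 0), Word (lowMul 0) 1 (fun i => i + 1) j x → ∀ m : ℤ, 0 < m →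
      lowerA c θs ν m x ∈ whitFil (j - m + 1) := by
    intro j x hx
    induction hx with
    | one => intro m hm; rw [lowerA_vac c θs ν hm]; exact zero_mem _
    | app p j x hx ih =>
      intro m hm
      have hx' : x ∈ whitFil j := hx.mem_fil le_rfl
      have e : lowerA c θs ν m (Low.gen 0 p * x) = Low.gen 0 p * lowerA c θs ν m x +
          ((m : ℂ) + p) • targetT c θs ν (m - p) x + cocyc c m (-p) • x := by
        rw [lowerA_apply, lowerA_apply, targetT_gen_mul, mul_sub, mul_smul_comm]
        abel
      rw [lowMul_apply, e]
      refine add_mem (add_mem ?_ (Submodule.smul_mem _ _ ?_)) ?_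
      · exact wordFil_mono (by push_cast; lia) (gen_mul_mem_whitFil p (ih m hm))
      · by_cases h2 : m - p = 2
        · rw [h2, targetT_eq]
          refine add_mem (wordFil_mono (by push_cast; lia) (ih 2 (by norm_num)))
            (Submodule.smul_mem _ _ (wordFil_mono (by push_cast; lia) hx'))
        · exact wordFil_mono (by push_cast; lia) (targetT_mem_of_lowerA hx' ih h2)
      · by_cases h : m + -(p : ℤ) = 0
        · exact Submodule.smul_mem _ _ (wordFil_mono (by push_cast; lia) hx')
        · rw [cocyc_of_ne c h, zero_smul]
          exact zero_mem _
  have : whitFil k ≤ (whitFil (k - m + 1)).comap (lowerA c θs ν m) :=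
    wordFil_le fun j hj x hx => wordFil_mono (by lia) (key j x hx m hm)
  exact this hx

/-- Since `[L_{n+2}, L_{-n}] = (2 n + 2) L_2` and `L_2` is `1/4` to leading order, twice `L_{n+2}`
minus its eigenvalue acts to leading order as `(n + 1) ∂/∂L_{-n}`. The Euler argument applies. -/
theorem mem_span_of_lowerA_eq_zero {x : Low 0}
    (h : ∀ m : ℤ, 2 ≤ m → lowerA c θs ν m x = 0) : x ∈ Submodule.span ℂ {(1 : Low 0)} := by
  obtain ⟨k, hk⟩ := exists_mem_wordFil (fun i => i + 1) x
  refine mem_span_of_lower_eq_zero (Y := fun n => (2 : ℂ) • lowerA c θs ν (n + 2))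
    (fun i => Nat.succ_pos i) ?_ ?_ ?_ hk ⟨0, fun N _ => ?_⟩
  · intro n
    rw [LinearMap.smul_apply, lowerA_vac c θs ν (by lia), smul_zero]
  · intro n p k x hx
    have hlow : ∀ m : ℤ, 0 < m → lowerA c θs ν m x ∈ whitFil (k - m + 1) :=
      fun m hm => lowerA_mem_whitFil hm hx
    have e : ((2 : ℂ) • lowerA c θs ν (n + 2)) (lowMul 0 p x) -
        lowMul 0 p (((2 : ℂ) • lowerA c θs ν (n + 2)) x) =
        (2 * (((n : ℤ) + 2 : ℤ) + (p : ℂ))) • targetT c θs ν (n + 2 - p) x +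
        (2 * cocyc c (n + 2) (-p)) • x := by
      simp only [LinearMap.smul_apply, lowerA_apply, lowMul_apply, targetT_gen_mul, mul_sub,
        mul_smul_comm]
      module
    rw [e]
    by_cases hnp : n = p
    · subst hnp
      have e2 : (n : ℤ) + 2 - n = 2 := by ring
      rw [e2, targetT_eq, cocyc_of_ne c (by lia), if_pos rfl, whitChar, if_neg (by norm_num),
        if_pos rfl]
      have e3 : (2 * (((n : ℤ) + 2 : ℤ) + (n : ℂ))) • (lowerA c θs ν 2 x + (1 / 4 : ℂ) • x) +
          (2 * (0 : ℂ)) • x - (((n + 1 : ℕ) : ℂ)) • x =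
          (2 * (((n : ℤ) + 2 : ℤ) + (n : ℂ))) • lowerA c θs ν 2 x := by
        push_cast
        module
      rw [e3]
      exact Submodule.smul_mem _ _ (wordFil_mono (by push_cast; lia) (hlow 2 (by norm_num)))
    · rw [if_neg hnp, zero_smul, sub_zero]
      refine add_mem (Submodule.smul_mem _ _ ?_) ?_
      · exact wordFil_mono (by push_cast; lia) (targetT_mem_of_lowerA hx hlow (by lia))
      · by_cases h : (n : ℤ) + 2 + -(p : ℤ) = 0
        · exact Submodule.smul_mem _ _ (wordFil_mono (by push_cast; lia) hx)
        · rw [cocyc_of_ne c h, mul_zero, zero_smul]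
          exact zero_mem _
  · intro n p k x hx
    rw [lowMul_comm]
    refine Submodule.smul_mem _ _ ?_
    exact wordFil_mono (by push_cast; lia) (app_mem_wordFil _ hx)
  · refine Finset.sum_eq_zero fun n _ => ?_
    rw [LinearMap.smul_apply, h _ (by lia), smul_zero, map_zero]

theorem isVirRep_target (c θs ν : ℂ) : IsVirRep c (targetT c θs ν) := isVirRep_whit₀ c _ _

theorem targetT_vac_one : targetT c θs ν 1 1 = targetChar θs ν • 1 := by
  rw [targetT, opT_one, whitBase₀_pos _ _ one_pos, whitChar, if_pos rfl]

theorem targetT_vac_two : targetT c θs ν 2 1 = (1 / 4 : ℂ) • 1 := by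
  rw [targetT, opT_one, whitBase₀_pos _ _ two_pos, whitChar, if_neg (by norm_num), if_pos rfl]

theorem targetT_vac_three {n : ℤ} (hn : 3 ≤ n) : targetT c θs ν n 1 = 0 := by
  rw [targetT, opT_one, whitBase₀_pos _ _ (by lia), whitChar, if_neg (by lia), if_neg (by lia),
    zero_smul]

theorem lowerA_one_apply (x : Low 0) :
    lowerA c θs ν 1 x = targetT c θs ν 1 x - targetChar θs ν • x := by
  rw [lowerA_apply, whitChar, if_pos rfl]

theorem lowerA_two_apply (x : Low 0) :
    lowerA c θs ν 2 x = targetT c θs ν 2 x - (1 / 4 : ℂ) • x := by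
  rw [lowerA_apply, whitChar, if_neg (by norm_num), if_pos rfl]

theorem zeroChar_one (Δ : ℂ) : zeroChar Δ 1 = 1 := map_one _

/-- A vector on which `L_2` acts as on the Whittaker vector, and `L_1` up to a multiple of the
Whittaker vector, is a multiple of the Whittaker vector. -/
theorem eq_smul_vac {x : Low 0} {σ : ℂ} (h1 : lowerA c θs ν 1 x = σ • 1)
    (h2 : lowerA c θs ν 2 x = 0) : (∃ r : ℂ, x = r • 1) ∧ σ = 0 := by
  have h3 := whittaker_of_lower (isVirRep_target c θs ν) targetT_vac_two
    (fun n hn => targetT_vac_three hn) (σ := σ) (x := x)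
    (by rw [← sub_eq_iff_eq_add', ← lowerA_one_apply, h1])
    (by rw [← sub_eq_zero, ← lowerA_two_apply, h2])
  have hx := mem_span_of_lowerA_eq_zero (c := c) (θs := θs) (ν := ν) (x := x) (fun m hm => by
    rcases hm.eq_or_lt with rfl | hm
    · exact h2
    · rw [lowerA_apply, h3 m (by lia), whitChar, if_neg (by lia), if_neg (by lia), zero_smul,
        sub_zero])
  obtain ⟨r, rfl⟩ := Submodule.mem_span_singleton.mp hx
  refine ⟨⟨r, rfl⟩, ?_⟩
  rw [map_smul, lowerA_vac c θs ν one_pos, smul_zero] at h1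
  have := congrArg (zeroChar 0) h1.symm
  rwa [map_smul, map_one, map_zero, smul_eq_mul, mul_one] at this

end Target

/-! ### Asymptotic expansions -/

section Expansion

variable {X Y : Type*} [AddCommGroup X] [Module ℂ X] [AddCommGroup Y] [Module ℂ Y]

/-- The Laurent polynomial in `1 / s` with given coefficients. -/
def laurent (p : ℤ →₀ X) (s : ℂ) : X := p.sum fun i x => s ^ (-i) • x

theorem laurent_add (p q : ℤ →₀ X) : laurent (p + q) = laurent p + laurent q := by
  ext s
  exact Finsupp.sum_add_index' (fun _ => smul_zero _) fun _ _ _ => smul_add _ _ _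

theorem laurent_single (i : ℤ) (x : X) :
    laurent (Finsupp.single i x) = fun s => s ^ (-i) • x := by
  ext s
  exact Finsupp.sum_single_index (smul_zero _)

theorem laurent_single_mem (i : ℤ) (x : X) : laurent (Finsupp.single i x) ∈ Small X i := by
  rw [laurent_single]
  simpa using small_zpow_smul i (small_const x)

theorem laurent_mem {p : ℤ →₀ X} {J : ℤ} (h : ∀ i < J, p i = 0) : laurent p ∈ Small X J := by
  have e : laurent p = ∑ i ∈ p.support, fun s : ℂ => s ^ (-i) • p i := by
    ext s
    rw [Finset.sum_apply]
    rfl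
  rw [e]
  refine sum_mem fun i hi => ?_
  have h4 := laurent_single_mem i (p i)
  rw [laurent_single] at h4
  refine small_mono ?_ h4
  by_contra hlt
  exact Finsupp.mem_support_iff.mp hi (h i (not_le.mp hlt))

/-- The coefficient of order `Λ ^ (-i)` in the asymptotic expansion of `f` is `x`. -/
def HasCoef (f : ℂ → X) (i : ℤ) (x : X) : Prop :=
  ∃ p : ℤ →₀ X, f - laurent p ∈ Small X (i + 1) ∧ p i = x

theorem HasCoef.of_laurent {f : ℂ → X} {i j : ℤ} {p : ℤ →₀ X} (h : f - laurent p ∈ Small X j)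
    (hij : i < j) : HasCoef f i (p i) := ⟨p, small_mono hij h, rfl⟩

theorem HasCoef.add {f g : ℂ → X} {i : ℤ} {x y : X} (hf : HasCoef f i x) (hg : HasCoef g i y) :
    HasCoef (f + g) i (x + y) := by
  obtain ⟨p, hp, rfl⟩ := hf
  obtain ⟨q, hq, rfl⟩ := hg
  refine ⟨p + q, ?_, rfl⟩
  rw [laurent_add, add_sub_add_comm]
  exact add_mem hp hq

theorem laurent_mapRange (T : X →ₗ[ℂ] Y) (p : ℤ →₀ X) :
    laurent (p.mapRange T (map_zero T)) = fun s => T (laurent p s) := by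
  ext s
  rw [laurent, laurent, Finsupp.sum_mapRange_index fun _ => smul_zero _, Finsupp.sum, Finsupp.sum,
    map_sum]
  simp only [map_smul]

theorem HasCoef.map (T : X →ₗ[ℂ] Y) {f : ℂ → X} {i : ℤ} {x : X} (hf : HasCoef f i x) :
    HasCoef (fun s => T (f s)) i (T x) := by
  obtain ⟨p, hp, rfl⟩ := hf
  refine ⟨p.mapRange T (map_zero T), ?_, by simp⟩
  rw [laurent_mapRange]
  have := small_map T hp
  simp only [Pi.sub_apply, map_sub] at this
  exact this

theorem HasCoef.smul (r : ℂ) {f : ℂ → X} {i : ℤ} {x : X} (hf : HasCoef f i x) :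
    HasCoef (fun s => r • f s) i (r • x) := hf.map (r • LinearMap.id)

theorem laurent_shift (n : ℤ) (p : ℤ →₀ X) {s : ℂ} (hs : s ≠ 0) :
    laurent (p.embDomain (Equiv.addRight n).toEmbedding) s = s ^ (-n) • laurent p s := by
  rw [laurent, laurent, Finsupp.sum_embDomain, Finsupp.sum, Finsupp.sum, Finset.smul_sum]
  refine Finset.sum_congr rfl fun i _ => ?_
  rw [smul_smul, ← zpow_add₀ hs]
  congr 2
  simp [Equiv.addRight]

theorem HasCoef.shift (n : ℤ) {f : ℂ → X} {i : ℤ} {x : X} (hf : HasCoef f (i - n) x) :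
    HasCoef (fun s => s ^ (-n) • f s) i x := by
  obtain ⟨p, hp, rfl⟩ := hf
  refine ⟨p.embDomain (Equiv.addRight n).toEmbedding, ?_, ?_⟩
  · have h := small_zpow_smul n hp
    have e : n + (i - n + 1) = i + 1 := by ring
    rw [e] at h
    refine small_congr h ?_
    filter_upwards [Bornology.eventually_ne_cobounded (0 : ℂ)] with s hs
    rw [Pi.sub_apply, Pi.sub_apply, laurent_shift n p hs, smul_sub]
  · have : i = (Equiv.addRight n).toEmbedding (i - n) := by simp
    conv_lhs => rw [this]
    rw [Finsupp.embDomain_apply_self]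

theorem HasCoef.congr {f g : ℂ → X} {i : ℤ} {x : X} (hf : HasCoef f i x)
    (h : ∀ᶠ s in Bornology.cobounded ℂ, g s = f s) : HasCoef g i x := by
  obtain ⟨p, hp, rfl⟩ := hf
  refine ⟨p, small_congr hp ?_, rfl⟩
  filter_upwards [h] with s hs
  rw [Pi.sub_apply, Pi.sub_apply, hs]

theorem HasCoef.sub {f g : ℂ → X} {i : ℤ} {x y : X} (hf : HasCoef f i x) (hg : HasCoef g i y) :
    HasCoef (f - g) i (x - y) := by
  have := hf.add (hg.smul (-1))
  rw [neg_one_smul, ← sub_eq_add_neg] at this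
  refine HasCoef.congr this (Eventually.of_forall fun s => ?_)
  simp [sub_eq_add_neg]

theorem HasCoef.of_small {f : ℂ → X} {i j : ℤ} (hf : f ∈ Small X j) (hij : i < j) :
    HasCoef f i 0 := by
  have h0 : laurent (0 : ℤ →₀ X) = 0 := by
    ext s
    exact Finsupp.sum_zero_index
  exact ⟨0, by rw [h0, sub_zero]; exact small_mono hij hf, rfl⟩

theorem laurent_eq_erase (p : ℤ →₀ X) (i : ℤ) :
    laurent p = laurent (p.erase i) + fun s => s ^ (-i) • p i := by
  rw [← laurent_single, ← laurent_add, add_comm, Finsupp.single_add_erase]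

/-- The lowest nonzero term dominates: after multiplication by the right power of `s` it is a
constant of order `O(1 / s)`, hence zero. Coefficients of asymptotic expansions are unique for this
reason. -/
theorem coeff_eq_zero_of_small (p : ℤ →₀ X) {j : ℤ} (h : laurent p ∈ Small X j) {i : ℤ}
    (hi : i < j) : p i = 0 := by
  by_contra hne
  have hfin : {i | i < j ∧ p i ≠ 0}.Finite :=
    p.support.finite_toSet.subset fun i hi => Finsupp.mem_support_iff.mpr hi.2
  obtain ⟨m, hm, hmin⟩ := hfin.exists_minimal ⟨i, hi, hne⟩
  have hlow : laurent (p.erase m) ∈ Small X (m + 1) := by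
    refine laurent_mem fun i hi => ?_
    by_cases him : i = m
    · rw [him, Finsupp.erase_same]
    · rw [Finsupp.erase_ne him]
      by_contra h1
      have him' : i ≤ m := by lia
      exact him (le_antisymm him' (hmin ⟨him'.trans_lt hm.1, h1⟩ him'))
  have h1 : (fun s : ℂ => s ^ (-m) • p m) ∈ Small X (m + 1) := by
    have := sub_mem (small_mono (show m + 1 ≤ j from hm.1) h) hlow
    rwa [laurent_eq_erase p m, add_sub_cancel_left] at this
  have h2 := small_zpow_smul (-m) h1
  have e : -m + (m + 1) = 1 := by ring
  rw [e] at h2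
  refine hm.2 (eq_zero_of_small_const (small_congr h2 ?_))
  filter_upwards [Bornology.eventually_ne_cobounded (0 : ℂ)] with s hs
  rw [smul_smul, ← zpow_add₀ hs, neg_neg, add_neg_cancel, zpow_zero, one_smul]

theorem HasCoef.unique {f : ℂ → X} {i : ℤ} {x y : X} (hx : HasCoef f i x) (hy : HasCoef f i y) :
    x = y := by
  have h := hx.sub hy
  obtain ⟨p, hp, h2⟩ := h
  rw [sub_self, zero_sub] at hp
  have := coeff_eq_zero_of_small p (by simpa using neg_mem hp) (lt_add_one i)
  rw [h2] at this
  exact sub_eq_zero.mp this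

/-- The functions with an asymptotic expansion up to the order `J`. -/
def Expandable (X : Type*) [AddCommGroup X] [Module ℂ X] (J : ℤ) : Submodule ℂ (ℂ → X) where
  carrier := {f | ∃ p : ℤ →₀ X, f - laurent p ∈ Small X J}
  add_mem' := by
    rintro f g ⟨p, hp⟩ ⟨q, hq⟩
    refine ⟨p + q, ?_⟩
    rw [laurent_add, add_sub_add_comm]
    exact add_mem hp hq
  zero_mem' := ⟨0, by
    have : laurent (0 : ℤ →₀ X) = 0 := by
      ext s
      exact Finsupp.sum_zero_index
    rw [this, sub_zero]
    exact zero_mem _⟩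
  smul_mem' := by
    rintro r f ⟨p, hp⟩
    refine ⟨p.mapRange (r • LinearMap.id : X →ₗ[ℂ] X) (map_zero _), ?_⟩
    rw [laurent_mapRange]
    have := Submodule.smul_mem _ r hp
    rw [smul_sub] at this
    exact this

theorem expandable_of_small {J : ℤ} {f : ℂ → X} (hf : f ∈ Small X J) : f ∈ Expandable X J := by
  refine ⟨0, ?_⟩
  have : laurent (0 : ℤ →₀ X) = 0 := by
    ext s
    exact Finsupp.sum_zero_index
  rwa [this, sub_zero]

theorem expandable_map (T : X →ₗ[ℂ] Y) {J : ℤ} {f : ℂ → X} (hf : f ∈ Expandable X J) :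
    (fun s => T (f s)) ∈ Expandable Y J := by
  obtain ⟨p, hp⟩ := hf
  refine ⟨p.mapRange T (map_zero T), ?_⟩
  rw [laurent_mapRange]
  have := small_map T hp
  simp only [Pi.sub_apply, map_sub] at this
  exact this

theorem expandable_mono {I J : ℤ} (h : J ≤ I) {f : ℂ → X} (hf : f ∈ Expandable X I) :
    f ∈ Expandable X J := by
  obtain ⟨p, hp⟩ := hf
  exact ⟨p, small_mono h hp⟩

theorem expandable_congr {J : ℤ} {f g : ℂ → X} (hf : f ∈ Expandable X J)
    (h : ∀ᶠ s in Bornology.cobounded ℂ, g s = f s) : g ∈ Expandable X J := by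
  obtain ⟨p, hp⟩ := hf
  refine ⟨p, small_congr hp ?_⟩
  filter_upwards [h] with s hs
  rw [Pi.sub_apply, Pi.sub_apply, hs]

theorem expandable_zpow (n : ℤ) {J : ℤ} {f : ℂ → X} (hf : f ∈ Expandable X J) :
    (fun s => s ^ (-n) • f s) ∈ Expandable X (n + J) := by
  obtain ⟨p, hp⟩ := hf
  refine ⟨p.embDomain (Equiv.addRight n).toEmbedding, small_congr (small_zpow_smul n hp) ?_⟩
  filter_upwards [Bornology.eventually_ne_cobounded (0 : ℂ)] with s hs
  rw [Pi.sub_apply, Pi.sub_apply, laurent_shift n p hs, smul_sub]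

theorem expandable_const (x : X) (J : ℤ) : (fun _ => x) ∈ Expandable X J := by
  refine ⟨Finsupp.single 0 x, ?_⟩
  rw [laurent_single]
  have : ((fun _ => x) - fun s : ℂ => s ^ (-(0 : ℤ)) • x) = 0 := by
    ext s
    simp
  rw [this]
  exact zero_mem _

theorem exists_coeffs {f : ℂ → X} (hf : ∀ J, f ∈ Expandable X J) :
    ∃ x : ℤ → X, ∀ i, HasCoef f i (x i) := by
  choose p hp using hf
  exact ⟨fun i => p (i + 1) i, fun i => HasCoef.of_laurent (hp (i + 1)) (lt_add_one i)⟩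

/-- Without positive powers of `s`, an expansion yields a limit, namely the coefficient of order
zero. -/
theorem sub_const_small {f : ℂ → X} {x : X} (h0 : HasCoef f 0 x)
    (hneg : ∀ i < 0, HasCoef f i 0) : (fun s => f s - x) ∈ Small X 1 := by
  obtain ⟨p, hp, rfl⟩ := h0
  rw [zero_add] at hp
  have hp0 : ∀ i < 0, p i = 0 := fun i hi =>
    (HasCoef.of_laurent hp (by lia)).unique (hneg i hi)
  have hlow : laurent (p.erase 0) ∈ Small X 1 := by
    refine laurent_mem fun i hi => ?_
    by_cases hi0 : i = 0
    · rw [hi0, Finsupp.erase_same]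
    · rw [Finsupp.erase_ne hi0]
      exact hp0 i (by lia)
  have := add_mem hp hlow
  rw [laurent_eq_erase p 0] at this
  convert this using 1
  ext s
  simp only [Pi.sub_apply, Pi.add_apply, neg_zero, zpow_zero, one_smul]
  abel

/-- A tame function which improves the order of its own expansion is expandable to all orders. -/
theorem expandable_of_bootstrap {f : ℂ → X} (hf : f ∈ Tame X)
    (h : ∀ J, f ∈ Expandable X J → f ∈ Expandable X (J + 1)) (J : ℤ) : f ∈ Expandable X J := by
  obtain ⟨I, hI⟩ := hf
  have key : ∀ n : ℕ, f ∈ Expandable X (I + n) := by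
    intro n
    induction n with
    | zero => simpa using expandable_of_small hI
    | succ n ih =>
      have := h _ ih
      rwa [add_assoc] at this
  exact expandable_mono (by lia) (key (J - I).toNat)

end Expansion

/-! ### The expansions of the representing vectors -/

section Family

variable {c θs ν Δt : ℂ} {w : ℤ → ℂ → Low 0}

/-- At leading order the equations for `w k` only control the part transverse to `1`, since the
lowering operators kill `1`. The missing component is found in the term `-s⁻¹ k (w k)` of the first
equation. Taking `s⁻¹ χ(w k)` as a separate unknown makes the leading operator injective, and the
rest is a perturbation by negative powers of `s`. -/
theorem IsConfluentFamily.expandable (hw : IsConfluentFamily c θs ν Δt w) (k : ℤ) :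
    ∀ J, w k ∈ Expandable (Low 0) J := by
  have hk : ∀ n : ℕ, ∀ k : ℤ, k = n → ∀ J, w k ∈ Expandable (Low 0) J := by
    intro n
    induction n using Nat.strong_induction_on with
    | _ n ih =>
      intro k hkn
      rcases Nat.eq_zero_or_pos n with rfl | hn
      · intro J
        subst hkn
        exact expandable_congr (expandable_const 1 J) hw.zero
      have hprev : ∀ j < k, ∀ J, w j ∈ Expandable (Low 0) J := by
        intro j hj
        rcases lt_or_ge j 0 with hj0 | hj0
        · intro J
          exact expandable_congr (zero_mem _) (Eventually.of_forall (hw.neg j hj0))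
        · exact ih j.toNat (by lia) j (by lia)
      have hk0 : (k : ℂ) ≠ 0 := by
        have : k ≠ 0 := by lia
        exact_mod_cast this
      let χ : Low 0 →ₗ[ℂ] ℂ := (zeroChar 0).toLinearMap
      have χ1 : χ 1 = 1 := zeroChar_one 0
      -- The leading operator on pairs `(u, τ)` with `w k = u + s τ 1` and `χ u = 0`. It is
      -- injective by `eq_smul_vac`, because `k ≠ 0`.
      let Q : Low 0 × ℂ →ₗ[ℂ] Low 0 × Low 0 × ℂ :=
        ((lowerA c θs ν 1).comp (LinearMap.fst ℂ _ _) +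
          ((k : ℂ) • LinearMap.toSpanSingleton ℂ (Low 0) 1).comp (LinearMap.snd ℂ _ _)).prod
        (((lowerA c θs ν 2).comp (LinearMap.fst ℂ _ _)).prod (χ.comp (LinearMap.fst ℂ _ _)))
      have hQ : ∀ u τ, Q (u, τ) = (lowerA c θs ν 1 u + (k : ℂ) • τ • 1, lowerA c θs ν 2 u, χ u) :=
        fun _ _ => rfl
      have hker : LinearMap.ker Q = ⊥ := by
        rw [LinearMap.ker_eq_bot']
        rintro ⟨u, τ⟩ h
        rw [hQ, Prod.mk_eq_zero, Prod.mk_eq_zero] at h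
        obtain ⟨⟨r, rfl⟩, hσ⟩ := eq_smul_vac (σ := -(k * τ)) (x := u)
          (by rw [eq_neg_of_add_eq_zero_left h.1]; module) h.2.1
        have hτ : τ = 0 := (mul_eq_zero.mp (neg_eq_zero.mp hσ)).resolve_left hk0
        have hr := h.2.2
        rw [map_smul, χ1, smul_eq_mul, mul_one] at hr
        rw [hr, hτ, zero_smul]
        rfl
      obtain ⟨R, hR⟩ := LinearMap.exists_leftInverse_of_injective Q hker
      have hR' : ∀ x, R (Q x) = x := fun x => LinearMap.congr_fun hR x
      -- `G₁` and `G₂` collect the terms of orders `s⁻¹` and `s⁻²`; their values on `u` and `τ` are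
      -- moved to the right-hand side.
      let G₁ : Low 0 × ℂ →ₗ[ℂ] Low 0 × Low 0 × ℂ :=
        ((-((k : ℂ) • LinearMap.id + lowerB₁ c θs ν)).comp (LinearMap.fst ℂ _ _)).prod
        (((-lowerB₂ c θs ν).comp (LinearMap.fst ℂ _ _) -
          ((k : ℂ) • LinearMap.toSpanSingleton ℂ (Low 0) 1).comp (LinearMap.snd ℂ _ _)).prod 0)
      have hG₁ : ∀ u τ, G₁ (u, τ) =
        (-((k : ℂ) • u + lowerB₁ c θs ν u), -lowerB₂ c θs ν u - (k : ℂ) • τ • 1, 0) := fun _ _ => rfl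
      let G₂ : Low 0 × ℂ →ₗ[ℂ] Low 0 × Low 0 × ℂ :=
        LinearMap.prod 0 (((-((k : ℂ) • LinearMap.id + lowerC c θs ν)).comp
          (LinearMap.fst ℂ _ _)).prod 0)
      have hG₂ : ∀ u τ, G₂ (u, τ) = (0, -((k : ℂ) • u + lowerC c θs ν u), 0) := fun _ _ => rfl
      let f : ℂ → Low 0 × ℂ := fun s => (w k s - χ (w k s) • 1, s ^ (-(1 : ℤ)) • χ (w k s))
      let ι₁ : Low 0 →ₗ[ℂ] Low 0 × Low 0 × ℂ := LinearMap.inl ℂ _ _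
      let ι₂ : Low 0 →ₗ[ℂ] Low 0 × Low 0 × ℂ := (LinearMap.inr ℂ _ _).comp (LinearMap.inl ℂ _ _)
      have hι₁ : ∀ x, ι₁ x = (x, 0, 0) := fun _ => rfl
      have hι₂ : ∀ x, ι₂ x = (0, x, 0) := fun _ => rfl
      let y : ℂ → Low 0 × Low 0 × ℂ := fun s =>
        ι₁ ((k - 1 - irrPower θs ν) • w (k - 1) s) +
        ι₂ ((Δt - irrPower θs ν + k - 2) • w (k - 2) s - irrRate θs ν • w (k - 1) s -
          s ^ (-(1 : ℤ)) • confShift θs ν Δt • w (k - 1) s)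
      have hy : ∀ J, y ∈ Expandable _ J := by
        intro J
        have e1 := fun (r : ℂ) => Submodule.smul_mem _ r (hprev (k - 1) (by lia) J)
        have e2 := fun (r : ℂ) => Submodule.smul_mem _ r (hprev (k - 2) (by lia) J)
        have e3 := expandable_zpow 1
          (Submodule.smul_mem _ (confShift θs ν Δt) (hprev (k - 1) (by lia) (J - 1)))
        rw [add_sub_cancel] at e3
        exact add_mem (expandable_map ι₁ (e1 _))
          (expandable_map ι₂ (sub_mem (sub_mem (e2 _) (e1 _)) e3))
      have hfeq : ∀ᶠ s in Bornology.cobounded ℂ,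
          f s = R (y s + s ^ (-(1 : ℤ)) • G₁ (f s) + s ^ (-(2 : ℤ)) • G₂ (f s)) := by
        filter_upwards [hw.lower_one k, hw.lower_two k] with s h1 h2
        conv_lhs => rw [← hR' (f s)]
        congr 1
        have e1 : s⁻¹ = s ^ (-(1 : ℤ)) := by simp
        have e2 : s⁻¹ ^ 2 = s ^ (-(2 : ℤ)) := by
          rw [zpow_neg, inv_pow]
          norm_cast
        have e3 : s ^ (-(2 : ℤ)) = s ^ (-(1 : ℤ)) * s ^ (-(1 : ℤ)) := by
          rw [← e1, ← e2, pow_two]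
        rw [e2, e1] at h2
        rw [e1] at h1
        rw [hQ, hG₁, hG₂]
        have h1' := eq_sub_of_add_eq h1
        have h2' := eq_sub_of_add_eq (eq_sub_of_add_eq h2)
        refine Prod.ext ?_ (Prod.ext ?_ ?_)
        · simp only [y, hι₁, hι₂,
            Prod.fst_add, Prod.smul_fst, map_sub, map_smul, lowerA_vac c θs ν one_pos,
            lowerB₁_vac, h1']
          module
        · simp only [y, hι₁, hι₂,
            Prod.fst_add, Prod.snd_add, Prod.smul_fst, Prod.smul_snd, map_sub, map_smul,
            lowerA_vac c θs ν two_pos, lowerB₂_vac, lowerC_vac, h2']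
          rw [e3]
          module
        · simp only [y, hι₁, hι₂,
            Prod.snd_add, Prod.smul_snd, map_sub, map_smul, χ1]
          simp
      have hft : f ∈ Tame (Low 0 × ℂ) := by
        have t0 := hw.tame k
        have t1 := tame_map χ t0
        have t2 := tame_sub t0 (tame_smul t1 (tame_const (1 : Low 0)))
        have t3 := tame_smul (tame_zpow (-1)) t1
        have := tame_add (tame_map (LinearMap.inl ℂ (Low 0) ℂ) t2)
          (tame_map (LinearMap.inr ℂ (Low 0) ℂ) t3)
        simpa [f] using this
      -- In `f = R (y + s⁻¹ G₁ f + s⁻² G₂ f)` an expansion of `f` up to order `J` on the right gives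
      -- one up to order `J + 1` on the left.
      have hf := expandable_of_bootstrap hft fun J hJ => by
        have e1 := expandable_zpow 1 (expandable_map G₁ hJ)
        have e2 := expandable_mono (show J + 1 ≤ 2 + J by lia)
          (expandable_zpow 2 (expandable_map G₂ hJ))
        rw [add_comm] at e1
        exact expandable_congr (expandable_map R (add_mem (add_mem (hy (J + 1)) e1) e2)) hfeq
      intro J
      have e1 := expandable_map (LinearMap.fst ℂ (Low 0) ℂ) (hf J)
      -- The factor `s` in `w k = u + s τ 1` costs one order, so `τ` is expanded up to order `J +
      -- 1`.
      have e2 := expandable_zpow (-1) (expandable_map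
        ((LinearMap.toSpanSingleton ℂ (Low 0) 1).comp (LinearMap.snd ℂ (Low 0) ℂ)) (hf (J + 1)))
      rw [neg_add_cancel_comm_assoc] at e2
      refine expandable_congr (add_mem e1 e2) ?_
      filter_upwards [Bornology.eventually_ne_cobounded (0 : ℂ)] with s hs
      simp only [f, Pi.add_apply, LinearMap.fst_apply, LinearMap.comp_apply, LinearMap.snd_apply,
        LinearMap.toSpanSingleton_apply, neg_neg, smul_smul, zpow_one, smul_eq_mul, zpow_neg]
      rw [← mul_assoc, mul_inv_cancel₀ hs, one_mul, sub_add_cancel]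
  rcases lt_or_ge k 0 with h | h
  · intro J
    exact expandable_congr (zero_mem _) (Eventually.of_forall (hw.neg k h))
  · exact hk k.toNat k (by lia)

/-- The coefficients of the asymptotic expansions of the representing vectors satisfy formal
recurrences. -/
structure IsFormalFamily (c θs ν Δt : ℂ) (v : ℤ → ℤ → Low 0) : Prop where
  neg : ∀ k < 0, ∀ i, v k i = 0
  zero : ∀ i, v 0 i = if i = 0 then 1 else 0
  bounded : ∀ k, ∃ N, ∀ i < N, v k i = 0
  lower_one : ∀ k i : ℤ, lowerA c θs ν 1 (v k i) + lowerB₁ c θs ν (v k (i - 1)) =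
    (k - 1 - irrPower θs ν) • v (k - 1) i - (k : ℂ) • v k (i - 1)
  lower_two : ∀ k i : ℤ, lowerA c θs ν 2 (v k i) + lowerB₂ c θs ν (v k (i - 1)) +
      lowerC c θs ν (v k (i - 2)) =
    (Δt - irrPower θs ν + k - 2) • v (k - 2) i - irrRate θs ν • v (k - 1) i -
      confShift θs ν Δt • v (k - 1) (i - 1) - (k : ℂ) • v k (i - 2)

theorem IsConfluentFamily.exists_formal (hw : IsConfluentFamily c θs ν Δt w) :
    ∃ v, IsFormalFamily c θs ν Δt v ∧ ∀ k i, HasCoef (w k) i (v k i) := by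
  have h : ∀ k, ∃ x : ℤ → Low 0, ∀ i, HasCoef (w k) i (x i) :=
    fun k => exists_coeffs (hw.expandable k)
  choose v hv using h
  have e1 : ∀ s : ℂ, s⁻¹ = s ^ (-(1 : ℤ)) := fun s => by simp
  have e2 : ∀ s : ℂ, s⁻¹ ^ 2 = s ^ (-(2 : ℤ)) := fun s => by
    rw [zpow_neg, inv_pow]
    norm_cast
  refine ⟨v, ⟨?_, ?_, ?_, ?_, ?_⟩, hv⟩
  · intro k hk i
    refine (hv k i).unique (HasCoef.of_small (j := i + 1) ?_ (lt_add_one i))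
    have : w k = 0 := funext (hw.neg k hk)
    rw [this]
    exact zero_mem _
  · intro i
    refine (hv 0 i).unique ⟨Finsupp.single 0 1, ?_, ?_⟩
    · rw [laurent_single]
      refine small_congr (f := 0) (zero_mem _) ?_
      filter_upwards [hw.zero] with s hs
      simp [hs]
    · rw [Finsupp.single_apply]
      simp [eq_comm]
  · intro k
    obtain ⟨J, hJ⟩ := hw.tame k
    exact ⟨J, fun i hi => (hv k i).unique (HasCoef.of_small hJ hi)⟩
  · intro k i
    have hl := ((hv k i).map (lowerA c θs ν 1)).add
      (((hv k (i - 1)).map (lowerB₁ c θs ν)).shift 1)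
    have hr := ((hv (k - 1) i).smul (k - 1 - irrPower θs ν)).sub
      (((hv k (i - 1)).smul k).shift 1)
    refine hl.unique (hr.congr ?_)
    filter_upwards [hw.lower_one k] with s hs
    simp only [Pi.add_apply, Pi.sub_apply, ← e1]
    rw [hs, mul_smul]
  · intro k i
    have hl := (((hv k i).map (lowerA c θs ν 2)).add
      (((hv k (i - 1)).map (lowerB₂ c θs ν)).shift 1)).add
      (((hv k (i - 2)).map (lowerC c θs ν)).shift 2)
    have hr := ((((hv (k - 2) i).smul (Δt - irrPower θs ν + k - 2)).sub
      ((hv (k - 1) i).smul (irrRate θs ν))).sub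
      (((hv (k - 1) (i - 1)).smul (confShift θs ν Δt)).shift 1)).sub
      (((hv k (i - 2)).smul k).shift 2)
    refine hl.unique (hr.congr ?_)
    filter_upwards [hw.lower_two k] with s hs
    simp only [Pi.add_apply, Pi.sub_apply, ← e1, ← e2]
    rw [hs]
    module

end Family

/-! ### The Heisenberg algebra on the Fock space -/

section Fock

open MvPolynomial (X pderiv constantCoeff)

/-- The Fock space; the variable `X i` stands for the creation operator `a_{-(i + 1)}`. -/
abbrev Fock : Type := MvPolynomial ℕ ℂ

theorem fock_induction {P : Fock → Prop} (hone : P 1) (hsmul : ∀ (r : ℂ) x, P x → P (r • x))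
    (hadd : ∀ x y, P x → P y → P (x + y)) (hX : ∀ i x, P x → P (X i * x)) (x : Fock) : P x := by
  induction x using MvPolynomial.induction_on with
  | C r =>
    have := hsmul r 1 hone
    rwa [MvPolynomial.smul_eq_C_mul, mul_one] at this
  | add x y hx hy => exact hadd x y hx hy
  | mul_X x i hx => rw [mul_comm]; exact hX i x hx

/-- The Heisenberg operators, `[a_m, a_n] = (m / 2) δ_{m+n,0}`, with `a_0 = q`. -/
def heis (q : ℂ) (n : ℤ) : Fock →ₗ[ℂ] Fock :=
  if n < 0 then LinearMap.mulLeft ℂ (X (-n - 1).toNat)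
  else if n = 0 then q • LinearMap.id
  else ((n : ℂ) / 2) • (pderiv (n - 1).toNat).toLinearMap

variable (q : ℂ)

theorem heis_neg (i : ℕ) (x : Fock) : heis q (-((i : ℤ) + 1)) x = X i * x := by
  have h : -((i : ℤ) + 1) < 0 := by lia
  have e : (-(-((i : ℤ) + 1)) - 1).toNat = i := by lia
  rw [heis, if_pos h, e]
  rfl

theorem heis_zero (x : Fock) : heis q 0 x = q • x := by simp [heis]

theorem heis_pos (i : ℕ) (x : Fock) :
    heis q ((i : ℤ) + 1) x = (((i : ℂ) + 1) / 2) • pderiv i x := by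
  have h : ¬ ((i : ℤ) + 1 < 0) := by lia
  have h2 : ¬ ((i : ℤ) + 1 = 0) := by lia
  have e : ((i : ℤ) + 1 - 1).toNat = i := by lia
  rw [heis, if_neg h, if_neg h2, e]
  push_cast
  rfl

theorem index_cases (n : ℤ) : (∃ i : ℕ, n = -((i : ℤ) + 1)) ∨ n = 0 ∨ ∃ i : ℕ, n = (i : ℤ) + 1 := by
  rcases lt_trichotomy n 0 with h | h | h
  · exact Or.inl ⟨(-n - 1).toNat, by lia⟩
  · exact Or.inr (Or.inl h)
  · exact Or.inr (Or.inr ⟨(n - 1).toNat, by lia⟩)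

theorem heis_one {n : ℤ} (hn : 0 < n) : heis q n 1 = 0 := by
  obtain ⟨i, rfl⟩ : ∃ i : ℕ, n = (i : ℤ) + 1 := ⟨(n - 1).toNat, by lia⟩
  rw [heis_pos, MvPolynomial.pderiv_one, smul_zero]

theorem constantCoeff_heis_neg {n : ℤ} (hn : n < 0) (x : Fock) :
    constantCoeff (heis q n x) = 0 := by
  obtain ⟨i, rfl⟩ : ∃ i : ℕ, n = -((i : ℤ) + 1) := ⟨(-n - 1).toNat, by lia⟩
  rw [heis_neg, map_mul, MvPolynomial.constantCoeff_X, zero_mul]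

theorem heis_X_mul (n : ℤ) (i : ℕ) (x : Fock) : heis q n (X i * x) =
    X i * heis q n x + (if n = (i : ℤ) + 1 then (n : ℂ) / 2 else 0) • x := by
  rcases index_cases n with ⟨j, rfl⟩ | rfl | ⟨j, rfl⟩
  · rw [heis_neg, heis_neg, if_neg (by lia), zero_smul, add_zero, mul_left_comm]
  · rw [heis_zero, heis_zero, if_neg (by lia), zero_smul, add_zero, mul_smul_comm]
  · rw [heis_pos, heis_pos, MvPolynomial.pderiv_mul]
    by_cases h : i = j
    · subst h
      rw [MvPolynomial.pderiv_X_self, if_pos rfl, one_mul, smul_add, mul_smul_comm, add_comm]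
      push_cast
      rfl
    · rw [MvPolynomial.pderiv_X_of_ne h, if_neg (by lia), zero_mul, zero_smul, zero_add, add_zero,
        mul_smul_comm]

/-- A linear operator that commutes with the creation operators is determined by the image
of the vacuum. -/
theorem fock_ext {A B : Fock →ₗ[ℂ] Fock} (h1 : A 1 = B 1)
    (hX : ∀ i x, A x = B x → A (X i * x) = B (X i * x)) (x : Fock) : A x = B x := by
  induction x using fock_induction with
  | hone => exact h1
  | hsmul r x hx => rw [map_smul, map_smul, hx]
  | hadd x y hx hy => rw [map_add, map_add, hx, hy]
  | hX i x hx => exact hX i x hx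

theorem heis_comm (m n : ℤ) (x : Fock) : heis q m (heis q n x) =
    heis q n (heis q m x) + (if m + n = 0 then (m : ℂ) / 2 else 0) • x := by
  rcases index_cases n with ⟨j, rfl⟩ | rfl | ⟨j, rfl⟩
  · rw [heis_neg, heis_X_mul, heis_neg]
    congr 2
    exact if_congr (by lia) rfl rfl
  · rw [heis_zero, heis_zero, map_smul]
    split_ifs with h
    · obtain rfl : m = 0 := by lia
      simp
    · simp
  · rcases index_cases m with ⟨i, rfl⟩ | rfl | ⟨i, rfl⟩
    · rw [heis_neg, heis_neg, heis_X_mul]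
      by_cases h : i = j
      · subst h
        rw [if_pos rfl, if_pos (by ring)]
        push_cast
        module
      · rw [if_neg (by lia), if_neg (by lia)]
        module
    · rw [heis_zero, heis_zero, map_smul, if_neg (by lia), zero_smul, add_zero]
    · rw [if_neg (by lia), zero_smul, add_zero]
      rw [← LinearMap.comp_apply, ← LinearMap.comp_apply]
      refine fock_ext ?_ (fun k y hy => ?_) x
      · rw [LinearMap.comp_apply, LinearMap.comp_apply, heis_one q (by lia), heis_one q (by lia),
          map_zero, map_zero]
      · rw [LinearMap.comp_apply, LinearMap.comp_apply] at hy ⊢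
        rw [heis_X_mul, heis_X_mul, map_add, map_add, map_smul, map_smul, heis_X_mul, heis_X_mul,
          hy]
        abel

/-- The filtration of the Fock space by the degree, where `a_{-n}` has degree `n`. -/
abbrev fockFil (k : ℤ) : Submodule ℂ Fock :=
  wordFil (fun i => LinearMap.mulLeft ℂ (X i : Fock)) 1 (fun i => i + 1) k

theorem exists_mem_fockFil (x : Fock) : ∃ k : ℕ, x ∈ fockFil k := by
  induction x using fock_induction with
  | hone => exact ⟨0, Word.one.mem_fil le_rfl⟩
  | hsmul r x hx =>
    obtain ⟨k, hk⟩ := hx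
    exact ⟨k, Submodule.smul_mem _ r hk⟩
  | hadd x y hx hy =>
    obtain ⟨k, hk⟩ := hx
    obtain ⟨j, hj⟩ := hy
    exact ⟨max k j, add_mem (wordFil_mono (by simp) hk) (wordFil_mono (by simp) hj)⟩
  | hX i x hx =>
    obtain ⟨k, hk⟩ := hx
    exact ⟨k + (i + 1), by simpa using app_mem_wordFil i hk⟩

theorem X_mul_mem_fockFil (i : ℕ) {k : ℤ} {x : Fock} (hx : x ∈ fockFil k) :
    X i * x ∈ fockFil (k + i + 1) := by
  have := app_mem_wordFil i hx
  rw [Nat.cast_add, Nat.cast_one, ← add_assoc] at this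
  exact this

theorem heis_mem_fockFil (n : ℤ) {k : ℤ} {x : Fock} (hx : x ∈ fockFil k) :
    heis q n x ∈ fockFil (k - n) := by
  rcases index_cases n with ⟨i, rfl⟩ | rfl | ⟨i, rfl⟩
  · rw [heis_neg]
    exact wordFil_mono (by lia) (X_mul_mem_fockFil i hx)
  · rw [heis_zero]
    exact Submodule.smul_mem _ _ (wordFil_mono (by lia) hx)
  · have key : ∀ (j : ℕ) (x : Fock),
        Word (fun i => LinearMap.mulLeft ℂ (X i : Fock)) 1 (fun i => i + 1) j x →
        heis q (i + 1) x ∈ fockFil (j - (i + 1)) := by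
      intro j x hx
      induction hx with
      | one => rw [heis_one q (by lia)]; exact zero_mem _
      | app p j x hx ih =>
        rw [LinearMap.mulLeft_apply, heis_X_mul]
        refine add_mem (wordFil_mono (by push_cast; lia) (X_mul_mem_fockFil p ih)) ?_
        split_ifs with h
        · exact Submodule.smul_mem _ _ (hx.mem_fil (by push_cast; lia))
        · rw [zero_smul]; exact zero_mem _
    have : fockFil k ≤ (fockFil (k - (i + 1))).comap (heis q (i + 1)) :=
      wordFil_le fun j hj x hx => wordFil_mono (by lia) (key j x hx)
    exact this hx

theorem eq_smul_one_of_mem_span {x : Fock} (hx : x ∈ Submodule.span ℂ {(1 : Fock)}) :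
    x = constantCoeff x • 1 := by
  obtain ⟨r, rfl⟩ := Submodule.mem_span_singleton.mp hx
  simp

/-- Twice `a_{n+1}` is `(n + 1) ∂/∂X_n`, so here the Euler operator is exactly the degree; no
corrections of lower weight occur. -/
theorem eq_smul_one_of_heis_eq_zero {x : Fock} (h : ∀ n : ℤ, 0 < n → heis q n x = 0) :
    x = constantCoeff x • 1 := by
  obtain ⟨k, hk⟩ := exists_mem_fockFil x
  refine eq_smul_one_of_mem_span (mem_span_of_lower_eq_zero
    (Y := fun n => (2 : ℂ) • heis q (n + 1)) (fun i => Nat.succ_pos i) ?_ ?_ ?_ hk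
    ⟨0, fun N _ => ?_⟩)
  · intro n
    rw [LinearMap.smul_apply, heis_one q (by lia), smul_zero]
  · intro n p k x hx
    convert Submodule.zero_mem _ using 1
    simp only [LinearMap.smul_apply, LinearMap.mulLeft_apply, heis_X_mul, mul_smul_comm]
    by_cases h : n = p
    · subst h
      rw [if_pos rfl, if_pos rfl]
      push_cast
      module
    · rw [if_neg (by lia), if_neg h]
      module
  · intro n p k x hx
    simp only [LinearMap.mulLeft_apply]
    rw [mul_left_comm, sub_self]
    exact zero_mem _
  · refine Finset.sum_eq_zero fun n _ => ?_
    rw [LinearMap.smul_apply, h _ (by lia), smul_zero, map_zero]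

end Fock

/-! ### The Virasoro algebra on the Fock space -/

section FockVirasoro

open MvPolynomial (X constantCoeff)

variable (q β : ℂ)

/-- The part of `L_m` that is bilinear in creation and annihilation operators. -/
def fockDer (m : ℤ) : Derivation ℂ Fock Fock := MvPolynomial.mkDerivation ℂ fun i =>
  if m < (i : ℤ) + 1 then ((i : ℂ) + 1) • X (i - m).toNat else 0

/-- The part of `L_m` that is bilinear in `a_r` and `a_{m-r}` with `r` between `0` and `m`. -/
def fockQuad (m : ℤ) : Fock →ₗ[ℂ] Fock :=
  ∑ j ∈ Finset.range (m.natAbs - 1),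
    (heis q (m.sign * ((j : ℤ) + 1))).comp (heis q (m - m.sign * ((j : ℤ) + 1)))

/-- The operator `L_m = ∑ :a_r a_{m-r}: + β (m + 1) a_m` on the Fock space. -/
def fockL (m : ℤ) : Fock →ₗ[ℂ] Fock :=
  (fockDer m).toLinearMap + fockQuad q m +
    ((if m = 0 then q else 2 * q) + β * (m + 1)) • heis q m

theorem fockL_apply (m : ℤ) (x : Fock) : fockL q β m x = fockDer m x + fockQuad q m x +
    ((if m = 0 then q else 2 * q) + β * (m + 1)) • heis q m x := rfl

theorem fockQuad_apply (m : ℤ) (x : Fock) : fockQuad q m x =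
    ∑ j ∈ Finset.range (m.natAbs - 1), heis q (m.sign * ((j : ℤ) + 1))
      (heis q (m - m.sign * ((j : ℤ) + 1)) x) := by
  simp [fockQuad]

theorem sum_sign_ite (m t : ℤ) : ∑ j ∈ Finset.range (m.natAbs - 1),
    (if m.sign * ((j : ℤ) + 1) = t then (1 : ℂ) else 0) =
      if 0 < t ∧ t < m ∨ m < t ∧ t < 0 then 1 else 0 := by
  by_cases h : 0 < t ∧ t < m ∨ m < t ∧ t < 0
  · rw [if_pos h, Finset.sum_eq_single_of_mem (t.natAbs - 1) (Finset.mem_range.mpr (by lia))]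
    · rw [if_pos]
      rcases h with h | h
      · rw [Int.sign_eq_one_of_pos (by lia)]
        lia
      · rw [Int.sign_eq_neg_one_of_neg (by lia)]
        lia
    · intro j _ hj
      rw [if_neg]
      rcases h with h | h
      · rw [Int.sign_eq_one_of_pos (by lia)]
        lia
      · rw [Int.sign_eq_neg_one_of_neg (by lia)]
        lia
  · rw [if_neg h]
    refine Finset.sum_eq_zero fun j hj => if_neg fun hjt => h ?_
    rw [Finset.mem_range] at hj
    rcases lt_trichotomy m 0 with hm | hm | hm
    · rw [Int.sign_eq_neg_one_of_neg hm] at hjt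
      lia
    · subst hm
      simp at hj
    · rw [Int.sign_eq_one_of_pos hm] at hjt
      lia

/-- `a_n` contracts with the summands `r = -n` and `r = m + n`, each contributing half of `n
a_{m+n}`. Both indices lie in the range of summation or neither does. -/
theorem heis_fockQuad (m n : ℤ) (x : Fock) : heis q n (fockQuad q m x) =
    fockQuad q m (heis q n x) +
      (if 0 < -n ∧ -n < m ∨ m < -n ∧ -n < 0 then (n : ℂ) else 0) • heis q (m + n) x := by
  have hterm : ∀ r : ℤ, heis q n (heis q r (heis q (m - r) x)) =
      heis q r (heis q (m - r) (heis q n x)) +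
        (((if r = -n then (1 : ℂ) else 0) + if r = m + n then 1 else 0) * (n / 2)) •
          heis q (m + n) x := by
    intro r
    rw [heis_comm q n r, heis_comm q n (m - r), map_add, map_smul]
    have e1 : (if n + r = 0 then (n : ℂ) / 2 else 0) • heis q (m - r) x =
        ((if r = -n then (1 : ℂ) else 0) * (n / 2)) • heis q (m + n) x := by
      by_cases h : r = -n
      · rw [if_pos h, if_pos (by lia), h, one_mul, sub_neg_eq_add]
      · rw [if_neg h, if_neg (by lia), zero_mul, zero_smul, zero_smul]
    have e2 : (if n + (m - r) = 0 then (n : ℂ) / 2 else 0) • heis q r x =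
        ((if r = m + n then (1 : ℂ) else 0) * (n / 2)) • heis q (m + n) x := by
      by_cases h : r = m + n
      · rw [if_pos h, if_pos (by lia), h, one_mul]
      · rw [if_neg h, if_neg (by lia), zero_mul, zero_smul, zero_smul]
    rw [e1, e2]
    module
  rw [fockQuad_apply, fockQuad_apply, map_sum, Finset.sum_congr rfl fun j _ => hterm _,
    Finset.sum_add_distrib, ← Finset.sum_smul, ← Finset.sum_mul, Finset.sum_add_distrib,
    sum_sign_ite, sum_sign_ite]
  congr 2
  by_cases h : 0 < -n ∧ -n < m ∨ m < -n ∧ -n < 0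
  · rw [if_pos h, if_pos h, if_pos (by lia)]
    ring
  · rw [if_neg h, if_neg h, if_neg (by lia)]
    ring

/-- Exactly one part of `fockL` produces `[L_m, a_{-(i+1)}] = (i + 1) a_{m-i-1}`: the derivation if
`m < i + 1`, the quadratic part if `m > i + 1`, and the zero mode term if `m = i + 1`. The scalar
comes from the background charge `β`. -/
theorem fockL_X_mul (m : ℤ) (i : ℕ) (x : Fock) : fockL q β m (X i * x) =
    X i * fockL q β m x + ((i : ℂ) + 1) • heis q (m - i - 1) x +
      (if m = (i : ℤ) + 1 then β * (m ^ 2 + m) / 2 else 0) • x := by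
  have hq := heis_fockQuad q m (-((i : ℤ) + 1)) x
  rw [heis_neg, heis_neg, neg_neg] at hq
  have e : m + -((i : ℤ) + 1) = m - i - 1 := by ring
  rw [e] at hq
  rw [fockL_apply, fockL_apply, mul_add (X i), mul_add (X i), eq_sub_of_add_eq hq.symm, heis_X_mul, Derivation.leibniz, fockDer,
    MvPolynomial.mkDerivation_X, smul_eq_mul, smul_eq_mul, mul_smul_comm]
  rcases lt_trichotomy m ((i : ℤ) + 1) with h | h | h
  · have hh : heis q (m - i - 1) x = X (i - m).toNat * x := by
      rw [← heis_neg q]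
      congr 2
      lia
    rw [if_pos h, if_neg h.ne, if_neg (by lia), if_neg h.ne, hh, mul_smul_comm, mul_comm x]
    module
  · have e0 : m - i - 1 = 0 := by lia
    rw [if_neg h.not_lt, mul_zero, if_neg (by lia), if_pos h, if_pos h, if_neg (by lia), e0, heis_zero, h]
    push_cast
    module
  · rw [if_neg h.not_gt, mul_zero, if_pos (by lia), if_neg h.ne', if_neg h.ne', if_neg (by lia)]
    push_cast
    module

theorem fockL_one_pos {m : ℤ} (hm : 0 < m) : fockL q β m 1 = 0 := by
  rw [fockL_apply, heis_one q hm, fockQuad_apply, Finset.sum_eq_zero]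
  · simp
  · intro j hj
    rw [Finset.mem_range] at hj
    rw [Int.sign_eq_one_of_pos hm, heis_one q (by lia), map_zero]

theorem fockL_one_zero : fockL q β 0 1 = (q ^ 2 + β * q) • 1 := by
  rw [fockL_apply, heis_zero, fockQuad_apply]
  simp
  module

theorem constantCoeff_fockL_one (m : ℤ) :
    constantCoeff (fockL q β m 1) = if m = 0 then q ^ 2 + β * q else 0 := by
  rcases lt_trichotomy m 0 with hm | rfl | hm
  · rw [fockL_apply, fockQuad_apply, map_add, map_add, map_sum, Finset.sum_eq_zero,
      MvPolynomial.constantCoeff_smul, constantCoeff_heis_neg q hm]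
    · simp [hm.ne]
    · intro j _
      rw [Int.sign_eq_neg_one_of_neg hm, constantCoeff_heis_neg q (by lia)]
  · rw [fockL_one_zero, if_pos rfl, MvPolynomial.constantCoeff_smul]
    simp
  · rw [fockL_one_pos q β hm, map_zero, if_neg hm.ne']

theorem constantCoeff_fockL_nonpos {m : ℤ} (hm : m ≤ 0) (x : Fock) :
    constantCoeff (fockL q β m x) =
      (if m = 0 then q ^ 2 + β * q else 0) * constantCoeff x := by
  induction x using fock_induction with
  | hone => rw [constantCoeff_fockL_one, map_one, mul_one]
  | hsmul r x hx =>
    rw [map_smul, MvPolynomial.constantCoeff_smul, MvPolynomial.constantCoeff_smul, hx,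
      smul_eq_mul, smul_eq_mul]
    ring
  | hadd x y hx hy => rw [map_add, map_add, map_add, hx, hy, mul_add]
  | hX i x hx =>
    rw [fockL_X_mul, if_neg (by lia), zero_smul, add_zero, map_add,
      MvPolynomial.constantCoeff_smul, constantCoeff_heis_neg q (by lia)]
    simp

/-- For creation operators this is `fockL_X_mul`. For annihilation operators both sides agree on the
vacuum and change in the same way when a creation operator is put in front. -/
theorem fockL_heis (m n : ℤ) (x : Fock) : fockL q β m (heis q n x) =
    heis q n (fockL q β m x) - (n : ℂ) • heis q (m + n) x +
      (if m + n = 0 then β * (m ^ 2 + m) / 2 else 0) • x := by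
  rcases index_cases n with ⟨i, rfl⟩ | rfl | ⟨i, rfl⟩
  · have e : m + -((i : ℤ) + 1) = m - i - 1 := by ring
    rw [heis_neg, heis_neg, fockL_X_mul, e]
    have e2 : m = (i : ℤ) + 1 ↔ m - i - 1 = 0 := by lia
    simp only [e2]
    push_cast
    module
  · rw [heis_zero, heis_zero, map_smul]
    split_ifs with h
    · obtain rfl : m = 0 := by lia
      simp
    · simp
  · generalize hn : (i : ℤ) + 1 = n
    have hn0 : 0 < n := by lia
    clear hn
    let B : Fock →ₗ[ℂ] Fock := (heis q n).comp (fockL q β m) - (n : ℂ) • heis q (m + n) +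
      (if m + n = 0 then β * (m ^ 2 + m) / 2 else 0 : ℂ) • LinearMap.id
    have hB : ∀ x, B x = heis q n (fockL q β m x) - (n : ℂ) • heis q (m + n) x +
      (if m + n = 0 then β * (m ^ 2 + m) / 2 else 0 : ℂ) • x := fun x => rfl
    rw [← hB, ← LinearMap.comp_apply]
    refine fock_ext ?_ (fun k y hy => ?_) x
    · rw [LinearMap.comp_apply, heis_one q hn0, map_zero, hB]
      rcases lt_trichotomy m 0 with hm | rfl | hm
      · rw [fockL_apply, map_add, map_add, heis_fockQuad, heis_one q hn0, map_zero, map_smul,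
          heis_comm q n m, heis_one q hn0, map_zero, Derivation.map_one_eq_zero, map_zero,
          if_neg hm.ne]
        by_cases h : m + n = 0
        · obtain rfl : m = -n := by lia
          rw [if_neg (by lia), if_pos (by lia), if_pos h, h, heis_zero]
          push_cast
          module
        · rw [if_neg h, if_neg (by lia : ¬ n + m = 0)]
          by_cases h2 : 0 < m + n
          · rw [heis_one q h2]
            simp
          · rw [if_pos (by lia)]
            module
      · rw [fockL_one_zero, map_smul, heis_one q hn0, heis_one q (by lia), if_neg (by lia)]
        simp
      · rw [fockL_one_pos q β hm, map_zero, heis_one q (by lia), if_neg (by lia)]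
        simp
    · rw [LinearMap.comp_apply, hB] at hy ⊢
      rw [heis_X_mul, heis_X_mul, map_add, map_smul, fockL_X_mul, fockL_X_mul, map_add, map_add,
        heis_X_mul, map_smul, map_smul, hy, heis_comm q (m - k - 1) n]
      by_cases h : m + n = k + 1
      · have hk : (k : ℂ) = m + n - 1 := by
          have : (k : ℤ) = m + n - 1 := by lia
          exact_mod_cast congrArg (Int.cast : ℤ → ℂ) this
        rw [if_pos h, if_pos (show m - k - 1 + n = 0 by lia)]
        push_cast
        rw [hk, mul_add, mul_sub, mul_smul_comm, mul_smul_comm]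
        module
      · rw [if_neg h, if_neg (by lia : ¬ m - k - 1 + n = 0), mul_add, mul_sub, mul_smul_comm,
          mul_smul_comm]
        module

theorem constantCoeff_heis_one (n : ℤ) :
    constantCoeff (heis q n 1) = if n = 0 then q else 0 := by
  rcases lt_trichotomy n 0 with hn | rfl | hn
  · rw [constantCoeff_heis_neg q hn, if_neg hn.ne]
  · rw [heis_zero, MvPolynomial.constantCoeff_smul]
    simp
  · rw [heis_one q hn, map_zero, if_neg hn.ne']

theorem sum_mul_reflect (p : ℕ) : ∑ j ∈ Finset.range (p - 1),
    ((j : ℂ) + 1) * ((p : ℂ) - (j + 1)) / 2 = ((p : ℂ) ^ 3 - p) / 12 := by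
  have key : ∀ (N : ℕ) (r : ℂ), ∑ j ∈ Finset.range N, ((j : ℂ) + 1) * (r - (j + 1)) / 2 =
      r * (N * (N + 1)) / 4 - N * (N + 1) * (2 * N + 1) / 12 := by
    intro N r
    induction N with
    | zero => simp
    | succ N ih =>
      rw [Finset.sum_range_succ, ih]
      push_cast
      ring
  rw [key]
  rcases Nat.eq_zero_or_pos p with rfl | hp
  · simp
  · rw [Nat.cast_sub hp]
    push_cast
    ring

/-- The vacuum expectation value that fixes the central charge: pairs of creation operators
contribute `(p ^ 3 - p) / 12`, as for `c = 1`, and the background charge contributes the correction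
`-6 β ^ 2`. -/
theorem constantCoeff_fockL_fockL {m p : ℤ} (hm : 0 < m) (hp : 0 < p) :
    constantCoeff (fockL q β m (fockL q β (-p) 1)) = if m = p then
      (2 * q + β * (1 - p)) * (p * q + β * (p ^ 2 + p) / 2) + (p ^ 3 - p) / 12 else 0 := by
  have hlin : constantCoeff (fockL q β m (heis q (-p) 1)) =
      if m = p then p * q + β * (p ^ 2 + p) / 2 else 0 := by
    rw [fockL_heis, fockL_one_pos q β hm, map_zero, map_add, map_sub, map_zero,
      MvPolynomial.constantCoeff_smul, MvPolynomial.constantCoeff_smul, constantCoeff_heis_one,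
      map_one]
    by_cases h : m = p
    · subst h
      simp
    · rw [if_neg (by lia), if_neg (by lia), if_neg h]
      simp
  have hquad : constantCoeff (fockL q β m (fockQuad q (-p) 1)) =
      if m = p then ((p : ℂ) ^ 3 - p) / 12 else 0 := by
    have hterm : ∀ j ∈ Finset.range ((-p).natAbs - 1), constantCoeff (fockL q β m
        (heis q ((-p).sign * ((j : ℤ) + 1)) (heis q (-p - (-p).sign * ((j : ℤ) + 1)) 1))) =
        if m = p then ((j : ℂ) + 1) * (p - (j + 1)) / 2 else 0 := by
      intro j hj
      rw [Finset.mem_range] at hj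
      have e : (-p).sign * ((j : ℤ) + 1) = -((j : ℤ) + 1) := by
        rw [Int.sign_eq_neg_one_of_neg (by lia), neg_one_mul]
      have h1 : constantCoeff (heis q (m + -((j : ℤ) + 1)) (heis q (-p - -((j : ℤ) + 1)) 1)) =
          if m = p then ((p : ℂ) - (j + 1)) / 2 else 0 := by
        rw [heis_comm, map_add, constantCoeff_heis_neg q (by lia),
          MvPolynomial.constantCoeff_smul, map_one, zero_add, smul_eq_mul, mul_one]
        by_cases h : m = p
        · subst h
          rw [if_pos (by lia), if_pos rfl]
          push_cast
          ring
        · rw [if_neg (by lia), if_neg h]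
      rw [e, fockL_heis, map_add, map_sub, constantCoeff_heis_neg q (n := -((j : ℤ) + 1)) (by lia),
        MvPolynomial.constantCoeff_smul, MvPolynomial.constantCoeff_smul, h1,
        constantCoeff_heis_neg q (by lia)]
      split_ifs
      · simp only [smul_eq_mul]
        push_cast
        ring
      · simp only [smul_eq_mul]
        push_cast
        ring
      · simp
      · simp
    rw [fockQuad_apply, map_sum, map_sum, Finset.sum_congr rfl hterm]
    split_ifs with h
    · have h2 := sum_mul_reflect p.natAbs
      have h3 : ((p.natAbs : ℕ) : ℂ) = p := by
        have : ((p.natAbs : ℕ) : ℤ) = p := by lia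
        rw [← Int.cast_natCast, this]
      rw [h3] at h2
      rwa [Int.natAbs_neg]
    · simp
  rw [fockL_apply q β (-p), Derivation.map_one_eq_zero, zero_add, map_add, map_smul, map_add, hquad,
    MvPolynomial.constantCoeff_smul, hlin, if_neg (show ¬ -p = 0 by lia)]
  split_ifs with h
  · rw [smul_eq_mul]
    push_cast
    ring
  · simp

/-- A Schur type argument. The defect `K` of the relation commutes with all `a_k`, so `K 1` is
killed by every annihilation operator and is a scalar. The scalar is its constant coefficient, which
vanishes, and then `K` vanishes on everything generated from the vacuum. -/
theorem fockL_isVirRep : IsVirRep (1 - 6 * β ^ 2) (fockL q β) := by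
  intro m n
  let c : ℂ := 1 - 6 * β ^ 2
  have hct : ∀ m n : ℤ, 0 < m → n ≤ 0 → constantCoeff (fockL q β m (fockL q β n 1)) =
      ((m : ℂ) - n) * constantCoeff (fockL q β (m + n) 1) + cocyc c m n := by
    intro m n hm hn
    rcases hn.eq_or_lt with rfl | hn
    · rw [fockL_one_zero, map_smul, add_zero, fockL_one_pos q β hm, cocyc_zero_right]
      simp
    · obtain ⟨p, rfl⟩ : ∃ p, n = -p := ⟨-n, by ring⟩
      rw [constantCoeff_fockL_fockL q β hm (by lia), constantCoeff_fockL_one, cocyc]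
      by_cases h : m = p
      · subst h
        rw [if_pos rfl, if_pos (by ring), if_pos (by ring)]
        simp only [c]
        push_cast
        ring
      · rw [if_neg h, if_neg (by lia), if_neg (by lia)]
        simp
  have hct0 : ∀ m n : ℤ, m ≤ 0 → 0 < n → constantCoeff (fockL q β m (fockL q β n 1)) = 0 := by
    intro m n _ hn
    rw [fockL_one_pos q β hn, map_zero, map_zero]
  let K : Fock →ₗ[ℂ] Fock := (fockL q β m).comp (fockL q β n) - (fockL q β n).comp (fockL q β m) -
    ((m : ℂ) - n) • fockL q β (m + n) - cocyc c m n • LinearMap.id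
  have hK : ∀ x, K x = fockL q β m (fockL q β n x) - fockL q β n (fockL q β m x) -
    ((m : ℂ) - n) • fockL q β (m + n) x - cocyc c m n • x := fun x => rfl
  have hcomm : ∀ (k : ℤ) x, K (heis q k x) = heis q k (K x) := by
    intro k x
    rw [hK, hK]
    simp only [fockL_heis, map_sub, map_add, map_smul]
    have e1 : m + (n + k) = m + n + k := by ring
    have e2 : n + (m + k) = m + n + k := by ring
    rw [e1, e2]
    by_cases h : m + n + k = 0
    · have hk : (k : ℂ) = -m - n := by
        have : (k : ℤ) = -m - n := by lia
        exact_mod_cast congrArg (Int.cast : ℤ → ℂ) this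
      simp only [if_pos h, hk]
      push_cast
      module
    · simp only [if_neg h]
      push_cast
      module
  have hK1 : K 1 = 0 := by
    have h1 : constantCoeff (K 1) = 0 := by
      rw [hK, map_sub, map_sub, map_sub, MvPolynomial.constantCoeff_smul,
        MvPolynomial.constantCoeff_smul, map_one constantCoeff, smul_eq_mul, smul_eq_mul,
        mul_one]
      rcases le_or_gt m 0 with hm | hm
      · rcases le_or_gt n 0 with hn | hn
        · simp only [constantCoeff_fockL_nonpos q β hm, constantCoeff_fockL_nonpos q β hn,
            constantCoeff_fockL_nonpos q β (add_nonpos hm hn), cocyc_nonpos c hm hn]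
          by_cases h : m + n = 0
          · obtain rfl : m = 0 := by lia
            obtain rfl : n = 0 := by lia
            simp
          · rw [if_neg h]
            ring
        · rw [hct0 m n hm hn, hct n m hn hm, cocyc_swap, add_comm n m]
          ring
      · rcases le_or_gt n 0 with hn | hn
        · rw [hct0 n m hn hm, hct m n hm hn]
          ring
        · rw [fockL_one_pos q β hm, fockL_one_pos q β hn, fockL_one_pos q β (add_pos hm hn),
            cocyc_of_ne c (by lia)]
          simp
    rw [eq_smul_one_of_heis_eq_zero q (x := K 1) fun k hk => by
      rw [← hcomm, heis_one q hk, map_zero], h1, zero_smul]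
  intro x
  have : K x = 0 := fock_ext (A := K) (B := 0) (by simpa using hK1) (fun i x hx => by
    rw [← heis_neg q, hcomm, hx, LinearMap.zero_apply, LinearMap.zero_apply, map_zero]) x
  rw [hK] at this
  rw [← sub_eq_zero, ← this]
  abel

end FockVirasoro

/-! ### Fock space realization of the target of the irregular vertex operator -/

section Shifted

open MvPolynomial (X constantCoeff)

variable (q β : ℂ)

theorem constantCoeff_fockL_one_apply (x : Fock) : constantCoeff (fockL q β 1 x) =
    (2 * q + 2 * β) * constantCoeff (heis q 1 x) := by
  induction x using fock_induction with
  | hone => rw [constantCoeff_fockL_one, heis_one q one_pos]; simp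
  | hsmul r x hx =>
    simp only [map_smul, MvPolynomial.constantCoeff_smul, hx, smul_eq_mul]
    ring
  | hadd x y hx hy => simp only [map_add, hx, hy, mul_add]
  | hX i x hx =>
    rw [fockL_X_mul, heis_X_mul]
    simp only [map_add, map_mul, MvPolynomial.constantCoeff_X, zero_mul,
      MvPolynomial.constantCoeff_smul, zero_add, smul_eq_mul]
    rcases Nat.eq_zero_or_pos i with rfl | hi
    · have e : (1 : ℤ) - (0 : ℕ) - 1 = 0 := by norm_num
      rw [if_pos (by norm_num), if_pos (by norm_num), e, heis_zero,
        MvPolynomial.constantCoeff_smul, smul_eq_mul]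
      push_cast
      ring
    · rw [if_neg (by lia), if_neg (by lia), constantCoeff_heis_neg q (by lia)]
      ring

theorem constantCoeff_fockL_two_apply (x : Fock) : constantCoeff (fockL q β 2 x) =
    (2 * q + 3 * β) * constantCoeff (heis q 2 x) + constantCoeff (heis q 1 (heis q 1 x)) := by
  induction x using fock_induction with
  | hone => rw [constantCoeff_fockL_one, heis_one q one_pos, heis_one q two_pos]; simp
  | hsmul r x hx =>
    simp only [map_smul, MvPolynomial.constantCoeff_smul, hx, smul_eq_mul]
    ring
  | hadd x y hx hy =>
    simp only [map_add, hx, hy]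
    ring
  | hX i x hx =>
    rw [fockL_X_mul, heis_X_mul, heis_X_mul, map_add (heis q 1), heis_X_mul, map_smul (heis q 1)]
    simp only [map_add, map_mul, MvPolynomial.constantCoeff_X, zero_mul,
      MvPolynomial.constantCoeff_smul, zero_add, smul_eq_mul]
    obtain rfl | rfl | hi : i = 0 ∨ i = 1 ∨ 1 < i := by lia
    · have e : (2 : ℤ) - (0 : ℕ) - 1 = 1 := by norm_num
      rw [if_neg (by norm_num), if_neg (by norm_num), if_pos (by norm_num), e]
      push_cast
      ring
    · have e : (2 : ℤ) - (1 : ℕ) - 1 = 0 := by norm_num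
      rw [if_pos (by norm_num), if_pos (by norm_num), if_neg (by norm_num), e, heis_zero,
        MvPolynomial.constantCoeff_smul, smul_eq_mul]
      push_cast
      ring
    · rw [if_neg (by lia), if_neg (by lia), if_neg (by lia), constantCoeff_heis_neg q (by lia)]
      ring

/-- The Virasoro operators after the translation of `a_1` by `1 / 2`. -/
def shiftL (m : ℤ) : Fock →ₗ[ℂ] Fock :=
  fockL q β m + heis q (m - 1) +
    ((if m = 2 then 1 / 4 else 0) + (if m = 1 then β else 0) : ℂ) • LinearMap.id

theorem shiftL_apply (m : ℤ) (x : Fock) : shiftL q β m x = fockL q β m x + heis q (m - 1) x +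
    ((if m = 2 then 1 / 4 else 0) + (if m = 1 then β else 0) : ℂ) • x := rfl

/-- Adding `1/2` to `a_1` preserves the Heisenberg relations. In `∑ :a_r a_{m-r}: + β (m + 1) a_m`
it produces `a_{m-1}`, the constant `1/4` for `m = 2` and the constant `β` for `m = 1`. -/
theorem shiftL_isVirRep : IsVirRep (1 - 6 * β ^ 2) (shiftL q β) := by
  intro m n x
  have h1 := fockL_isVirRep q β m n x
  have h2 := fockL_heis q β m (n - 1) x
  have h3 := fockL_heis q β n (m - 1) x
  have h4 := heis_comm q (m - 1) (n - 1) x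
  have e1 : m + (n - 1) = m + n - 1 := by ring
  have e2 : n + (m - 1) = m + n - 1 := by ring
  rw [e1] at h2
  rw [e2] at h3
  simp only [shiftL_apply, map_add, map_smul, h2, h3, h4]
  rw [sub_eq_iff_eq_add] at h1
  rw [h1]
  rcases eq_or_ne (m + n) 1 with h | h
  · have hn : (n : ℂ) = 1 - m := by
      have : n = 1 - m := by lia
      rw [this]
      push_cast
      ring
    simp only [if_pos (show m + n - 1 = 0 by lia), if_neg (show ¬ m - 1 + (n - 1) = 0 by lia),
      if_neg (show ¬ m + n = 2 by lia), if_pos h]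
    push_cast
    rw [hn]
    module
  · rcases eq_or_ne (m + n) 2 with h' | h'
    · have hn : (n : ℂ) = 2 - m := by
        have : n = 2 - m := by lia
        rw [this]
        push_cast
        ring
      simp only [if_neg (show ¬ m + n - 1 = 0 by lia), if_pos (show m - 1 + (n - 1) = 0 by lia),
        if_pos h', if_neg h]
      push_cast
      rw [hn]
      module
    · simp only [if_neg (show ¬ m + n - 1 = 0 by lia),
        if_neg (show ¬ m - 1 + (n - 1) = 0 by lia), if_neg h', if_neg h]
      push_cast
      module

theorem shiftL_heis (m n : ℤ) (x : Fock) : shiftL q β m (heis q n x) =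
    heis q n (shiftL q β m x) - (n : ℂ) • heis q (m + n) x +
      ((if m + n = 0 then β * (m ^ 2 + m) / 2 else 0) +
        (if m - 1 + n = 0 then ((m : ℂ) - 1) / 2 else 0)) • x := by
  simp only [shiftL_apply, map_add, map_smul, fockL_heis, heis_comm q (m - 1) n]
  push_cast
  module

theorem shiftL_vac_one : shiftL q β 1 1 = (q + β) • 1 := by
  rw [shiftL_apply, fockL_one_pos q β one_pos, sub_self, heis_zero, if_neg (by norm_num),
    if_pos rfl]
  module

theorem shiftL_vac_two : shiftL q β 2 1 = (1 / 4 : ℂ) • 1 := by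
  rw [shiftL_apply, fockL_one_pos q β two_pos, heis_one q (by norm_num), if_pos rfl,
    if_neg (by norm_num)]
  module

theorem shiftL_vac_three {n : ℤ} (hn : 3 ≤ n) : shiftL q β n 1 = 0 := by
  rw [shiftL_apply, fockL_one_pos q β (by lia), heis_one q (by lia), if_neg (by lia),
    if_neg (by lia)]
  module

theorem constantCoeff_shiftL_zero (x : Fock) :
    constantCoeff (shiftL q β 0 x) = (q ^ 2 + β * q) * constantCoeff x := by
  rw [shiftL_apply, map_add, map_add, constantCoeff_fockL_nonpos q β le_rfl,
    constantCoeff_heis_neg q (by norm_num), MvPolynomial.constantCoeff_smul]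
  simp

theorem constantCoeff_shiftL_one (x : Fock) : constantCoeff (shiftL q β 1 x) =
    (2 * q + 2 * β) * constantCoeff (heis q 1 x) + (q + β) * constantCoeff x := by
  rw [shiftL_apply, map_add, map_add, constantCoeff_fockL_one_apply, sub_self, heis_zero,
    MvPolynomial.constantCoeff_smul, MvPolynomial.constantCoeff_smul, if_neg (by norm_num),
    if_pos rfl, smul_eq_mul, smul_eq_mul]
  ring

theorem constantCoeff_shiftL_two (x : Fock) : constantCoeff (shiftL q β 2 x) =
    (2 * q + 3 * β) * constantCoeff (heis q 2 x) + constantCoeff (heis q 1 (heis q 1 x)) +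
      constantCoeff (heis q 1 x) + 1 / 4 * constantCoeff x := by
  have e : (2 : ℤ) - 1 = 1 := by norm_num
  rw [shiftL_apply, map_add, map_add, constantCoeff_fockL_two_apply, e,
    MvPolynomial.constantCoeff_smul, if_pos rfl, if_neg (by norm_num), smul_eq_mul]
  ring

/-- A vector on which `L_2` acts as on the vacuum, and `L_1` up to a multiple of the vacuum, is a
multiple of the vacuum. -/
theorem eq_smul_fock_vac {x : Fock} {σ : ℂ} (h1 : shiftL q β 1 x = (q + β) • x + σ • 1)
    (h2 : shiftL q β 2 x = (1 / 4 : ℂ) • x) : x = constantCoeff x • 1 ∧ σ = 0 := by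
  have h3 := whittaker_of_lower (shiftL_isVirRep q β) (shiftL_vac_two q β)
    (fun n hn => shiftL_vac_three q β hn) h1 h2
  obtain ⟨k, hk⟩ := exists_mem_fockFil x
  have hx : x = constantCoeff x • 1 := by
    let χ : ℤ → ℂ := fun m => if m = 2 then 1 / 4 else 0
    refine eq_smul_one_of_mem_span (mem_span_of_lower_eq_zero
      (Y := fun n => (2 : ℂ) • (shiftL q β (n + 2) - χ (n + 2) • LinearMap.id))
      (fun i => Nat.succ_pos i) ?_ ?_ ?_ hk ⟨0, fun N _ => ?_⟩)
    · intro n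
      rw [LinearMap.smul_apply, LinearMap.sub_apply, LinearMap.smul_apply, LinearMap.id_apply]
      by_cases hn : n = 0
      · subst hn
        rw [Nat.cast_zero, zero_add, shiftL_vac_two]
        simp [χ]
      · rw [shiftL_vac_three q β (by lia)]
        simp [χ, hn]
    · intro n p k x hx
      -- The commutator of `L_{n+2}` with `a_{-(n+1)}` is `(n + 1) a_1` plus the scalar `(n + 1) /
      -- 2` that comes from the translation. The factor `2` in `Y` normalizes this scalar to the
      -- weight `n + 1`.
      have h := shiftL_heis q β (n + 2) (-((p : ℤ) + 1)) x
      rw [heis_neg, heis_neg] at h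
      have e : ((2 : ℂ) • (shiftL q β (n + 2) - χ (n + 2) • LinearMap.id) : Fock →ₗ[ℂ] Fock)
            (LinearMap.mulLeft ℂ (X p) x) - LinearMap.mulLeft ℂ (X p)
            (((2 : ℂ) • (shiftL q β (n + 2) - χ (n + 2) • LinearMap.id) : Fock →ₗ[ℂ] Fock) x) -
            (if n = p then ((p + 1 : ℕ) : ℂ) else 0) • x =
          (2 * ((p : ℂ) + 1)) • heis q ((n : ℤ) + 2 + -((p : ℤ) + 1)) x +
          (2 * (if (n : ℤ) + 2 + -((p : ℤ) + 1) = 0 then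
            β * (((n : ℤ) + 2 : ℤ) ^ 2 + ((n : ℤ) + 2 : ℤ)) / 2 else 0)) • x := by
        simp only [LinearMap.smul_apply, LinearMap.sub_apply, LinearMap.id_apply,
          LinearMap.mulLeft_apply, h, mul_sub, mul_smul_comm]
        by_cases hnp : n = p
        · subst hnp
          rw [if_pos (show (n : ℤ) + 2 - 1 + -((n : ℤ) + 1) = 0 by ring), if_pos rfl]
          push_cast
          module
        · rw [if_neg (show ¬ (n : ℤ) + 2 - 1 + -((p : ℤ) + 1) = 0 by lia), if_neg hnp]
          push_cast
          module
      have goal : ((2 : ℂ) • (shiftL q β (n + 2) - χ (n + 2) • LinearMap.id) : Fock →ₗ[ℂ] Fock)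
            (LinearMap.mulLeft ℂ (X p) x) - LinearMap.mulLeft ℂ (X p)
            (((2 : ℂ) • (shiftL q β (n + 2) - χ (n + 2) • LinearMap.id) : Fock →ₗ[ℂ] Fock) x) -
            (if n = p then ((p + 1 : ℕ) : ℂ) else 0) • x ∈
            fockFil (k + (p + 1 : ℕ) - (n + 1 : ℕ) - 1) := by
        rw [e]
        refine add_mem (Submodule.smul_mem _ _ ?_) ?_
        · exact wordFil_mono (by push_cast; lia) (heis_mem_fockFil q _ hx)
        · split_ifs with h0
          · exact Submodule.smul_mem _ _ (wordFil_mono (by push_cast; lia) hx)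
          · rw [mul_zero, zero_smul]
            exact zero_mem _
      exact goal
    · intro n p k x hx
      simp only [LinearMap.mulLeft_apply]
      rw [mul_left_comm, sub_self]
      exact zero_mem _
    · refine Finset.sum_eq_zero fun n _ => ?_
      rw [LinearMap.smul_apply, LinearMap.sub_apply, LinearMap.smul_apply, LinearMap.id_apply]
      by_cases hn : n = 0
      · subst hn
        rw [Nat.cast_zero, zero_add, h2]
        simp [χ]
      · rw [h3 _ (by lia)]
        simp [χ, hn]
  refine ⟨hx, ?_⟩
  rw [hx, map_smul, shiftL_vac_one, smul_comm, left_eq_add, smul_eq_zero] at h1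
  exact h1.resolve_right one_ne_zero

end Shifted

/-! ### Coherent series -/

section Coherent

open MvPolynomial (X constantCoeff)

/-- The series `∑ P_i ε ^ i` is an eigenvector of `a_n`, `n > 0`; the eigenvalue of `a_1` is
`f * ε` and the one of `a_n`, `n > 1`, is `ε ^ (n - 1) / 2 + f * ε ^ n`. -/
structure IsCoherent (q f : ℂ) (P : ℤ → Fock) : Prop where
  neg : ∀ i < 0, P i = 0
  zero : P 0 = 1
  heis : ∀ n : ℤ, 0 < n → ∀ i, heis q n (P i) =
    (if n = 1 then 0 else 1 / 2 : ℂ) • P (i - n + 1) + f • P (i - n)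

/-- The coefficients of the logarithmic derivative of the coherent series. -/
def coherentLog (f : ℂ) (k : ℕ) : Fock :=
  (((k : ℂ) + 1) / (k + 2)) • X (k + 1) + (2 * f) • X k

/-- The coefficients of the coherent series. -/
def coherentCoeff (f : ℂ) : ℕ → Fock
  | 0 => 1
  | i + 1 => ((i : ℂ) + 1)⁻¹ • ∑ k : Fin (i + 1), coherentLog f k * coherentCoeff f (i - k)
  decreasing_by lia

theorem heis_coherentLog_mul (q f : ℂ) (k : ℕ) (n : ℤ) (x : Fock) :
    heis q n (coherentLog f k * x) = coherentLog f k * heis q n x +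
      ((if (k : ℤ) = n - 2 then ((n : ℂ) - 1) / 2 else 0) +
        (if (k : ℤ) = n - 1 then f * n else 0)) • x := by
  simp only [coherentLog, add_mul, smul_mul_assoc, map_add, map_smul, heis_X_mul]
  have hk : (k : ℂ) + 2 ≠ 0 := by exact_mod_cast Nat.succ_ne_zero (k + 1)
  by_cases h1 : (k : ℤ) = n - 2
  · obtain rfl : n = k + 2 := by lia
    rw [if_pos (by push_cast; ring), if_neg (by lia), if_pos (by ring), if_neg (by lia)]
    push_cast
    match_scalars
    · ring
    · field_simp
      ring
    · ring
  · rw [if_neg (by push_cast; lia), if_neg h1]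
    by_cases h2 : (k : ℤ) = n - 1
    · obtain rfl : n = k + 1 := by lia
      rw [if_pos rfl, if_pos (by ring)]
      push_cast
      module
    · rw [if_neg (by lia), if_neg h2]
      module

/-- As `a_n` is `(n / 2) ∂/∂X_{n-1}`, the series with eigenvalues `λ_n` is `exp (∑ (2 / n) λ_n
X_{n-1})`. The recursion `i P_i = ∑ coherentLog k * P_{i-1-k}` is its derivative in `ε`, and the
eigenvalue equations follow from it by induction on `i`. -/
theorem exists_coherent (q f : ℂ) : ∃ P, IsCoherent q f P := by
  let P : ℤ → Fock := fun i => if i < 0 then 0 else coherentCoeff f i.toNat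
  have hneg : ∀ i < 0, P i = 0 := fun i hi => if_pos hi
  have hzero : P 0 = 1 := by simp [P, coherentCoeff]
  have hnat : ∀ i : ℕ, P i = coherentCoeff f i := fun i => by simp [P]
  have hrec : ∀ (i : ℤ) (N : ℕ), i ≤ N →
      (i : ℂ) • P i = ∑ k ∈ Finset.range N, coherentLog f k * P (i - 1 - k) := by
    intro i N hN
    rcases le_or_gt i 0 with hi | hi
    · rw [Finset.sum_eq_zero fun k _ => by rw [hneg _ (by lia), mul_zero]]
      rcases hi.eq_or_lt with rfl | hi
      · simp
      · rw [hneg i hi, smul_zero]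
    · obtain ⟨j, rfl⟩ : ∃ j : ℕ, i = ((j + 1 : ℕ) : ℤ) := ⟨(i - 1).toNat, by lia⟩
      rw [hnat, coherentCoeff, Fin.sum_univ_eq_sum_range
        (fun k => coherentLog f k * coherentCoeff f (j - k)) (j + 1), smul_smul]
      have hj : (j : ℂ) + 1 ≠ 0 := Nat.cast_add_one_ne_zero j
      have e : (((j + 1 : ℕ) : ℤ) : ℂ) * ((j : ℂ) + 1)⁻¹ = 1 := by
        push_cast
        exact mul_inv_cancel₀ hj
      rw [e, one_smul]
      have hsub : Finset.range (j + 1) ⊆ Finset.range N :=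
        Finset.range_subset_range.mpr (by lia)
      rw [← Finset.sum_subset hsub fun k _ hk => by
        rw [Finset.mem_range, not_lt] at hk
        rw [hneg _ (by push_cast; lia), mul_zero]]
      refine Finset.sum_congr rfl fun k hk => ?_
      rw [Finset.mem_range] at hk
      have e2 : ((j + 1 : ℕ) : ℤ) - 1 - k = ((j - k : ℕ) : ℤ) := by lia
      rw [e2, hnat]
  refine ⟨P, hneg, hzero, fun n hn i => ?_⟩
  obtain ⟨N, hN⟩ : ∃ N : ℕ, i ≤ N := ⟨i.toNat, by lia⟩
  induction N using Nat.strong_induction_on generalizing i with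
  | _ N ih =>
    rcases le_or_gt i 0 with hi | hi
    · have h1 : heis q n (P i) = 0 := by
        rcases hi.eq_or_lt with rfl | hi
        · rw [hzero, heis_one q hn]
        · rw [hneg i hi, map_zero]
      rw [h1, hneg (i - n) (by lia), smul_zero, add_zero]
      split_ifs with h
      · rw [zero_smul]
      · rw [hneg _ (by lia), smul_zero]
    · have hi0 : (i : ℂ) ≠ 0 := by exact_mod_cast hi.ne'
      have hsum : ∀ (t : ℤ) (r : ℂ), 0 ≤ t ∨ r = 0 → ∑ k ∈ Finset.range N,
          (if (k : ℤ) = t then r else 0) • P (i - 1 - k) = r • P (i - 1 - t) := by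
        intro t r ht
        rcases ht with ht | rfl
        · obtain ⟨j, rfl⟩ : ∃ j : ℕ, t = j := ⟨t.toNat, by lia⟩
          simp only [Nat.cast_inj, ite_smul, zero_smul]
          rw [Finset.sum_ite_eq']
          split_ifs with hj
          · rfl
          · rw [Finset.mem_range, not_lt] at hj
            rw [hneg _ (by lia), smul_zero]
        · simp
      have h1 : heis q n ((i : ℂ) • P i) =
          ∑ k ∈ Finset.range N, coherentLog f k *
            ((if n = 1 then 0 else 1 / 2 : ℂ) • P (i - n + 1 - 1 - k) + f • P (i - n - 1 - k)) +
          (∑ k ∈ Finset.range N, (if (k : ℤ) = n - 2 then ((n : ℂ) - 1) / 2 else 0) • P (i - 1 - k) +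
          ∑ k ∈ Finset.range N, (if (k : ℤ) = n - 1 then f * n else 0) • P (i - 1 - k)) := by
        rw [hrec i N hN, map_sum, ← Finset.sum_add_distrib, ← Finset.sum_add_distrib]
        refine Finset.sum_congr rfl fun k hk => ?_
        have e1 : i - 1 - (k : ℤ) - n + 1 = i - n + 1 - 1 - k := by ring
        have e2 : i - 1 - (k : ℤ) - n = i - n - 1 - k := by ring
        rw [heis_coherentLog_mul, ih (N - 1) (by lia) (i - 1 - k) (by lia), e1, e2, add_smul]
      have h2 : (i : ℂ) • heis q n (P i) = (i : ℂ) •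
          ((if n = 1 then 0 else 1 / 2 : ℂ) • P (i - n + 1) + f • P (i - n)) := by
        rw [← map_smul, h1, hsum (n - 1) _ (Or.inl (by lia)), hsum (n - 2) _ (by
          by_cases h : n = 1
          · right; rw [h]; simp
          · left; lia)]
        simp only [mul_add, mul_smul_comm, Finset.sum_add_distrib, ← Finset.smul_sum]
        rw [← hrec (i - n + 1) N (by lia), ← hrec (i - n) N (by lia)]
        have e1 : i - 1 - (n - 2) = i - n + 1 := by ring
        have e2 : i - 1 - (n - 1) = i - n := by ring
        rw [e1, e2]
        split_ifs with h
        · rw [h]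
          push_cast
          module
        · push_cast
          module
      exact smul_right_injective _ hi0 h2

variable {q f : ℂ}

/-- If the earlier coefficients vanish, `ψ i` is killed by all annihilation operators and equals its
constant coefficient. Identities between series obtained from a coherent one can thus be checked on
commutators with `a_n` and on constant coefficients. -/
theorem eq_zero_of_coherent {ψ : ℤ → Fock} (hneg : ∀ i < 0, ψ i = 0)
    (hψ : ∀ n : ℤ, 0 < n → ∀ i, heis q n (ψ i) =
      (if n = 1 then 0 else 1 / 2 : ℂ) • ψ (i - n + 1) + f • ψ (i - n))
    (h0 : ∀ i, constantCoeff (ψ i) = 0) (i : ℤ) : ψ i = 0 := by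
  obtain ⟨N, hN⟩ : ∃ N : ℕ, i < N := ⟨(i + 1).toNat, by lia⟩
  induction N generalizing i with
  | zero => exact hneg i hN
  | succ N ih =>
    rw [eq_smul_one_of_heis_eq_zero q (x := ψ i) fun n hn => ?_, h0, zero_smul]
    rw [hψ n hn, ih (i - n) (by lia), smul_zero, add_zero]
    split_ifs with h
    · rw [zero_smul]
    · rw [ih _ (by lia), smul_zero]

variable {P : ℤ → Fock}

/-- With the translated `a_1`, the eigenvalues `ε ^ (n - 1) (1/2 + f ε)` form a geometric
progression. In `L_1 - ε L_0` the terms `a_{-r} a_{r+1}` and `ε a_{-r} a_r` therefore cancel, and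
only scalars remain. -/
theorem IsCoherent.shiftL_one (hP : IsCoherent q f P) (β : ℂ) (i : ℤ) :
    shiftL q β 1 (P i) = (q + β) • P i + shiftL q β 0 (P (i - 1)) +
      ((2 * q + 2 * β) * f - (q ^ 2 + β * q)) • P (i - 1) := by
  rw [← sub_eq_zero]
  refine eq_zero_of_coherent (q := q) (f := f) (ψ := fun i => shiftL q β 1 (P i) -
    ((q + β) • P i + shiftL q β 0 (P (i - 1)) +
      ((2 * q + 2 * β) * f - (q ^ 2 + β * q)) • P (i - 1))) ?_ ?_ ?_ i
  · intro i hi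
    simp only [hP.neg i hi, hP.neg (i - 1) (by lia), map_zero, smul_zero, add_zero, sub_zero]
  · intro n hn i
    have h1 := shiftL_heis q β 1 n (P i)
    have h0 := shiftL_heis q β 0 n (P (i - 1))
    rw [if_neg (by lia), if_neg (by lia), hP.heis n hn, hP.heis (1 + n) (by lia),
      if_neg (show ¬ 1 + n = 1 by lia)] at h1
    rw [if_neg (by lia), zero_add n, hP.heis n hn] at h0
    have e1 : i - (1 + n) + 1 = i - n := by ring
    have e2 : i - (1 + n) = i - n - 1 := by ring
    have e3 : i - 1 - n + 1 = i - n := by ring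
    have e4 : i - 1 - n = i - n - 1 := by ring
    have e5 : i - n + 1 - 1 = i - n := by ring
    have e6 : i - n - 1 + 1 = i - n := by ring
    rw [e1, e2] at h1
    rw [e3, e4] at h0
    simp only [map_add, map_smul] at h1 h0
    simp only [map_sub, map_add, map_smul, hP.heis n hn, e4, e5, e6]
    have h1' := sub_eq_zero.mpr h1
    have h0' := sub_eq_zero.mpr h0
    rw [← sub_eq_zero]
    by_cases h : n = 1
    · subst h
      simp only [if_true] at h1' h0' ⊢
      rw [if_pos (by norm_num)] at h0'
      rw [← sub_zero (0 : Fock)]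
      nth_rewrite 1 [← h0']
      rw [← h1']
      push_cast
      module
    · simp only [if_neg h] at h1' h0' ⊢
      rw [if_neg (by lia)] at h0'
      rw [← sub_zero (0 : Fock)]
      nth_rewrite 1 [← h0']
      rw [← h1']
      module
  · intro i
    simp only [map_sub, map_add, MvPolynomial.constantCoeff_smul, constantCoeff_shiftL_one,
      constantCoeff_shiftL_zero, hP.heis 1 one_pos, if_true, smul_eq_mul]
    ring

/-- The same cancellation in `L_2 - ε ^ 2 L_0`; the additional term `a_1 ^ 2` contributes `(1/2 + f
ε) ^ 2`. -/
theorem IsCoherent.shiftL_two (hP : IsCoherent q f P) (β : ℂ) (i : ℤ) :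
    shiftL q β 2 (P i) = (1 / 4 : ℂ) • P i + ((2 * q + 3 * β) / 2 + f) • P (i - 1) +
      shiftL q β 0 (P (i - 2)) +
      ((2 * q + 3 * β) * f + f ^ 2 - (q ^ 2 + β * q)) • P (i - 2) := by
  rw [← sub_eq_zero]
  refine eq_zero_of_coherent (q := q) (f := f) (ψ := fun i => shiftL q β 2 (P i) -
    ((1 / 4 : ℂ) • P i + ((2 * q + 3 * β) / 2 + f) • P (i - 1) + shiftL q β 0 (P (i - 2)) +
      ((2 * q + 3 * β) * f + f ^ 2 - (q ^ 2 + β * q)) • P (i - 2))) ?_ ?_ ?_ i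
  · intro i hi
    simp only [hP.neg i hi, hP.neg (i - 1) (by lia), hP.neg (i - 2) (by lia), map_zero, smul_zero,
      add_zero, sub_zero]
  · intro n hn i
    have h1 := shiftL_heis q β 2 n (P i)
    have h0 := shiftL_heis q β 0 n (P (i - 2))
    rw [if_neg (by lia), if_neg (by lia), hP.heis n hn, hP.heis (2 + n) (by lia),
      if_neg (show ¬ 2 + n = 1 by lia)] at h1
    rw [if_neg (by lia), zero_add n, hP.heis n hn] at h0
    have e1 : i - (2 + n) + 1 = i - n - 1 := by ring
    have e2 : i - (2 + n) = i - n - 2 := by ring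
    have e3 : i - 2 - n + 1 = i - n - 1 := by ring
    have e4 : i - 2 - n = i - n - 2 := by ring
    have e5 : i - n + 1 - 1 = i - n := by ring
    have e6 : i - n + 1 - 2 = i - n - 1 := by ring
    have e7 : i - n - 1 + 1 = i - n := by ring
    have e8 : i - 1 - n = i - n - 1 := by ring
    have e9 : i - n - 2 + 1 = i - n - 1 := by ring
    rw [e1, e2] at h1
    rw [e3, e4] at h0
    simp only [map_add, map_smul] at h1 h0
    simp only [map_sub, map_add, map_smul, hP.heis n hn, e4, e5, e6, e7, e8, e9]
    have h1' := sub_eq_zero.mpr h1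
    have h0' := sub_eq_zero.mpr h0
    rw [← sub_eq_zero]
    by_cases h : n = 1
    · subst h
      have e10 : i - 1 - 1 = i - 2 := by ring
      simp only [if_true, e10] at h1' h0' ⊢
      rw [if_pos (by norm_num)] at h0'
      rw [← sub_zero (0 : Fock)]
      nth_rewrite 1 [← h0']
      rw [← h1']
      push_cast
      module
    · simp only [if_neg h] at h1' h0' ⊢
      rw [if_neg (by lia)] at h0'
      rw [← sub_zero (0 : Fock)]
      nth_rewrite 1 [← h0']
      rw [← h1']
      module
  · intro i
    have e : i - 1 - 1 = i - 2 := by ring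
    have e2 : i - 2 + 1 = i - 1 := by ring
    have h1 : ∀ i, ConfBlock.heis q 1 (P i) = f • P (i - 1) := fun i => by
      rw [hP.heis 1 one_pos, if_pos rfl, zero_smul, zero_add]
    simp only [map_sub, map_add, map_smul, MvPolynomial.constantCoeff_smul,
      constantCoeff_shiftL_two, constantCoeff_shiftL_zero, h1, hP.heis 2 two_pos, e, e2,
      smul_eq_mul]
    rw [if_neg (by norm_num)]
    ring

end Coherent

/-! ### The obstruction to the regularity of the rescaled block -/

section Defect

variable {c : ℂ}

/-- Operators that act on `x : Low 0` as a deformation of `opT`, if they do so on `1`. -/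
theorem lowHom_deformed {V : Type*} [AddCommGroup V] [Module ℂ V] {ρ : ℤ → V →ₗ[ℂ] V}
    (hρ : IsVirRep c ρ) {z w w₂ : ℤ → Low 0} {φ φ₁ φ₂ : V} {M : ℤ}
    (h : ∀ m ≤ M, ρ m φ =
      lowHom 0 hρ (z m) φ + lowHom 0 hρ (w m) φ₁ + lowHom 0 hρ (w₂ m) φ₂)
    (x : Low 0) : ∀ m ≤ M, ρ m (lowHom 0 hρ x φ) = lowHom 0 hρ (opT c 0 z m x) φ +
      lowHom 0 hρ (opS c 0 w m x) φ₁ + lowHom 0 hρ (opS c 0 w₂ m x) φ₂ := by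
  induction x using Low.induction with
  | hone => intro m hm; simpa using h m hm
  | hsmul r x hx =>
    intro m hm
    simp only [map_smul, LinearMap.smul_apply, hx m hm, smul_add]
  | hadd x y hx hy =>
    intro m hm
    simp only [map_add, LinearMap.add_apply, hx m hm, hy m hm]
    abel
  | hgen p x hx =>
    intro m hm
    have h1 := hρ m (-((p : ℤ) + (0 : ℕ))) (lowHom 0 hρ x φ)
    have e : m + -((p : ℤ) + (0 : ℕ)) = m - p - (0 : ℕ) := by ring
    rw [e, hx m hm, hx (m - p - (0 : ℕ)) (by lia), sub_eq_iff_eq_add] at h1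
    rw [lowHom_gen_mul, h1, opT_gen_mul, opS_gen_mul, opS_gen_mul]
    simp only [map_add, map_smul, LinearMap.add_apply, LinearMap.smul_apply, lowHom_gen_mul]
    push_cast
    module

variable {q β : ℂ}

/-- The lowest nonzero coefficient of `T` below order `n` is a multiple of the vacuum, and
subtracting that multiple of the shifted homogeneous solution `Y` removes it. Once `T` starts at
order `n`, `T n` satisfies `L_1 T n = (q + β) T n - S 1` and `L_2 T n = T n / 4`, which forces `S =
0`. -/
theorem eq_zero_of_fock_defect {T Y : ℤ → Fock} {u₁ u₂ u₃ S : ℂ} {n : ℤ} (hn : 0 ≤ n)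
    (hT : ∀ i < 0, T i = 0) (hY : ∀ i < 0, Y i = 0) (hY0 : Y 0 = 1)
    (h1 : ∀ e ≤ n, shiftL q β 1 (T e) = (q + β) • T e + shiftL q β 0 (T (e - 1)) +
      u₁ • T (e - 1) - (if e = n then S else 0) • 1)
    (h2 : ∀ e ≤ n, shiftL q β 2 (T e) = (1 / 4 : ℂ) • T e + u₂ • T (e - 1) +
      shiftL q β 0 (T (e - 2)) + u₃ • T (e - 2))
    (hY1 : ∀ e, shiftL q β 1 (Y e) = (q + β) • Y e + shiftL q β 0 (Y (e - 1)) + u₁ • Y (e - 1))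
    (hY2 : ∀ e, shiftL q β 2 (Y e) = (1 / 4 : ℂ) • Y e + u₂ • Y (e - 1) +
      shiftL q β 0 (Y (e - 2)) + u₃ • Y (e - 2)) : S = 0 := by
  have hkernel : ∀ (T : ℤ → Fock) (k : ℤ), (∀ i < k, T i = 0) → k ≤ n →
      (∀ e ≤ n, shiftL q β 1 (T e) = (q + β) • T e + shiftL q β 0 (T (e - 1)) +
        u₁ • T (e - 1) - (if e = n then S else 0) • 1) →
      (∀ e ≤ n, shiftL q β 2 (T e) = (1 / 4 : ℂ) • T e + u₂ • T (e - 1) +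
        shiftL q β 0 (T (e - 2)) + u₃ • T (e - 2)) →
      (∃ r : ℂ, T k = r • 1) ∧ (if k = n then S else 0) = 0 := by
    intro T k hT hk h1 h2
    obtain ⟨h, hσ⟩ := eq_smul_fock_vac q β (x := T k) (σ := -(if k = n then S else 0))
      (by rw [h1 k hk, hT (k - 1) (by lia), map_zero, smul_zero, neg_smul, add_zero, add_zero,
        sub_eq_add_neg])
      (by rw [h2 k hk, hT (k - 1) (by lia), hT (k - 2) (by lia), map_zero, smul_zero, smul_zero,
        add_zero, add_zero, add_zero])
    exact ⟨⟨_, h⟩, neg_eq_zero.mp hσ⟩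
  have key : ∀ k : ℕ, (k : ℤ) ≤ n → ∃ T : ℤ → Fock, (∀ i < (k : ℤ), T i = 0) ∧
      (∀ e ≤ n, shiftL q β 1 (T e) = (q + β) • T e + shiftL q β 0 (T (e - 1)) +
        u₁ • T (e - 1) - (if e = n then S else 0) • 1) ∧
      (∀ e ≤ n, shiftL q β 2 (T e) = (1 / 4 : ℂ) • T e + u₂ • T (e - 1) +
        shiftL q β 0 (T (e - 2)) + u₃ • T (e - 2)) := by
    intro k
    induction k with
    | zero => exact fun _ => ⟨T, hT, h1, h2⟩
    | succ k ih =>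
      intro hk
      obtain ⟨T, hT, h1, h2⟩ := ih (by lia)
      obtain ⟨⟨r, hr⟩, -⟩ := hkernel T k hT (by lia) h1 h2
      refine ⟨fun e => T e - r • Y (e - k), fun i hi => ?_, fun e he => ?_, fun e he => ?_⟩
      · rcases (show i ≤ k by lia).eq_or_lt with rfl | hi
        · simp only [hr, sub_self, hY0]
        · simp only [hT i hi, hY (i - k) (by lia), smul_zero, sub_self]
      · have e1 : e - 1 - (k : ℤ) = e - k - 1 := by ring
        simp only [map_sub, map_smul, h1 e he, hY1 (e - k), e1]
        module
      · have e1 : e - 1 - (k : ℤ) = e - k - 1 := by ring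
        have e2 : e - 2 - (k : ℤ) = e - k - 2 := by ring
        simp only [map_sub, map_smul, h2 e he, hY2 (e - k), e1, e2]
        module
  obtain ⟨m, rfl⟩ : ∃ m : ℕ, n = m := ⟨n.toNat, by lia⟩
  obtain ⟨T, hT, h1, h2⟩ := key m le_rfl
  simpa using (hkernel T m hT le_rfl h1 h2).2

variable {θs ν : ℂ}

/-- If `φ` satisfies the deformed Whittaker relations with neighbours `φ₁` and `φ₂`, then letting
`x` act on `φ` carries the lowering operators of the model, with their `1 / Λ` corrections, to the
Virasoro operators of any representation. -/
theorem lowHom_lower {V : Type*} [AddCommGroup V] [Module ℂ V] {ρ : ℤ → V →ₗ[ℂ] V}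
    (hρ : IsVirRep c ρ) {φ φ₁ φ₂ : V}
    (h1 : ρ 1 φ = targetChar θs ν • φ + ρ 0 φ₁ + (θs ^ 2 / 4 - ν ^ 2) • φ₁)
    (h2 : ρ 2 φ = (1 / 4 : ℂ) • φ + (θs - ν) • φ₁ + ρ 0 φ₂ +
      ((c - 1) / 24 + θs ^ 2 / 2 - ν ^ 2) • φ₂) (x : Low 0) :
    ρ 1 (lowHom 0 hρ x φ) = lowHom 0 hρ (lowerA c θs ν 1 x) φ + lowHom 0 hρ (lowerB₁ c θs ν x) φ₁ +
        targetChar θs ν • lowHom 0 hρ x φ + ρ 0 (lowHom 0 hρ x φ₁) +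
        (θs ^ 2 / 4 - ν ^ 2) • lowHom 0 hρ x φ₁ ∧
      ρ 2 (lowHom 0 hρ x φ) = lowHom 0 hρ (lowerA c θs ν 2 x) φ +
        lowHom 0 hρ (lowerB₂ c θs ν x) φ₁ + lowHom 0 hρ (lowerC c θs ν x) φ₂ +
        (1 / 4 : ℂ) • lowHom 0 hρ x φ + (θs - ν) • lowHom 0 hρ x φ₁ + ρ 0 (lowHom 0 hρ x φ₂) +
        ((c - 1) / 24 + θs ^ 2 / 2 - ν ^ 2) • lowHom 0 hρ x φ₂ := by
  have hg : ∀ y, lowHom 0 hρ (Low.gen 0 0) y = ρ 0 y := fun y => by simp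
  have hbase : ∀ m ≤ (2 : ℤ), ρ m φ = lowHom 0 hρ (whitBase₀ (targetChar θs ν) (1 / 4) m) φ +
      lowHom 0 hρ (corrBase θs ν m) φ₁ + lowHom 0 hρ (corrBase₂ c θs ν m) φ₂ := by
    intro m hm
    simp only [corrBase, corrBase₂, Pi.add_apply]
    rcases le_or_gt m 0 with h | h
    · obtain ⟨p, rfl⟩ : ∃ p : ℕ, m = -((p : ℤ) + (0 : ℕ)) := ⟨(-m).toNat, by lia⟩
      rw [whitBase₀, isBase_whitBase, Pi.single_eq_of_ne (by lia), Pi.single_eq_of_ne (by lia),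
        Pi.single_eq_of_ne (by lia), lowHom_gen]
      simp
    · obtain rfl | rfl : m = 1 ∨ m = 2 := by lia
      · rw [whitBase₀_pos _ _ h, whitChar, if_pos rfl, Pi.single_eq_same,
          Pi.single_eq_of_ne (by norm_num), Pi.single_eq_of_ne (by norm_num), h1]
        simp
        abel
      · rw [whitBase₀_pos _ _ h, whitChar, if_neg (by norm_num), if_pos rfl, Pi.single_eq_same,
          Pi.single_eq_same, Pi.single_eq_of_ne (by norm_num), h2]
        simp
        abel
  have key := lowHom_deformed hρ hbase x
  have hmul : ∀ y, lowHom 0 hρ (Low.gen 0 0 * x) y = ρ 0 (lowHom 0 hρ x y) := fun y => by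
    rw [map_mul, Module.End.mul_apply, hg]
  constructor
  · rw [key 1 (by norm_num), opS_corrBase₂_one, lowerA_one_apply, lowerB₁, targetT]
    simp only [map_sub, map_smul, map_zero, LinearMap.sub_apply, LinearMap.smul_apply,
      LinearMap.zero_apply, LinearMap.id_apply, lowMul_apply, hmul]
    abel
  · rw [key 2 le_rfl, lowerA_two_apply, lowerB₂, lowerC, targetT]
    simp only [map_sub, map_smul, LinearMap.sub_apply, LinearMap.smul_apply, LinearMap.id_apply,
      lowMul_apply, hmul]
    abel

/-- The product of the series `∑ Z_j ε ^ j`, cut off at `j = N`, and `∑ φ_i ε ^ i`. -/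
def convSeries {V : Type*} [AddCommGroup V] [Module ℂ V] (A : Low 0 →ₗ[ℂ] Module.End ℂ V) (N : ℕ)
    (Z : ℤ → Low 0) (φ : ℤ → V) (e : ℤ) : V := ∑ j ∈ Finset.range (N + 1), A (Z j) (φ (e - j))

/-- Up to order `N` the cutoff is invisible, so a shift of one factor may be replaced by a shift of
the other. -/
theorem convSeries_shift {V : Type*} [AddCommGroup V] [Module ℂ V]
    {A : Low 0 →ₗ[ℂ] Module.End ℂ V} {N : ℕ} {Z : ℤ → Low 0} {φ : ℤ → V} (hZ : ∀ j < 0, Z j = 0)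
    (hφ : ∀ i < 0, φ i = 0) {e : ℤ} (he : e ≤ N) :
    convSeries A N Z φ (e - 1) = convSeries A N (fun j => Z (j - 1)) φ e := by
  unfold convSeries
  rw [Finset.sum_range_succ, Finset.sum_range_succ', hφ (e - 1 - N) (by lia)]
  beta_reduce
  rw [hZ (((0 : ℕ) : ℤ) - 1) (by norm_num), map_zero, map_zero, LinearMap.zero_apply]
  congr 1
  refine Finset.sum_congr rfl fun j _ => ?_
  congr 2
  · congr 1
    push_cast
    ring
  · push_cast
    ring

/-- The equations are those of the family at `t = Λ`, with a source `S` in the single order `n`.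
Letting `∑ Z_j ε ^ j` act on a coherent series in the Fock space gives a solution with the same
source, which `eq_zero_of_fock_defect` compares with a homogeneous one. -/
theorem eq_zero_of_defect {Z : ℤ → Low 0} {S : ℂ} {n : ℤ} (hn : 0 < n)
    (hneg : ∀ e < 0, Z e = 0)
    (h1 : ∀ e ≤ n, lowerA c θs ν 1 (Z e) + lowerB₁ c θs ν (Z (e - 1)) =
      -(irrPower θs ν • Z (e - 1)) - (if e = n then S else 0) • 1)
    (h2 : ∀ e ≤ n, lowerA c θs ν 2 (Z e) + lowerB₂ c θs ν (Z (e - 1)) +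
      lowerC c θs ν (Z (e - 2)) = -(irrRate θs ν • Z (e - 1)) -
        (3 / 2 * irrPower θs ν) • Z (e - 2)) : S = 0 := by
  -- Over `ℂ` every central charge has the form `1 - 6 β ^ 2`, so the Fock realization is available
  -- for all `c`.
  obtain ⟨β, hβ⟩ : ∃ β : ℂ, β ^ 2 = (1 - c) / 6 := IsAlgClosed.exists_pow_nat_eq _ two_pos
  obtain rfl : c = 1 - 6 * β ^ 2 := by
    rw [hβ]
    ring
  -- The charge is chosen so that `q + β` is the `L_1`-eigenvalue of the Whittaker vector.
  set q : ℂ := θs / 2 - ν - β with hq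
  -- With the parameter `(θs - β) / 2`, the scalars in `shiftL_one` and `shiftL_two` are those of
  -- the deformed Whittaker relations.
  obtain ⟨φ, hφ⟩ := exists_coherent q ((θs - β) / 2)
  -- Lowering the parameter by `irrRate` changes the scalar in `L_1` by `-irrPower` and those in
  -- `L_2` by `-irrRate` and `-3/2 irrPower`. These are the coefficients on the right of `h1` and
  -- `h2`, so `Y` solves the homogeneous system.
  obtain ⟨Y, hY⟩ := exists_coherent q ((θs - β) / 2 - irrRate θs ν)
  have hρ := shiftL_isVirRep q β
  obtain ⟨N, rfl⟩ : ∃ N : ℕ, n = N := ⟨n.toNat, by lia⟩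
  let A := lowHom 0 hρ
  let B : (ℤ → Low 0) → ℤ → Fock := fun Z => convSeries A.toLinearMap N Z φ
  have hB : ∀ Z e, B Z e = ∑ j ∈ Finset.range (N + 1), A (Z j) (φ (e - j)) := fun _ _ => rfl
  have hshift : ∀ Z : ℤ → Low 0, (∀ j < 0, Z j = 0) → ∀ e ≤ (N : ℤ),
      B Z (e - 1) = B (fun j => Z (j - 1)) e := fun Z hZ e he => convSeries_shift hZ hφ.neg he
  have hlow := fun (i : ℤ) (x : Low 0) => lowHom_lower (θs := θs) (ν := ν) hρ (φ := φ i)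
    (φ₁ := φ (i - 1)) (φ₂ := φ (i - 2))
    (by
      rw [hφ.shiftL_one β i, hq, targetChar]
      module)
    (by
      rw [hφ.shiftL_two β i, hq]
      module) x
  have e1 : ∀ e j : ℤ, e - j - 1 = e - 1 - j := fun e j => by ring
  have e2 : ∀ e j : ℤ, e - j - 2 = e - 2 - j := fun e j => by ring
  have hZ1 : ∀ j < 0, Z (j - 1) = 0 := fun j hj => hneg _ (by lia)
  have hB1 : ∀ e ≤ (N : ℤ), B (fun j => lowerA (1 - 6 * β ^ 2) θs ν 1 (Z j)) e +
      B (fun j => lowerB₁ (1 - 6 * β ^ 2) θs ν (Z j)) (e - 1) =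
      -(irrPower θs ν • B Z (e - 1)) - (if e = (N : ℤ) then S else 0) • 1 := by
    intro e he
    rw [hshift _ (fun j hj => by rw [hneg j hj, map_zero]) e he, hshift Z hneg e he, hB, hB, hB,
      ← Finset.sum_add_distrib, Finset.smul_sum, ← Finset.sum_neg_distrib]
    have hlast : (if e = (N : ℤ) then S else 0) • (1 : Fock) =
        ∑ j ∈ Finset.range (N + 1), (if (j : ℤ) = N then S else 0) • φ (e - j) := by
      rw [Finset.sum_range_succ, Finset.sum_eq_zero, zero_add, if_pos rfl]
      · split_ifs with h
        · rw [h, sub_self, hφ.zero]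
        · rw [hφ.neg _ (by lia), zero_smul, smul_zero]
      · intro j hj
        rw [Finset.mem_range] at hj
        rw [if_neg (by lia), zero_smul]
    rw [hlast, ← Finset.sum_sub_distrib]
    refine Finset.sum_congr rfl fun j hj => ?_
    rw [Finset.mem_range] at hj
    rw [← LinearMap.add_apply, ← map_add, h1 j (by lia)]
    simp only [map_sub, map_neg, map_smul, map_one, LinearMap.sub_apply, LinearMap.neg_apply,
      LinearMap.smul_apply, Module.End.one_apply]
  have hB2 : ∀ e ≤ (N : ℤ), B (fun j => lowerA (1 - 6 * β ^ 2) θs ν 2 (Z j)) e +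
      B (fun j => lowerB₂ (1 - 6 * β ^ 2) θs ν (Z j)) (e - 1) +
      B (fun j => lowerC (1 - 6 * β ^ 2) θs ν (Z j)) (e - 2) =
      -(irrRate θs ν • B Z (e - 1)) - (3 / 2 * irrPower θs ν) • B Z (e - 2) := by
    intro e he
    have e3 : e - 2 = e - 1 - 1 := by ring
    rw [e3, hshift _ (fun j hj => by rw [hneg j hj, map_zero]) e he, hshift Z hneg e he,
      hshift _ (fun j hj => by rw [hneg j hj, map_zero]) (e - 1) (by lia),
      hshift Z hneg (e - 1) (by lia),
      hshift _ (fun j hj => by rw [hZ1 j hj, map_zero]) e he, hshift _ hZ1 e he, hB, hB, hB, hB, hB,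
      ← Finset.sum_add_distrib, ← Finset.sum_add_distrib, Finset.smul_sum, Finset.smul_sum,
      ← Finset.sum_neg_distrib, ← Finset.sum_sub_distrib]
    refine Finset.sum_congr rfl fun j hj => ?_
    rw [Finset.mem_range] at hj
    have h := h2 j (by lia)
    have e4 : (j : ℤ) - 2 = j - 1 - 1 := by ring
    rw [e4] at h
    rw [← LinearMap.add_apply, ← map_add, ← LinearMap.add_apply, ← map_add, h]
    simp only [map_sub, map_neg, map_smul, LinearMap.sub_apply, LinearMap.neg_apply,
      LinearMap.smul_apply]
  refine eq_zero_of_fock_defect (q := q) (β := β) (T := B Z) (Y := Y) (n := N)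
    (u₁ := θs ^ 2 / 4 - ν ^ 2 - irrPower θs ν) (u₂ := θs - ν - irrRate θs ν)
    (u₃ := (1 - 6 * β ^ 2 - 1) / 24 + θs ^ 2 / 2 - ν ^ 2 - 3 / 2 * irrPower θs ν) hn.le
    (fun e he => ?_) hY.neg hY.zero (fun e he => ?_) (fun e he => ?_) (fun e => ?_) (fun e => ?_)
  · rw [hB]
    exact Finset.sum_eq_zero fun j _ => by rw [hφ.neg _ (by lia), map_zero]
  · have h : shiftL q β 1 (B Z e) = B (fun j => lowerA (1 - 6 * β ^ 2) θs ν 1 (Z j)) e +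
        B (fun j => lowerB₁ (1 - 6 * β ^ 2) θs ν (Z j)) (e - 1) + targetChar θs ν • B Z e +
        shiftL q β 0 (B Z (e - 1)) + (θs ^ 2 / 4 - ν ^ 2) • B Z (e - 1) := by
      simp only [hB, map_sum, Finset.smul_sum, ← Finset.sum_add_distrib]
      refine Finset.sum_congr rfl fun j _ => ?_
      rw [(hlow _ _).1, e1]
    rw [h, hB1 e he, hq, targetChar]
    module
  · have h : shiftL q β 2 (B Z e) = B (fun j => lowerA (1 - 6 * β ^ 2) θs ν 2 (Z j)) e +
        B (fun j => lowerB₂ (1 - 6 * β ^ 2) θs ν (Z j)) (e - 1) +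
        B (fun j => lowerC (1 - 6 * β ^ 2) θs ν (Z j)) (e - 2) + (1 / 4 : ℂ) • B Z e +
        (θs - ν) • B Z (e - 1) + shiftL q β 0 (B Z (e - 2)) +
        ((1 - 6 * β ^ 2 - 1) / 24 + θs ^ 2 / 2 - ν ^ 2) • B Z (e - 2) := by
      simp only [hB, map_sum, Finset.smul_sum, ← Finset.sum_add_distrib]
      refine Finset.sum_congr rfl fun j _ => ?_
      rw [(hlow _ _).2, e1, e2]
    rw [h, hB2 e he]
    module
  · rw [hY.shiftL_one β e, hq]
    simp only [irrRate, irrPower]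
    module
  · rw [hY.shiftL_two β e, hq]
    simp only [irrRate, irrPower]
    module

end Defect

/-! ### Regularity of the formal expansions -/

section Formal

variable {c θs ν Δt : ℂ} {v : ℤ → ℤ → Low 0}

/-- The lowest coefficient of `w k` below the diagonal is a multiple `r` of `1` by the equations of
its own order. The equation for `L_1` one order higher then has the source `-k r`, which must vanish
by `eq_smul_vac`. -/
theorem IsFormalFamily.eq_zero_of_add_neg (hv : IsFormalFamily c θs ν Δt v) (k i : ℤ)
    (hki : k + i < 0) : v k i = 0 := by
  have key : ∀ (n : ℕ) (k : ℤ), k = n → ∀ i, k + i < 0 → v k i = 0 := by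
    intro n
    induction n using Nat.strong_induction_on with
    | _ n ih =>
      intro k hkn
      rcases Nat.eq_zero_or_pos n with rfl | hn
      · intro i hi
        rw [hkn, Nat.cast_zero, hv.zero, if_neg (by lia)]
      have hprev : ∀ j < k, ∀ i, j + i < 0 → v j i = 0 := by
        intro j hj i hi
        rcases lt_or_ge j 0 with hj0 | hj0
        · exact hv.neg j hj0 i
        · exact ih j.toNat (by lia) j (by lia) i hi
      obtain ⟨N, hN⟩ := hv.bounded k
      have hi : ∀ (m : ℕ) (i : ℤ), i < N + m → k + i < 0 → v k i = 0 := by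
        intro m
        induction m with
        | zero => exact fun i hi _ => hN i (by simpa using hi)
        | succ m ihm =>
          intro i him hki
          have hbelow : ∀ j < i, v k j = 0 := fun j hj => ihm j (by push_cast at him; lia) (by lia)
          have e1 := hv.lower_one k i
          have e2 := hv.lower_two k i
          rw [hbelow (i - 1) (by lia), hprev (k - 1) (by lia) i (by lia)] at e1
          rw [hbelow (i - 1) (by lia), hbelow (i - 2) (by lia), hprev (k - 1) (by lia) i (by lia),
            hprev (k - 1) (by lia) (i - 1) (by lia), hprev (k - 2) (by lia) i (by lia)] at e2
          simp only [map_zero, smul_zero, add_zero, sub_zero] at e1 e2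
          obtain ⟨⟨r, hr⟩, -⟩ := eq_smul_vac (σ := 0) (by rw [e1, zero_smul]) e2
          have f1 := hv.lower_one k (i + 1)
          have f2 := hv.lower_two k (i + 1)
          have g1 : i + 1 - 1 = i := by ring
          have g2 : i + 1 - 2 = i - 1 := by ring
          rw [g1, hr, map_smul, lowerB₁_vac, hprev (k - 1) (by lia) (i + 1) (by lia)] at f1
          rw [g1, g2, hr, map_smul, lowerB₂_vac, hbelow (i - 1) (by lia),
            hprev (k - 1) (by lia) (i + 1) (by lia), hprev (k - 1) (by lia) i (by lia),
            hprev (k - 2) (by lia) (i + 1) (by lia)] at f2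
          simp only [map_zero, smul_zero, add_zero, sub_zero, zero_sub, smul_smul] at f1 f2
          have hσ := (eq_smul_vac (σ := -(k * r)) (by rw [f1, neg_smul]) f2).2
          have hk0 : (k : ℂ) ≠ 0 := by
            have : k ≠ 0 := by lia
            exact_mod_cast this
          have hr0 : r = 0 := (mul_eq_zero.mp (neg_eq_zero.mp hσ)).resolve_left hk0
          rw [hr, hr0, zero_smul]
      intro i hki
      exact hi (i - N + 1).toNat i (by lia) hki
  rcases lt_or_ge k 0 with hk | hk
  · exact hv.neg k hk i
  · exact key k.toNat k (by lia) i hki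

/-- The vector `L_0 1` serves to absorb a term `irrRate` in the `L_2` equation; the price in the
`L_1` equation is `2 * irrRate * targetChar`, which equals `irrPower`. -/
theorem lowerA_one_gen : lowerA c θs ν 1 (Low.gen 0 0) = targetChar θs ν • 1 := by
  have h := targetT_gen_mul (c := c) (θs := θs) (ν := ν) 1 0 1
  rw [mul_one, targetT_vac_one] at h
  have h2 : targetT c θs ν (1 - (0 : ℕ)) 1 = targetChar θs ν • 1 := targetT_vac_one
  have h3 : cocyc c 1 (-((0 : ℕ) : ℤ)) = 0 := by simpa using cocyc_zero_right c 1
  rw [lowerA_one_apply, h, h2, h3, mul_smul_comm, mul_one]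
  push_cast
  module

theorem lowerA_two_gen : lowerA c θs ν 2 (Low.gen 0 0) = (1 / 2 : ℂ) • 1 := by
  have h := targetT_gen_mul (c := c) (θs := θs) (ν := ν) 2 0 1
  have h2 : targetT c θs ν (2 - (0 : ℕ)) 1 = (1 / 4 : ℂ) • 1 := targetT_vac_two
  rw [mul_one, h2, targetT_vac_two] at h
  have h3 : cocyc c 2 (-((0 : ℕ) : ℤ)) = 0 := by simpa using cocyc_zero_right c 2
  rw [lowerA_two_apply, h, h3, mul_smul_comm, mul_one]
  push_cast
  module

/-- Induction on the diagonal `d = k + i`. On diagonal `n` the coefficients of positive powers of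
`Λ` are multiples `s k` of `1`, and the next diagonal shows that `k * s k` is constant. A further
equation is needed to make the constant zero; it comes from summing over whole diagonals. -/
theorem IsFormalFamily.eq_zero_of_pos (hv : IsFormalFamily c θs ν Δt v) (d k : ℤ) (hk : d < k) :
    v k (d - k) = 0 := by
  have key : ∀ (n : ℕ) (d : ℤ), d < n → ∀ k, d < k → v k (d - k) = 0 := by
    intro n
    induction n with
    | zero => exact fun d hd k _ => hv.eq_zero_of_add_neg k _ (by lia)
    | succ n ih =>
      intro d hd
      rcases lt_or_ge d n with hdn | hdn
      · exact ih d hdn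
      obtain rfl : d = n := by push_cast at hd; lia
      have hlow : ∀ k i : ℤ, k + i < n → 0 < -i → v k i = 0 := by
        intro k i h1 h2
        have := ih (k + i) h1 k (by lia)
        rwa [add_sub_cancel_left] at this
      have hconst : ∀ k : ℤ, ∃ s : ℂ, (n : ℤ) < k → v k (n - k) = s • 1 := by
        intro k
        by_cases hk : (n : ℤ) < k
        · have e1 := hv.lower_one k (n - k)
          have e2 := hv.lower_two k (n - k)
          rw [hlow k (n - k - 1) (by lia) (by lia), hlow (k - 1) (n - k) (by lia) (by lia)] at e1
          rw [hlow k (n - k - 1) (by lia) (by lia), hlow k (n - k - 2) (by lia) (by lia),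
            hlow (k - 1) (n - k) (by lia) (by lia), hlow (k - 1) (n - k - 1) (by lia) (by lia),
            hlow (k - 2) (n - k) (by lia) (by lia)] at e2
          simp only [map_zero, smul_zero, add_zero, sub_zero] at e1 e2
          obtain ⟨⟨r, hr⟩, -⟩ := eq_smul_vac (σ := 0) (by rw [e1, zero_smul]) e2
          exact ⟨r, fun _ => hr⟩
        · exact ⟨0, fun h => absurd h hk⟩
      choose s hs using hconst
      have hrec : ∀ k : ℤ, (n : ℤ) + 1 < k → (k : ℂ) * s k = (k - 1) * s (k - 1) := by
        intro k hk
        have e1 := hv.lower_one k (n + 1 - k)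
        have e2 := hv.lower_two k (n + 1 - k)
        have g1 : (n : ℤ) + 1 - k - 1 = n - k := by ring
        have g2 : (n : ℤ) + 1 - k - 2 = n - k - 1 := by ring
        have g3 : (n : ℤ) + 1 - k = n - (k - 1) := by ring
        have h3 : v (k - 1) (n + 1 - k) = s (k - 1) • 1 := by rw [g3]; exact hs (k - 1) (by lia)
        rw [g1, hs k (by lia), h3, map_smul, lowerB₁_vac] at e1
        rw [g1, g2, hs k (by lia), h3, map_smul, lowerB₂_vac, hlow k (n - k - 1) (by lia) (by lia),
          hlow (k - 2) (n + 1 - k) (by lia) (by lia), hlow (k - 1) (n - k) (by lia) (by lia)] at e2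
        simp only [map_zero, smul_zero, add_zero, sub_zero, zero_sub, smul_smul] at e1 e2
        -- Adding a multiple of `L_0 1` removes the `irrRate` term from the `L_2` equation and
        -- cancels `irrPower` in the `L_1` equation. The source left over, `(k - 1) s (k - 1) - k s
        -- k`, must vanish.
        have h4 := (eq_smul_vac (c := c) (θs := θs) (ν := ν)
          (x := v k (n + 1 - k) + (2 * irrRate θs ν * s (k - 1)) • Low.gen 0 0)
          (σ := (k - 1) * s (k - 1) - k * s k) (by
            rw [map_add, e1, map_smul, lowerA_one_gen, targetChar, irrPower, irrRate]
            module) (by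
            rw [map_add, e2, map_smul, lowerA_two_gen]
            module)).2
        linear_combination -h4
      have hS : (n + 1 : ℂ) * s (n + 1) = 0 := by
        let N : ℕ := n + 2
        -- Order by order in `1 / Λ`, this is the sum `∑ w_k t^{-k}` at `t = Λ`, cut off after `k =
        -- n + 1`. By induction the omitted terms are zero on the diagonals below `n`.
        let X : ℤ → Low 0 := fun e => ∑ k ∈ Finset.range N, v k (e - k)
        -- The term `k = n + 1` on diagonal `n`, a multiple of `1`, is taken out. The lowering
        -- operators do not notice this, but the term `-k v` of the recurrence leaves the source `(n
        -- + 1) * s (n + 1)` in order `n + 1`.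
        let Z : ℤ → Low 0 := fun e => X e - (if e = n then s (n + 1) else 0) • 1
        have hneg : ∀ e < 0, X e = 0 := fun e he => Finset.sum_eq_zero fun k _ =>
          hv.eq_zero_of_add_neg k (e - k) (by lia)
        have hlast : ∀ e ≤ (n : ℤ), v ((n + 1 : ℕ) : ℤ) (e - (n + 1 : ℕ)) =
            (if e = n then s (n + 1) else 0) • 1 := by
          intro e he
          split_ifs with h
          · rw [h, hs _ (by push_cast; lia)]
            push_cast
            rfl
          · rw [zero_smul]
            exact hlow _ _ (by push_cast; lia) (by push_cast; lia)
        have hZ : ∀ e ≤ (n : ℤ), Z e = ∑ k ∈ Finset.range (n + 1), v k (e - k) := by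
          intro e he
          simp only [Z, X, N]
          rw [Finset.sum_range_succ, hlast e he, add_sub_cancel_right]
        have hZX : ∀ e < (n : ℤ), Z e = X e := by
          intro e he
          simp only [Z]
          rw [if_neg he.ne, zero_smul, sub_zero]
        have hTZ : ∀ T : Low 0 →ₗ[ℂ] Low 0, T 1 = 0 → ∀ e, T (Z e) = T (X e) := by
          intro T hT e
          simp only [Z]
          rw [map_sub, map_smul, hT, smul_zero, sub_zero]
        refine eq_zero_of_defect (c := c) (θs := θs) (ν := ν) (Z := Z) (n := n + 1) (by lia) ?_
          ?_ ?_
        · intro e he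
          rw [hZX e (by lia), hneg e he]
        · intro e he
          have g : ∀ k : ℕ, e - 1 - k = e - k - 1 := fun k => by ring
          have h1 : lowerA c θs ν 1 (X e) + lowerB₁ c θs ν (X (e - 1)) =
              ∑ k ∈ Finset.range N, ((k : ℂ) - 1 - irrPower θs ν) • v (k - 1) (e - k) -
              ∑ k ∈ Finset.range N, (k : ℂ) • v k (e - 1 - k) := by
            simp only [X, map_sum, ← Finset.sum_add_distrib, ← Finset.sum_sub_distrib, g]
            exact Finset.sum_congr rfl fun k _ => hv.lower_one k (e - k)
          have h2 : ∑ k ∈ Finset.range N, ((k : ℂ) - 1 - irrPower θs ν) • v (k - 1) (e - k) =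
              ∑ k ∈ Finset.range (n + 1), ((k : ℂ) - irrPower θs ν) • v k (e - 1 - k) := by
            rw [Finset.sum_range_succ', hv.neg _ (by simp), smul_zero, add_zero]
            refine Finset.sum_congr rfl fun k _ => ?_
            have g1 : (((k + 1 : ℕ) : ℤ) - 1) = k := by push_cast; ring
            have g2 : (e - ((k + 1 : ℕ) : ℤ)) = e - 1 - k := by push_cast; ring
            rw [g1, g2]
            push_cast
            rw [add_sub_cancel_right]
          rw [hTZ _ (lowerA_vac c θs ν one_pos), hTZ _ (lowerB₁_vac c θs ν), h1, h2,
            hZ (e - 1) (by lia), Finset.sum_range_succ _ (n + 1), hlast (e - 1) (by lia),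
            Finset.smul_sum, ← sub_sub, ← Finset.sum_sub_distrib, ← Finset.sum_neg_distrib]
          congr 1
          · exact Finset.sum_congr rfl fun k _ => by module
          · by_cases h : e = n + 1
            · rw [if_pos (by lia), if_pos h, smul_smul]
              push_cast
              rfl
            · rw [if_neg (by lia), if_neg h, zero_smul, smul_zero]
        · intro e he
          have g : ∀ k : ℕ, e - 1 - k = e - k - 1 := fun k => by ring
          have g' : ∀ k : ℕ, e - 2 - k = e - k - 2 := fun k => by ring
          have h1 : lowerA c θs ν 2 (X e) + lowerB₂ c θs ν (X (e - 1)) +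
              lowerC c θs ν (X (e - 2)) =
              ∑ k ∈ Finset.range N, (Δt - irrPower θs ν + k - 2) • v (k - 2) (e - k) -
              irrRate θs ν • ∑ k ∈ Finset.range N, v (k - 1) (e - k) -
              confShift θs ν Δt • ∑ k ∈ Finset.range N, v (k - 1) (e - 1 - k) -
              ∑ k ∈ Finset.range N, (k : ℂ) • v k (e - 2 - k) := by
            simp only [X, map_sum, Finset.smul_sum, ← Finset.sum_add_distrib,
              ← Finset.sum_sub_distrib, g, g']
            exact Finset.sum_congr rfl fun k _ => hv.lower_two k (e - k)
          have h2 : ∀ e : ℤ, e ≤ n + 1 → ∑ k ∈ Finset.range N, v (k - 1) (e - k) = Z (e - 1) := by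
            intro e he
            rw [hZ (e - 1) (by lia), Finset.sum_range_succ', hv.neg _ (by simp), add_zero]
            refine Finset.sum_congr rfl fun k _ => ?_
            have g1 : (((k + 1 : ℕ) : ℤ) - 1) = k := by push_cast; ring
            have g2 : (e - ((k + 1 : ℕ) : ℤ)) = e - 1 - k := by push_cast; ring
            rw [g1, g2]
          have h3 : ∑ k ∈ Finset.range N, (Δt - irrPower θs ν + k - 2) • v (k - 2) (e - k) =
              ∑ k ∈ Finset.range N, (Δt - irrPower θs ν + k) • v k (e - 2 - k) := by
            rw [Finset.sum_range_succ', Finset.sum_range_succ', hv.neg _ (by simp),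
              hv.neg _ (by simp), smul_zero, add_zero, smul_zero, add_zero,
              Finset.sum_range_succ _ (n + 1), Finset.sum_range_succ _ n,
              hlow _ _ (by lia) (by lia),
              hlow _ _ (by push_cast; lia) (by push_cast; lia), smul_zero, add_zero, smul_zero,
              add_zero]
            refine Finset.sum_congr rfl fun k _ => ?_
            have g1 : (((k + 1 + 1 : ℕ) : ℤ) - 2) = k := by push_cast; ring
            have g2 : (e - ((k + 1 + 1 : ℕ) : ℤ)) = e - 2 - k := by push_cast; ring
            rw [g1, g2]
            push_cast
            congr 1
            ring
          have g2 : e - 1 - 1 = e - 2 := by ring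
          have h4 : Z (e - 2) = ∑ k ∈ Finset.range N, v k (e - 2 - k) := hZX _ (by lia)
          rw [hTZ _ (lowerA_vac c θs ν two_pos), hTZ _ (lowerB₂_vac c θs ν),
            hTZ _ (lowerC_vac c θs ν), h1, h2 e he, h2 (e - 1) (by lia), h3, g2,
            sub_right_comm _ _ (∑ k ∈ Finset.range N, (k : ℂ) • v k (e - 2 - k)),
            sub_right_comm _ _ (∑ k ∈ Finset.range N, (k : ℂ) • v k (e - 2 - k)),
            ← Finset.sum_sub_distrib]
          have h5 : ∑ k ∈ Finset.range N, ((Δt - irrPower θs ν + k) • v k (e - 2 - k) -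
              (k : ℂ) • v k (e - 2 - k)) = (Δt - irrPower θs ν) • Z (e - 2) := by
            rw [h4, Finset.smul_sum]
            exact Finset.sum_congr rfl fun k _ => by module
          rw [h5, confShift, irrPower]
          module
      have hall : ∀ m : ℕ, ((n + 1 + m : ℤ) : ℂ) * s (n + 1 + m) = 0 := by
        intro m
        induction m with
        | zero => simpa using hS
        | succ m ihm =>
          have h := hrec (n + 1 + (m + 1 : ℕ)) (by push_cast; lia)
          have e : (n : ℤ) + 1 + (m + 1 : ℕ) - 1 = n + 1 + m := by push_cast; ring
          rw [e] at h
          rw [h, ← ihm]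
          push_cast
          ring
      intro k hk
      have h := hall (k - n - 1).toNat
      have e : (n : ℤ) + 1 + (k - n - 1).toNat = k := by lia
      rw [e] at h
      have hk0 : (k : ℂ) ≠ 0 := by
        have : k ≠ 0 := by lia
        exact_mod_cast this
      rw [hs k hk, (mul_eq_zero.mp h).resolve_left hk0, zero_smul]
  exact key (d + 1).toNat d (by lia) k hk

theorem IsFormalFamily.eq_zero (hv : IsFormalFamily c θs ν Δt v) (k : ℤ) {i : ℤ} (hi : i < 0) :
    v k i = 0 := by
  have := hv.eq_zero_of_pos (k + i) k (by lia)
  rwa [add_sub_cancel_left] at this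

end Formal

/-! ### The irregular vertex operator -/

/-- The vectors `y k` are the coefficients of `t ^ (-k)` in the image of the Whittaker vector
under the irregular vertex operator. -/
structure IsIrregularSeq (c θs ν Δt : ℂ) (y : ℤ → Low 0) : Prop where
  neg : ∀ k < 0, y k = 0
  zero : y 0 = 1
  lower_one : ∀ k : ℤ, lowerA c θs ν 1 (y k) = (k - 1 - irrPower θs ν) • y (k - 1)
  lower_two : ∀ k : ℤ, lowerA c θs ν 2 (y k) =
    (Δt - irrPower θs ν + k - 2) • y (k - 2) - irrRate θs ν • y (k - 1)

/-! ### Uniqueness and existence of the irregular vertex operator -/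

section Seq

variable {c θs ν Δt : ℂ}

theorem IsFormalFamily.isIrregularSeq {v : ℤ → ℤ → Low 0} (hv : IsFormalFamily c θs ν Δt v) :
    IsIrregularSeq c θs ν Δt (fun k => v k 0) where
  neg k hk := hv.neg k hk 0
  zero := by simpa using hv.zero 0
  lower_one k := by
    have h := hv.lower_one k 0
    rw [hv.eq_zero k (i := 0 - 1) (by norm_num)] at h
    simpa using h
  lower_two k := by
    have h := hv.lower_two k 0
    rw [hv.eq_zero k (i := 0 - 1) (by norm_num), hv.eq_zero k (i := 0 - 2) (by norm_num),
      hv.eq_zero (k - 1) (i := 0 - 1) (by norm_num)] at h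
    simpa using h

/-- The first nonzero difference, in place `n > 0`, is a multiple `r` of `1`. The equations in place
`n + 1`, corrected by a multiple of `L_0 1`, are solvable only if `n * r = 0`. -/
theorem IsIrregularSeq.unique {y z : ℤ → Low 0} (hy : IsIrregularSeq c θs ν Δt y)
    (hz : IsIrregularSeq c θs ν Δt z) : y = z := by
  have key : ∀ (n : ℕ) (k : ℤ), k < n → y k - z k = 0 := by
    intro n
    induction n with
    | zero =>
      intro k hk
      rw [hy.neg k (by simpa using hk), hz.neg k (by simpa using hk), sub_zero]
    | succ n ih =>
      intro k hk
      rcases lt_or_ge k n with hkn | hkn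
      · exact ih k hkn
      obtain rfl : k = n := by push_cast at hk; lia
      rcases Nat.eq_zero_or_pos n with rfl | hn
      · rw [Nat.cast_zero, hy.zero, hz.zero, sub_self]
      have e1 : ∀ k : ℤ, lowerA c θs ν 1 (y k - z k) =
          (k - 1 - irrPower θs ν) • (y (k - 1) - z (k - 1)) := by
        intro k
        rw [map_sub, hy.lower_one, hz.lower_one, smul_sub]
      have e2 : ∀ k : ℤ, lowerA c θs ν 2 (y k - z k) =
          (Δt - irrPower θs ν + k - 2) • (y (k - 2) - z (k - 2)) -
            irrRate θs ν • (y (k - 1) - z (k - 1)) := by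
        intro k
        rw [map_sub, hy.lower_two, hz.lower_two]
        module
      obtain ⟨⟨r, hr⟩, -⟩ := eq_smul_vac (c := c) (θs := θs) (ν := ν) (x := y n - z n) (σ := 0)
        (by rw [e1, ih _ (by lia), smul_zero, zero_smul])
        (by rw [e2, ih _ (by lia), ih _ (by lia), smul_zero, smul_zero, sub_zero])
      have f1 := e1 (n + 1)
      have f2 := e2 (n + 1)
      have g1 : (n : ℤ) + 1 - 1 = n := by ring
      rw [g1, hr] at f1 f2
      rw [ih (n + 1 - 2) (by lia), smul_zero, zero_sub] at f2
      have h := (eq_smul_vac (c := c) (θs := θs) (ν := ν)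
        (x := (y (n + 1) - z (n + 1)) + (2 * irrRate θs ν * r) • Low.gen 0 0)
        (σ := n * r) (by
          rw [map_add, f1, map_smul, lowerA_one_gen, targetChar, irrPower, irrRate]
          push_cast
          module) (by
          rw [map_add, f2, map_smul, lowerA_two_gen]
          module)).2
      have hn0 : (n : ℂ) ≠ 0 := by exact_mod_cast hn.ne'
      rw [hr, (mul_eq_zero.mp h).resolve_left hn0, zero_smul]
  funext k
  exact sub_eq_zero.mp (key (k.toNat + 1) k (by lia))

/-- The representation of the Virasoro algebra on series with coefficients in the target. -/
abbrev irrRep (c θs ν Δt : ℂ) (n : ℤ) :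
    (ℤ → IrrTarget c θs ν) →ₗ[ℂ] (ℤ → IrrTarget c θs ν) :=
  vertexRep (fun m => braAct c whitSet (whitChar (θs / 2 - ν) (1 / 4)) (-m)) Δt
    (irrPower θs ν) (irrRate θs ν) n

theorem isVirRep_irrRep (c θs ν Δt : ℂ) : IsVirRep c (irrRep c θs ν Δt) :=
  isVirRep_vertexRep (isVirRep_braAct c whitSet _) _ _ _

theorem whitEquiv_irrRep (n : ℤ) (f : ℤ → IrrTarget c θs ν) (k : ℤ) :
    whitEquiv c (θs / 2 - ν) (1 / 4) (irrRep c θs ν Δt n f k) =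
      targetT c θs ν n (whitEquiv c _ _ (f k)) +
      ((k : ℂ) + n + irrPower θs ν + (1 - n) * Δt) • whitEquiv c _ _ (f (k + n)) +
      irrRate θs ν • whitEquiv c _ _ (f (k + n - 1)) := by
  rw [vertexRep_apply, map_add, map_add, map_smul, map_smul, whitEquiv_act, neg_neg]

theorem lower_one_iff {y : ℤ → Low 0} {f : ℤ → IrrTarget c θs ν}
    (hf : ∀ k, whitEquiv c (θs / 2 - ν) (1 / 4) (f k) = y (-k)) (k : ℤ) :
    irrRep c θs ν Δt 1 f (-k) = θs • f (-k) ↔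
      lowerA c θs ν 1 (y k) = (k - 1 - irrPower θs ν) • y (k - 1) := by
  rw [← (whitEquiv c (θs / 2 - ν) (1 / 4)).injective.eq_iff, whitEquiv_irrRep, map_smul, hf, hf, hf,
    neg_neg, lowerA_one_apply]
  have e1 : -(-k + 1) = k - 1 := by ring
  have e2 : -(-k + 1 - 1) = k := by ring
  rw [e1, e2, ← sub_eq_zero]
  have : targetT c θs ν 1 (y k) + (((-k : ℤ) : ℂ) + (1 : ℤ) + irrPower θs ν +
      (1 - (1 : ℤ)) * Δt) • y (k - 1) + irrRate θs ν • y k - θs • y k =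
      targetT c θs ν 1 (y k) - targetChar θs ν • y k - ((k : ℂ) - 1 - irrPower θs ν) • y (k - 1) := by
    -- The exponential rate makes up the difference of the `L_{-1}`-eigenvalues of source and
    -- target: `(θs/2 + ν) + (θs/2 - ν) = θs`.
    rw [irrRate, targetChar]
    push_cast
    module
  rw [this, sub_eq_zero]

theorem lower_two_iff {y : ℤ → Low 0} {f : ℤ → IrrTarget c θs ν}
    (hf : ∀ k, whitEquiv c (θs / 2 - ν) (1 / 4) (f k) = y (-k)) (k : ℤ) :
    irrRep c θs ν Δt 2 f (-k) = (1 / 4 : ℂ) • f (-k) ↔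
      lowerA c θs ν 2 (y k) =
        (Δt - irrPower θs ν + k - 2) • y (k - 2) - irrRate θs ν • y (k - 1) := by
  rw [← (whitEquiv c (θs / 2 - ν) (1 / 4)).injective.eq_iff, whitEquiv_irrRep, map_smul, hf, hf, hf,
    neg_neg, lowerA_two_apply]
  have e1 : -(-k + 2) = k - 2 := by ring
  have e2 : -(-k + 2 - 1) = k - 1 := by ring
  rw [e1, e2, ← sub_eq_zero]
  have : targetT c θs ν 2 (y k) + (((-k : ℤ) : ℂ) + (2 : ℤ) + irrPower θs ν +
      (1 - (2 : ℤ)) * Δt) • y (k - 2) + irrRate θs ν • y (k - 1) - (1 / 4 : ℂ) • y k =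
      targetT c θs ν 2 (y k) - (1 / 4 : ℂ) • y k -
      ((Δt - irrPower θs ν + k - 2) • y (k - 2) - irrRate θs ν • y (k - 1)) := by
    push_cast
    module
  rw [this, sub_eq_zero]

theorem IsIrregularVertexOperator.isIrregularSeq
    {W : IrrSource c θs →ₗ[ℂ] (ℤ → IrrTarget c θs ν)} (hW : IsIrregularVertexOperator c θs ν Δt W) :
    IsIrregularSeq c θs ν Δt (fun k => whitEquiv c (θs / 2 - ν) (1 / 4)
      (W (braVac c whitSet (whitChar θs (1 / 4))) (-k))) := by
  have h := (isVertexOperator_iff _ _ _ _ _ _).mp hW.1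
  have hf : ∀ k : ℤ, whitEquiv c (θs / 2 - ν) (1 / 4)
      (W (braVac c whitSet (whitChar θs (1 / 4))) k) = whitEquiv c (θs / 2 - ν) (1 / 4)
      (W (braVac c whitSet (whitChar θs (1 / 4))) (- -k)) := fun k => by rw [neg_neg]
  refine ⟨fun k hk => ?_, ?_, fun k => ?_, fun k => ?_⟩
  · rw [hW.2.2 _ (by lia), map_zero]
  · rw [neg_zero, hW.2.1, whitEquiv_vac]
  · refine (lower_one_iff (Δt := Δt) (y := fun k => whitEquiv c (θs / 2 - ν) (1 / 4)
      (W (braVac c whitSet (whitChar θs (1 / 4))) (-k))) hf k).mp ?_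
    have := h (-1) (braVac c whitSet (whitChar θs (1 / 4)))
    rw [braAct_vac c _ (show (-1 : ℤ) ∈ whitSet from by norm_num [whitSet]), whitChar, if_pos rfl,
      map_smul, neg_neg] at this
    exact (congrFun this (-k)).symm
  · refine (lower_two_iff (Δt := Δt) (y := fun k => whitEquiv c (θs / 2 - ν) (1 / 4)
      (W (braVac c whitSet (whitChar θs (1 / 4))) (-k))) hf k).mp ?_
    have := h (-2) (braVac c whitSet (whitChar θs (1 / 4)))
    rw [braAct_vac c _ (show (-2 : ℤ) ∈ whitSet from by norm_num [whitSet]), whitChar,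
      if_neg (by norm_num), if_pos rfl, map_smul, neg_neg] at this
    exact (congrFun this (-k)).symm

/-- A homomorphism from the source module is fixed by a vector satisfying the Whittaker relations.
The relations for `L_1` and `L_2` are the two recurrences, and the others follow by
`whittaker_of_lower` with `v = 0`. -/
theorem IsIrregularSeq.exists_vertexOperator {y : ℤ → Low 0} (hy : IsIrregularSeq c θs ν Δt y) :
    ∃ W, IsIrregularVertexOperator c θs ν Δt W := by
  let f : ℤ → IrrTarget c θs ν := fun k => (whitEquiv c (θs / 2 - ν) (1 / 4)).symm (y (-k))
  have hf : ∀ k, whitEquiv c (θs / 2 - ν) (1 / 4) (f k) = y (-k) :=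
    fun k => LinearEquiv.apply_symm_apply _ _
  have h1 : irrRep c θs ν Δt 1 f = θs • f := by
    funext k
    have := (lower_one_iff (Δt := Δt) hf (-k)).mpr (hy.lower_one (-k))
    rwa [neg_neg] at this
  have h2 : irrRep c θs ν Δt 2 f = (1 / 4 : ℂ) • f := by
    funext k
    have := (lower_two_iff (Δt := Δt) hf (-k)).mpr (hy.lower_two (-k))
    rwa [neg_neg] at this
  have h3 : ∀ n : ℤ, 3 ≤ n → irrRep c θs ν Δt n f = 0 :=
    whittaker_of_lower (isVirRep_irrRep c θs ν Δt) (v := 0) (σ := 0) (l₁ := θs) (l₂ := 1 / 4)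
      (by rw [map_zero, smul_zero]) (fun n _ => map_zero _) (by rw [h1, smul_zero, add_zero]) h2
  obtain ⟨W, hW1, hW2⟩ := exists_bra_hom (isVirRep_irrRep c θs ν Δt) (S := whitSet)
    (χ := whitChar θs (1 / 4)) (v := f) (by
      intro n hn
      have hn : n < 0 := hn
      rw [whitChar]
      split_ifs with h h'
      · rw [h]; exact h1
      · rw [h']; exact h2
      · rw [h3 (-n) (by lia), zero_smul])
  refine ⟨W, (isVertexOperator_iff _ _ _ _ _ _).mpr hW2, ?_, fun k hk => ?_⟩
  · rw [hW1]
    simp only [f]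
    rw [neg_zero, hy.zero, LinearEquiv.symm_apply_eq, whitEquiv_vac]
  · rw [hW1]
    simp only [f]
    rw [hy.neg _ (by lia), map_zero]

theorem IsIrregularVertexOperator.unique {W W' : IrrSource c θs →ₗ[ℂ] (ℤ → IrrTarget c θs ν)}
    (hW : IsIrregularVertexOperator c θs ν Δt W) (hW' : IsIrregularVertexOperator c θs ν Δt W') :
    W = W' := by
  have h := (isVertexOperator_iff _ _ _ _ _ _).mp hW.1
  have h' := (isVertexOperator_iff _ _ _ _ _ _).mp hW'.1
  refine LinearMap.ext fun u => ?_
  refine bra_induction (P := fun u => W u = W' u) ?_ ?_ ?_ ?_ u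
  · funext k
    have := congrFun (hW.isIrregularSeq.unique hW'.isIrregularSeq) (-k)
    simp only [neg_neg] at this
    exact (whitEquiv c (θs / 2 - ν) (1 / 4)).injective this
  · exact fun r x hx => by rw [map_smul, map_smul, hx]
  · exact fun x y hx hy => by rw [map_add, map_add, hx, hy]
  · exact fun n x hx => by rw [h, h', hx]

/-- On `|Δ₀⟩` the operator `L_0` is the number `Δ₀` and the `L_n`, `n > 0`, vanish. This is the
specialization `zeroChar`, so the irregular block and the limit of the regular ones are evaluated by
the same functional. -/
theorem pairing_ket_eq {Δ₀ : ℂ} {p : IrrTarget c θs ν →ₗ[ℂ] Module.Dual ℂ (Verma c Δ₀)}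
    (hp : IsCanonicalPairing c whitSet (whitChar (θs / 2 - ν) (1 / 4)) Δ₀ p)
    (u : IrrTarget c θs ν) :
    p u (ket c Δ₀) = zeroChar Δ₀ (whitEquiv c (θs / 2 - ν) (1 / 4) u) := by
  obtain ⟨x, rfl⟩ := (whitEquiv c (θs / 2 - ν) (1 / 4)).symm.surjective u
  rw [LinearEquiv.apply_symm_apply]
  induction x using Low.induction with
  | hone =>
    have : (whitEquiv c (θs / 2 - ν) (1 / 4)).symm 1 =
        braVac c whitSet (whitChar (θs / 2 - ν) (1 / 4)) := by
      rw [LinearEquiv.symm_apply_eq, whitEquiv_vac]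
    rw [this, hp.2, map_one]
  | hsmul r x hx => simp [hx]
  | hadd x y hx hy => simp [hx, hy]
  | hgen i x hx =>
    have : (whitEquiv c (θs / 2 - ν) (1 / 4)).symm (Low.gen 0 i * x) =
        braAct c whitSet (whitChar (θs / 2 - ν) (1 / 4)) i
          ((whitEquiv c (θs / 2 - ν) (1 / 4)).symm x) := by
      rw [LinearEquiv.symm_apply_eq, whitEquiv_act, LinearEquiv.apply_symm_apply]
      exact (targetT_nonpos i x).symm
    rw [this, hp.1, zeroChar_gen_mul]
    rcases Nat.eq_zero_or_pos i with rfl | hi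
    · rw [Nat.cast_zero, ketAct_ket_zero, map_smul, hx, if_pos rfl, smul_eq_mul]
    · rw [ketAct_ket_pos c _ (by exact_mod_cast hi), map_zero, if_neg hi.ne', zero_mul]

end Seq

end ConfBlock

end

theorem theoremA (c θs θt ν θ₀ : ℂ) :
    (∃! W : ConfBlock.IrrSource c θs →ₗ[ℂ] (ℤ → ConfBlock.IrrTarget c θs ν),
      ConfBlock.IsIrregularVertexOperator c θs ν (ConfBlock.dim c θt) W) ∧
    (∃! p : ConfBlock.IrrTarget c θs ν →ₗ[ℂ]
        Module.Dual ℂ (ConfBlock.Verma c (ConfBlock.dim c θ₀)),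
      ConfBlock.IsCanonicalPairing c ConfBlock.whitSet
        (ConfBlock.whitChar (θs / 2 - ν) (1 / 4)) (ConfBlock.dim c θ₀) p) ∧
    (∀ k : ℕ, ∀ᶠ Λ : ℂ in Bornology.cobounded ℂ,
      ∃! z : ℂ, ConfBlock.IsUBlockCoeff c θs θt ν θ₀ Λ k z) ∧
    ∃ D : ℕ → ℂ,
      (∀ k : ℕ, Tendsto
        (fun Λ : ℂ => PowerSeries.coeff k (ConfBlock.rescaledBlock c θs θt ν θ₀ Λ))
        (Bornology.cobounded ℂ) (𝓝 (D k))) ∧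
      ∀ (W : ConfBlock.IrrSource c θs →ₗ[ℂ] (ℤ → ConfBlock.IrrTarget c θs ν))
        (p : ConfBlock.IrrTarget c θs ν →ₗ[ℂ]
          Module.Dual ℂ (ConfBlock.Verma c (ConfBlock.dim c θ₀))),
        ConfBlock.IsIrregularVertexOperator c θs ν (ConfBlock.dim c θt) W →
        ConfBlock.IsCanonicalPairing c ConfBlock.whitSet
          (ConfBlock.whitChar (θs / 2 - ν) (1 / 4)) (ConfBlock.dim c θ₀) p →
        ConfBlock.irregularBlock c θs ν (ConfBlock.dim c θ₀) p W =
          { power := θs ^ 2 / 2 - 2 * ν ^ 2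
            rate := θs / 2 + ν
            coeff := ConfBlock.invSeries D } := by
  open ConfBlock in
  obtain ⟨hunique, w, hw, hcoeff⟩ := exists_confluentFamily c θs θt ν θ₀
  obtain ⟨v, hv, hwv⟩ := hw.exists_formal
  have hy := hv.isIrregularSeq
  obtain ⟨W₀, hW₀⟩ := hy.exists_vertexOperator
  refine ⟨⟨W₀, hW₀, fun W hW => hW.unique hW₀⟩, existsUnique_whittaker_pairing _ _ _ _, hunique,
    fun k => zeroChar (dim c θ₀) (v k 0), fun k => ?_, fun W p hW hp => ?_⟩
  -- No positive powers of `Λ` occur in the expansion of `w k`, so it converges to `v k 0` and its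
  -- image under `zeroChar` converges as well.
  · have h1 := sub_const_small (hwv k 0) fun i hi => by
      have := hwv k i
      rwa [hv.eq_zero k hi] at this
    have h2 := (small_tendsto (small_map (zeroChar (dim c θ₀)).toLinearMap h1)).add_const
      (zeroChar (dim c θ₀) (v k 0))
    rw [zero_add] at h2
    refine h2.congr' ?_
    filter_upwards [hcoeff k] with s hs
    rw [hs]
    simp
  · rw [irregularBlock]
    congr 1
    funext k
    -- The limits `v k 0` satisfy the defining recurrences of the coefficients of `W`, and these
    -- have only one solution.
    have h := congrFun (hW.isIrregularSeq.unique hy) (-k)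
    simp only [neg_neg] at h
    rw [pairing_ket_eq hp, h, invSeries]
    split_ifs with hk
    · rw [Int.toNat_of_nonneg (by lia)]
    · rw [hv.neg _ (by lia), map_zero]
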